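/- Let $K_n=(V,E)$ be the complete undirected graph on $n$ nodes and let $s\neq t$ be nodes. Let $SP(K_n,s,t)$ be the set of $x\in[0,1]^E$ such that $x(\delta(v))=1$ for $v\in\{s,t\}$, $x(\delta(v))=2$ for every other node $v$, and, for every $\emptyset\subsetneq S\subsetneq V$, $x(\delta(S))\ge 1$ if $|S\cap\{s,t\}|=1$ and $x(\delta(S))\ge 2$ otherwise; here $\delta(S)$ is the set of edges with exactly one end in $S$, $\delta(v)=\delta(\{v\})$ and $x(F)=\sum_{e\in F}x_e$. Let $SP^{\mathrm{int}}(K_n,s,t)$ be the set of its $0/1$ points (the Hamiltonian paths from $s$ to $t$). For $R\subseteq[0,1]^m$ let $\mathrm{cone}(R)=\{(\lambda,\lambda x):\lambda\ge 0,\ x\in R\}$, and let $N_+(R)$ be the set of $x\in[0,1]^m$ for which there is a symmetric positive semidefinite $(m+1)\times(m+1)$ matrix $X$, with rows and columns indexed by $0,\dots,m$ and rows $X_0,\dots,X_m$, such that $X_0=\mathrm{diag}(X)=(1,x)$ and $X_i,\ X_0-X_i\in\mathrm{cone}(R)$ for all $1\le i\le m$; $N_+^r$ is its $r$-fold iterate.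 An instance of the symmetric TSP path problem on $n$ nodes consists of $K_n$, distinct nodes $s,t$, and nonnegative edge distances $d=(d_e)_{e\in E}$ satisfying the triangle inequality. Theorem. After $o(n)$ rounds of $N_+$ applied to $SP(K_n,s,t)$, the integrality gap of the symmetric TSP path problem is at least $3/2-o(1)$. Precisely: for every $\varepsilon>0$ there are $\gamma>0$ and $N$ such that for all $n\ge N$ and all integers $0\le r\le\gamma n$ there is an instance on $n$ nodes with $$\frac{\min_{x\in SP^{\mathrm{int}}(K_n,s,t)} d\cdot x}{\min_{x\in N_+^r(SP(K_n,s,t))} d\cdot x}\ \ge\ \frac32-\varepsilon .$$ Moreover, $d$ can be taken to be the shortest-path metric of a connected unweighted undirected graph on the $n$ nodes. -/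

import Mathlib

noncomputable section

/-- The cone over `R ⊆ ℝ^ι`: all vectors `(l, l * x)` with `0 ≤ l` and `x ∈ R`.
The extra coordinate (called `0` in the literature) is indexed by `none`. -/
def coneOver {ι : Type*} (R : Set (ι → ℝ)) : Set (Option ι → ℝ) :=
  {y | ∃ l : ℝ, 0 ≤ l ∧ ∃ x ∈ R, y none = l ∧ ∀ i, y (some i) = l * x i}

/-- `X` is a positive semidefinite protection matrix for `x` with respect to `R`. -/
structure IsProtectionMatrix {ι : Type*} (R : Set (ι → ℝ)) (x : ι → ℝ)
    (X : Matrix (Option ι) (Option ι) ℝ) : Prop where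
  symm : X.IsSymm
  posSemidef : X.PosSemidef
  corner : X none none = 1
  row_zero : ∀ i, X none (some i) = x i
  diag : ∀ i, X (some i) (some i) = x i
  row_mem : ∀ i, X (some i) ∈ coneOver R
  sub_row_mem : ∀ i, X none - X (some i) ∈ coneOver R

/-- The Lovász–Schrijver operator `N₊`; its `r`-fold iterate is `lsPlus^[r]`. -/
def lsPlus {ι : Type*} (R : Set (ι → ℝ)) : Set (ι → ℝ) :=
  {x | (∀ i, x i ∈ Set.Icc (0 : ℝ) 1) ∧ ∃ X, IsProtectionMatrix R x X}

open scoped Classical in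
/-- `x(δ(S))`: the total `x`-weight of the edges of `G` with one end in `S` and the other outside. -/
def cutWeight {V : Type*} [Fintype V] {G : SimpleGraph V} (x : G.edgeSet → ℝ) (S : Finset V) : ℝ :=
  ∑ e : G.edgeSet, if ∃ u ∈ S, ∃ v ∉ S, (e : Sym2 V) = s(u, v) then x e else 0

open scoped Classical in
/-- The symmetric path polytope `SP(G, s, t)`. -/
structure IsSymPathPoint {V : Type*} [Fintype V] (G : SimpleGraph V) (s t : V)
    (x : G.edgeSet → ℝ) : Prop where
  cut_two : ∀ S : Finset V, S ≠ ∅ → S ≠ Finset.univ →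
    (S ∩ {s, t}).card ≠ 1 → 2 ≤ cutWeight x S
  cut_one : ∀ S : Finset V, S ≠ ∅ → S ≠ Finset.univ →
    (S ∩ {s, t}).card = 1 → 1 ≤ cutWeight x S
  degree_two : ∀ v, v ≠ s → v ≠ t → cutWeight x {v} = 2
  degree_source : cutWeight x {s} = 1
  degree_target : cutWeight x {t} = 1
  mem_Icc : ∀ e, x e ∈ Set.Icc (0 : ℝ) 1

/-- The symmetric path polytope `SP(G, s, t)` as a set. -/
def symPathPolytope {V : Type*} [Fintype V] (G : SimpleGraph V) (s t : V) :
    Set (G.edgeSet → ℝ) :=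
  {x | IsSymPathPoint G s t x}

/-- The 0/1 points of `SP(G, s, t)`, i.e. the hamiltonian `s`-`t` paths of `G`. -/
def symPathInt {V : Type*} [Fintype V] (G : SimpleGraph V) (s t : V) :
    Set (G.edgeSet → ℝ) :=
  {x | x ∈ symPathPolytope G s t ∧ ∀ e, x e = 0 ∨ x e = 1}

/-- An instance of the symmetric TSP path problem on the complete graph with node set `V`. Only the
values of `d` on the edges (unordered pairs of distinct nodes) matter. -/
structure SymPathInstance (V : Type*) where
  /-- the edge distances -/
  d : Sym2 V → ℝ
  nonneg : ∀ e, 0 ≤ d e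
  triangle : ∀ u v w, u ≠ v → v ≠ w → u ≠ w → d s(u, w) ≤ d s(u, v) + d s(v, w)
  /-- the first endpoint -/
  s : V
  /-- the last endpoint -/
  t : V
  s_ne_t : s ≠ t

namespace SymPathInstance

/-- The distances are the shortest-path distances of a connected unweighted undirected graph. -/
def IsGraphMetric {V : Type*} (I : SymPathInstance V) : Prop :=
  ∃ G : SimpleGraph V, G.Connected ∧ ∀ u v, I.d s(u, v) = (G.dist u v : ℝ)

open scoped Classical in
/-- The objective `d · x`. -/
def cost {V : Type*} [Fintype V] (I : SymPathInstance V)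
    (x : (⊤ : SimpleGraph V).edgeSet → ℝ) : ℝ :=
  ∑ e : (⊤ : SimpleGraph V).edgeSet, I.d e * x e

/-- The optimal value of the problem. -/
def intOpt {V : Type*} [Fintype V] (I : SymPathInstance V) : ℝ :=
  sInf (I.cost '' symPathInt ⊤ I.s I.t)

/-- The optimal value of the relaxation obtained by `r` rounds of `N₊` from the standard one. -/
def lsPlusOpt {V : Type*} [Fintype V] (I : SymPathInstance V) (r : ℕ) : ℝ :=
  sInf (I.cost '' (lsPlus^[r] (symPathPolytope ⊤ I.s I.t)))

/-- The integrality gap of the instance after `r` rounds of `N₊`. Whenever this real number is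
positive, both optimal values are positive, so no default value of `sInf` or of division enters. -/
def integralityGap {V : Type*} [Fintype V] (I : SymPathInstance V) (r : ℕ) : ℝ :=
  I.intOpt / I.lsPlusOpt r

end SymPathInstance

end

/-! The instance is the shortest-path metric of two small cliques (zones) joined by two paths with
about `ℓ` edges each; `s` lies in one zone, `t` in the other. Each zone also holds O(r) two-vertex
segments, so that `n = 2 * ℓ + O(r)`.

Integer optimum (`le_cost_of_mem_symPathInt`). Route every edge of a Hamiltonian path along a
shortest walk of the graph. Each of the `ℓ` levels between the zones separates `s` from `t`, so its
two path edges are traversed an odd number of times in total. Two levels cannot both be traversed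
just once: on either path the piece between the two levels has to be entered and left, which takes
two traversals per path and four altogether. Hence all levels but one carry at least three
traversals, and the cost is at least `3 * ℓ - 2`.

Relaxation. Give weight one to all path and segment edges. In each zone this leaves three special
free ends (`s` or `t`, and one end of each path) and the `N` ends of the segments. Spread one
further unit over each free end: weight `alphaW N` between special ends and segment ends, `betaW N`
between ends of different segments. All degree and cut constraints hold (`Conf.Good.pt_mem`): every
level is crossed by weight two, which violates only the parity. The point is supported on edges of
the graph, so it costs `n - 1`, which is about `2 * ℓ`.

Survival (`Conf.Good.pt_mem_iterate`), by induction on the number of rounds. The weights depend only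
on how the chosen edges form strands (`Conf`), and adding an edge between two free ends yields a
configuration of the same kind with fewer segments (`mergeA`, `mergeB`). A row of the protection
matrix is the point conditioned on one edge. For an edge at a special end this is the point after
one merge; for an edge between two segments it is a mixture `condB` of the points after one merge
and after a second random merge, in the proportion that makes the matrix symmetric (`mom_symm`). A
round thus uses up at most four segment ends of a zone, and O(r) segments suffice.

Two conditions remain. The complementary row of an edge is the sum of the rows of the other
fractional edges at one of its ends (`sum_row`), since every conditioned point has the same degrees.
For semidefiniteness, the covariance `dev` annihilates the stars of the vertices for the same
reason; orthogonally to the stars the products of first moments drop out, the two zones decouple,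
and the diagonal dominates (`zoneForm_nonneg`, `mom_parameters`). -/

noncomputable section

open scoped Classical

/-! ### Cones, convexity of the iterates, and preservation of valid inequalities. -/

section Cone

variable {ι : Type*} {R : Set (ι → ℝ)}

lemma add_mem_coneOver (hR : Convex ℝ R) {y z : Option ι → ℝ} (hy : y ∈ coneOver R)
    (hz : z ∈ coneOver R) : y + z ∈ coneOver R := by
  obtain ⟨l, hl, a, ha, hy0, hy1⟩ := hy
  obtain ⟨k, hk, b, hb, hz0, hz1⟩ := hz
  rcases eq_or_lt_of_le (add_nonneg hl hk) with h | h
  · have hl0 : l = 0 := by linarith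
    have hk0 : k = 0 := by linarith
    refine ⟨0, le_rfl, a, ha, by simp [hy0, hz0, hl0, hk0], fun i => ?_⟩
    simp [hy1, hz1, hl0, hk0]
  · refine ⟨l + k, h.le, (l / (l + k)) • a + (k / (l + k)) • b, ?_, by simp [hy0, hz0], fun i => ?_⟩
    · exact hR ha hb (by positivity) (by positivity) (by field_simp)
    · simp only [Pi.add_apply, Pi.smul_apply, smul_eq_mul, hy1, hz1]
      field_simp

lemma smul_mem_coneOver {y : Option ι → ℝ} (hy : y ∈ coneOver R) {a : ℝ} (ha : 0 ≤ a) :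
    a • y ∈ coneOver R := by
  obtain ⟨l, hl, x, hx, h0, h1⟩ := hy
  exact ⟨a * l, mul_nonneg ha hl, x, hx, by simp [h0], fun i => by simp [h1, mul_assoc]⟩

lemma zero_mem_coneOver (hR : R.Nonempty) : (0 : Option ι → ℝ) ∈ coneOver R := by
  obtain ⟨x, hx⟩ := hR
  exact ⟨0, le_rfl, x, hx, by simp, by simp⟩

lemma sum_mem_coneOver (hR : Convex ℝ R) (hne : R.Nonempty) {κ : Type*} (s : Finset κ)
    (y : κ → Option ι → ℝ) (hy : ∀ k ∈ s, y k ∈ coneOver R) : ∑ k ∈ s, y k ∈ coneOver R := by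
  induction s using Finset.induction_on with
  | empty => simpa using zero_mem_coneOver hne
  | insert a s ha ih =>
    rw [Finset.sum_insert ha]
    exact add_mem_coneOver hR (hy a (by simp)) (ih fun k hk => hy k (by simp [hk]))

lemma convex_lsPlus (hR : Convex ℝ R) : Convex ℝ (lsPlus R) := by
  rintro x ⟨hx, X, hX⟩ y ⟨hy, Y, hY⟩ a b ha hb hab
  refine ⟨fun i => ?_, a • X + b • Y, ?_⟩
  · exact convex_Icc (0 : ℝ) 1 (hx i) (hy i) ha hb hab
  · refine ⟨?_, ?_, ?_, fun i => ?_, fun i => ?_, fun i => ?_, fun i => ?_⟩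
    · exact (hX.symm.smul a).add (hY.symm.smul b)
    · exact (hX.posSemidef.smul ha).add (hY.posSemidef.smul hb)
    · simp [hX.corner, hY.corner, hab]
    · simp [hX.row_zero, hY.row_zero]
    · simp [hX.diag, hY.diag]
    · exact add_mem_coneOver hR (smul_mem_coneOver (hX.row_mem i) ha)
        (smul_mem_coneOver (hY.row_mem i) hb)
    · have h := add_mem_coneOver hR (smul_mem_coneOver (hX.sub_row_mem i) ha)
        (smul_mem_coneOver (hY.sub_row_mem i) hb)
      convert h using 1
      ext j
      simp
      ring

lemma convex_lsPlus_iterate (hR : Convex ℝ R) (r : ℕ) : Convex ℝ (lsPlus^[r] R) := by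
  induction r with
  | zero => simpa
  | succ r ih => rw [Function.iterate_succ_apply']; exact convex_lsPlus ih

/-- A linear inequality becomes homogeneous on the cone, and the row of the point is the sum of the
two cone vectors `X i` and `X 0 - X i`. Some index `i` is needed for this splitting. -/
lemma le_sum_of_mem_lsPlus [Fintype ι] [Nonempty ι] {d : ι → ℝ} {K : ℝ}
    (h : ∀ x ∈ R, K ≤ ∑ i, d i * x i) {x : ι → ℝ} (hx : x ∈ lsPlus R) : K ≤ ∑ i, d i * x i := by
  obtain ⟨-, X, hX⟩ := hx
  have key : ∀ y ∈ coneOver R, K * y none ≤ ∑ i, d i * y (some i) := by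
    rintro y ⟨l, hl, a, ha, h0, h1⟩
    have e : ∑ i, d i * y (some i) = l * ∑ i, d i * a i := by
      rw [Finset.mul_sum]
      exact Finset.sum_congr rfl fun i _ => by rw [h1]; ring
    rw [e, h0, mul_comm]
    exact mul_le_mul_of_nonneg_left (h a ha) hl
  let i0 : ι := Classical.arbitrary ι
  have h1 := key _ (hX.row_mem i0)
  have h2 := key _ (hX.sub_row_mem i0)
  simp only [Pi.sub_apply, mul_sub, Finset.sum_sub_distrib, hX.row_zero, hX.corner] at h2
  linarith

lemma le_sum_of_mem_lsPlus_iterate [Fintype ι] [Nonempty ι] {d : ι → ℝ} {K : ℝ}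
    (h : ∀ x ∈ R, K ≤ ∑ i, d i * x i) (r : ℕ) :
    ∀ x ∈ lsPlus^[r] R, K ≤ ∑ i, d i * x i := by
  induction r with
  | zero => simpa
  | succ r ih =>
    rw [Function.iterate_succ_apply']
    exact fun x hx => le_sum_of_mem_lsPlus ih hx

end Cone

/-! ### Edge sums as sums over ordered pairs; cuts and their parity. -/

section EdgeSums

variable {V : Type*} [Fintype V]

/-- The ends of an edge of the complete graph, in an arbitrary order. -/
def edgeFst (e : (⊤ : SimpleGraph V).edgeSet) : V := (Quot.out e.1).1

/-- The second end of an edge, see `edgeFst`. -/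
def edgeSnd (e : (⊤ : SimpleGraph V).edgeSet) : V := (Quot.out e.1).2

omit [Fintype V] in
lemma mk_edgeFst_edgeSnd (e : (⊤ : SimpleGraph V).edgeSet) :
    s(edgeFst e, edgeSnd e) = (e : Sym2 V) :=
  Quot.out_eq e.1

omit [Fintype V] in
lemma edgeFst_ne_edgeSnd (e : (⊤ : SimpleGraph V).edgeSet) : edgeFst e ≠ edgeSnd e := by
  have h := e.2
  rw [← mk_edgeFst_edgeSnd e] at h
  simpa using h

/-- The vector indexed by the edges that comes from a (symmetric) function on pairs. -/
def edgePt (w : V → V → ℝ) (e : (⊤ : SimpleGraph V).edgeSet) : ℝ := w (edgeFst e) (edgeSnd e)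

omit [Fintype V] in
lemma edge_eq_iff (e : (⊤ : SimpleGraph V).edgeSet) (a b : V) :
    (e : Sym2 V) = s(a, b) ↔ (edgeFst e = a ∧ edgeSnd e = b) ∨ (edgeFst e = b ∧ edgeSnd e = a) := by
  rw [← mk_edgeFst_edgeSnd e]; simp

omit [Fintype V] in
lemma edgePt_mk {w : V → V → ℝ} (hw : ∀ u v, w u v = w v u) {a b : V}
    (h : s(a, b) ∈ (⊤ : SimpleGraph V).edgeSet) : edgePt w ⟨s(a, b), h⟩ = w a b := by
  rcases (edge_eq_iff ⟨s(a, b), h⟩ a b).1 rfl with ⟨h1, h2⟩ | ⟨h1, h2⟩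
  · simp [edgePt, h1, h2]
  · simp [edgePt, h1, h2, hw b a]

/-- The fibre of `(u, v) ↦ s(u, v)` over an edge consists of two ordered pairs; the fibres over the
diagonal contribute zero. -/
lemma sum_edgeSet {φ : V → V → ℝ} (hφ : ∀ u v, φ u v = φ v u) :
    ∑ e, edgePt φ e = (1 / 2) * ∑ u, ∑ v, if u = v then 0 else φ u v := by
  have h1 : ∑ u, ∑ v, (if u = v then 0 else φ u v)
      = ∑ q : Sym2 V, ∑ p : V × V with s(p.1, p.2) = q, if p.1 = p.2 then 0 else φ p.1 p.2 := by
    rw [Finset.sum_fiberwise, ← Finset.univ_product_univ, Finset.sum_product]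
  have h2 : ∀ q : Sym2 V, (∑ p : V × V with s(p.1, p.2) = q, if p.1 = p.2 then 0 else φ p.1 p.2)
      = if h : q ∈ (⊤ : SimpleGraph V).edgeSet then 2 * edgePt φ ⟨q, h⟩ else 0 := by
    intro q
    induction q using Sym2.ind with
    | _ a b =>
      by_cases hab : a = b
      · subst hab
        have : ¬ (s(a, a) ∈ (⊤ : SimpleGraph V).edgeSet) := by simp
        rw [dif_neg this]
        apply Finset.sum_eq_zero
        rintro ⟨x, y⟩ hp
        simp at hp
        simp [hp]
      · have : s(a, b) ∈ (⊤ : SimpleGraph V).edgeSet := by simpa using hab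
        rw [dif_pos this, edgePt_mk hφ]
        have hs : (Finset.univ.filter fun p : V × V => s(p.1, p.2) = s(a, b))
            = {(a, b), (b, a)} := by
          ext ⟨x, y⟩; simp
        rw [hs, Finset.sum_pair (by simp; intro h; exact fun _ => hab h)]
        simp [hab, Ne.symm hab, hφ b a]
        ring
  rw [h1, Finset.sum_congr rfl fun q _ => h2 q]
  rw [Finset.sum_dite, Finset.sum_const_zero, add_zero, Finset.mul_sum]
  refine (Finset.sum_bij (fun x _ => (⟨x.1, by simpa using x.2⟩ : (⊤ : SimpleGraph V).edgeSet))
    ?_ ?_ ?_ ?_).symm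
  · simp
  · intro x _ y _ h; exact Subtype.ext (by simpa using congrArg Subtype.val h)
  · intro b _; exact ⟨⟨b.1, by simpa using b.2⟩, by simp, rfl⟩
  · intro x _; ring

/-- The ordered-pair function of a vector indexed by the edges. -/
def pairFn (x : (⊤ : SimpleGraph V).edgeSet → ℝ) (a b : V) : ℝ :=
  if h : s(a, b) ∈ (⊤ : SimpleGraph V).edgeSet then x ⟨s(a, b), h⟩ else 0

omit [Fintype V] in
lemma pairFn_comm (x : (⊤ : SimpleGraph V).edgeSet → ℝ) (a b : V) :
    pairFn x a b = pairFn x b a := by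
  unfold pairFn
  simp only [Sym2.eq_swap]

omit [Fintype V] in
@[simp] lemma pairFn_self (x : (⊤ : SimpleGraph V).edgeSet → ℝ) (a : V) : pairFn x a a = 0 := by
  simp [pairFn]

omit [Fintype V] in
lemma pairFn_edge (x : (⊤ : SimpleGraph V).edgeSet → ℝ) (e : (⊤ : SimpleGraph V).edgeSet) :
    pairFn x (edgeFst e) (edgeSnd e) = x e := by
  have h : s(edgeFst e, edgeSnd e) ∈ (⊤ : SimpleGraph V).edgeSet := by
    rw [mk_edgeFst_edgeSnd]; exact e.2
  rw [pairFn, dif_pos h]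
  congr 1
  exact Subtype.ext (mk_edgeFst_edgeSnd e)

omit [Fintype V] in
lemma pairFn_edgePt {w : V → V → ℝ} (hw : ∀ u v, w u v = w v u) {a b : V} (h : a ≠ b) :
    pairFn (edgePt w) a b = w a b := by
  have h' : s(a, b) ∈ (⊤ : SimpleGraph V).edgeSet := by simpa using h
  rw [pairFn, dif_pos h', edgePt_mk hw]

lemma sum_edges_mul (φ : V → V → ℝ) (hφ : ∀ u v, φ u v = φ v u)
    (x : (⊤ : SimpleGraph V).edgeSet → ℝ) :
    ∑ e, edgePt φ e * x e = (1 / 2) * ∑ u, ∑ v, φ u v * pairFn x u v := by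
  have h := sum_edgeSet (φ := fun u v => φ u v * pairFn x u v)
    (fun u v => by rw [hφ, pairFn_comm])
  have e1 : ∀ e, edgePt (fun u v => φ u v * pairFn x u v) e = edgePt φ e * x e := fun e => by
    simp [edgePt, pairFn_edge]
  rw [Finset.sum_congr rfl fun e _ => e1 e] at h
  rw [h]
  congr 1
  refine Finset.sum_congr rfl fun u _ => Finset.sum_congr rfl fun v _ => ?_
  split_ifs with huv
  · simp [huv]
  · rfl

lemma cutWeight_eq (x : (⊤ : SimpleGraph V).edgeSet → ℝ) (S : Finset V) :
    cutWeight x S = ∑ a ∈ S, ∑ b ∈ Sᶜ, pairFn x a b := by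
  have h := sum_edges_mul (fun u v => if (u ∈ S ∧ v ∉ S) ∨ (v ∈ S ∧ u ∉ S) then (1 : ℝ) else 0)
    (fun u v => by simp only [or_comm]) x
  have e1 : cutWeight x S = ∑ e, edgePt
      (fun u v => if (u ∈ S ∧ v ∉ S) ∨ (v ∈ S ∧ u ∉ S) then (1 : ℝ) else 0) e * x e := by
    unfold cutWeight
    refine Finset.sum_congr (Finset.ext fun _ => by simp) fun e _ => ?_
    have : (∃ u ∈ S, ∃ v ∉ S, (e : Sym2 V) = s(u, v)) ↔
        (edgeFst e ∈ S ∧ edgeSnd e ∉ S) ∨ (edgeSnd e ∈ S ∧ edgeFst e ∉ S) := by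
      simp only [edge_eq_iff]
      constructor
      · rintro ⟨u, hu, v, hv, ⟨rfl, rfl⟩ | ⟨rfl, rfl⟩⟩
        · exact Or.inl ⟨hu, hv⟩
        · exact Or.inr ⟨hu, hv⟩
      · rintro (⟨h1, h2⟩ | ⟨h1, h2⟩)
        · exact ⟨_, h1, _, h2, Or.inl ⟨rfl, rfl⟩⟩
        · exact ⟨_, h1, _, h2, Or.inr ⟨rfl, rfl⟩⟩
    simp only [this, edgePt]
    split_ifs <;> simp
  have h1 : ∀ u v : V, (if (u ∈ S ∧ v ∉ S) ∨ (v ∈ S ∧ u ∉ S) then (1 : ℝ) else 0) * pairFn x u v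
      = (if u ∈ S then if v ∈ Sᶜ then pairFn x u v else 0 else 0)
        + (if v ∈ S then if u ∈ Sᶜ then pairFn x v u else 0 else 0) := by
    intro u v
    by_cases hu : u ∈ S <;> by_cases hv : v ∈ S <;> simp [hu, hv, pairFn_comm x u v]
  rw [e1, h]
  simp only [h1, Finset.sum_add_distrib]
  rw [Finset.sum_comm (f := fun u v => if v ∈ S then if u ∈ Sᶜ then pairFn x v u else 0 else 0)]
  have h2 : ∑ u, ∑ v, (if u ∈ S then if v ∈ Sᶜ then pairFn x u v else 0 else 0)
      = ∑ a ∈ S, ∑ b ∈ Sᶜ, pairFn x a b := by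
    rw [← Finset.sum_subset (Finset.subset_univ S)]
    · refine Finset.sum_congr rfl fun u hu => ?_
      simp only [hu, if_true]
      rw [← Finset.sum_filter]
      congr 1
      ext; simp
    · intro u _ hu; simp [hu]
  rw [h2]; ring

lemma cutWeight_singleton (x : (⊤ : SimpleGraph V).edgeSet → ℝ) (v : V) :
    cutWeight x {v} = ∑ b, pairFn x v b := by
  rw [cutWeight_eq, Finset.sum_singleton]
  apply Finset.sum_subset (Finset.subset_univ _)
  intro b _ hb
  have : b = v := by simpa using hb
  simp [this]

omit [Fintype V] in
lemma pairFn_add (x y : (⊤ : SimpleGraph V).edgeSet → ℝ) (a b : V) :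
    pairFn (x + y) a b = pairFn x a b + pairFn y a b := by
  unfold pairFn; split_ifs <;> simp

omit [Fintype V] in
lemma pairFn_smul (l : ℝ) (y : (⊤ : SimpleGraph V).edgeSet → ℝ) (a b : V) :
    pairFn (l • y) a b = l * pairFn y a b := by
  unfold pairFn; split_ifs <;> simp

lemma cutWeight_combo (x y : (⊤ : SimpleGraph V).edgeSet → ℝ) (l k : ℝ) (S : Finset V) :
    cutWeight (l • x + k • y) S = l * cutWeight x S + k * cutWeight y S := by
  simp only [cutWeight_eq, pairFn_add, pairFn_smul, Finset.sum_add_distrib, Finset.mul_sum]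

lemma convex_symPathPolytope (s t : V) :
    Convex ℝ (symPathPolytope (⊤ : SimpleGraph V) s t) := by
  intro x hx y hy a b ha hb hab
  refine ⟨fun S h1 h2 h3 => ?_, fun S h1 h2 h3 => ?_, fun v h1 h2 => ?_, ?_, ?_, fun e => ?_⟩
  · rw [cutWeight_combo]
    nlinarith [hx.cut_two S h1 h2 h3, hy.cut_two S h1 h2 h3]
  · rw [cutWeight_combo]
    nlinarith [hx.cut_one S h1 h2 h3, hy.cut_one S h1 h2 h3]
  · rw [cutWeight_combo, hx.degree_two v h1 h2, hy.degree_two v h1 h2, ← add_mul, hab, one_mul]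
  · rw [cutWeight_combo, hx.degree_source, hy.degree_source, ← add_mul, hab, one_mul]
  · rw [cutWeight_combo, hx.degree_target, hy.degree_target, ← add_mul, hab, one_mul]
  · exact convex_Icc (0 : ℝ) 1 (hx.mem_Icc e) (hy.mem_Icc e) ha hb hab

omit [Fintype V] in
lemma even_sum_sum (f : V → V → ℕ) (hf : ∀ u v, f u v = f v u) (h0 : ∀ u, f u u = 0)
    (S : Finset V) : Even (∑ a ∈ S, ∑ b ∈ S, f a b) := by
  induction S using Finset.induction_on with
  | empty => simp
  | insert a S ha ih =>
    simp only [Finset.sum_insert ha, h0, Finset.sum_add_distrib]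
    have : ∑ x ∈ S, f x a = ∑ x ∈ S, f a x := Finset.sum_congr rfl fun x _ => hf x a
    rw [this]
    obtain ⟨k, hk⟩ := ih
    exact ⟨∑ x ∈ S, f a x + k, by omega⟩

/-- The cut of a symmetric integer weight has the parity of the degree sum. -/
lemma cut_parity (f : V → V → ℕ) (hf : ∀ u v, f u v = f v u) (h0 : ∀ u, f u u = 0)
    (S : Finset V) :
    (∑ a ∈ S, ∑ b ∈ Sᶜ, f a b) % 2 = (∑ a ∈ S, ∑ b, f a b) % 2 := by
  have h := even_sum_sum f hf h0 S
  have e : ∑ a ∈ S, ∑ b, f a b = ∑ a ∈ S, ∑ b ∈ S, f a b + ∑ a ∈ S, ∑ b ∈ Sᶜ, f a b := by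
    rw [← Finset.sum_add_distrib]
    exact Finset.sum_congr rfl fun a _ => (Finset.sum_add_sum_compl S _).symm
  obtain ⟨k, hk⟩ := h
  omega

end EdgeSums

end


/-! ### The quadratic form of the second moments within one zone. -/

noncomputable section

open scoped Classical

section ZoneForm

variable {J : Type*} [Fintype J]

/-- Second moments of two special-end edges. -/
def momAA (τ : J → J) (α y1 : ℝ) (i : Fin 3) (u : J) (j : Fin 3) (w : J) : ℝ :=
  if i = j then (if u = w then α else 0) else if w = u ∨ w = τ u then 0 else y1

/-- Second moments of a special-end edge and an end-end edge. -/
def momAB (τ : J → J) (y1 y3 : ℝ) (u w v : J) : ℝ :=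
  if u = w ∨ u = v then 0 else if τ u = w ∨ τ u = v then y1 else y3

/-- Second moments of two end-end edges. -/
def momBB (τ : J → J) (β y4 y5 : ℝ) (w v w' v' : J) : ℝ :=
  if (w = w' ∧ v = v') ∨ (w = v' ∧ v = w') then β
  else if w = w' ∨ w = v' ∨ v = w' ∨ v = v' then 0
  else if (τ w = w' ∧ τ v = v') ∨ (τ w = v' ∧ τ v = w') then 0
  else if τ w = w' ∨ τ w = v' ∨ τ v = w' ∨ τ v = v' then y4 else y5

variable {τ : J → J} (hτ : ∀ u, τ (τ u) = u) (hne : ∀ u, τ u ≠ u)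
  {f : Fin 3 → J → ℝ} {g : J → J → ℝ}
  (hg : ∀ u w, g u w = g w u) (hg0 : ∀ u, g u u = 0) (hg1 : ∀ u, g u (τ u) = 0)
  (hf : ∀ i, ∑ u, f i u = 0) (hG : ∀ u, ∑ w, g u w = -∑ i, f i u)

include hf in
-- Inclusion and exclusion: the moment is the constant `y1` minus corrections supported on `j = i`,
-- `w = u` and `w = τ u`. The constant part disappears because the sums of each `f j` vanish.
lemma momAA_row (hne : ∀ u, τ u ≠ u) (α y1 : ℝ) (i : Fin 3) (u : J) :
    ∑ j, ∑ w, f j w * momAA τ α y1 i u j w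
      = (α + y1) * f i u + y1 * f i (τ u) - y1 * (∑ j, f j u + ∑ j, f j (τ u)) := by
  have key : ∀ j w, f j w * momAA τ α y1 i u j w
      = y1 * f j w - (if j = i then y1 * f j w else 0) - (if w = u then y1 * f j w else 0)
        - (if w = τ u then y1 * f j w else 0)
        + (if j = i then (if w = u then (α + y1) * f j w else 0) else 0)
        + (if j = i then (if w = τ u then y1 * f j w else 0) else 0) := by
    intro j w
    unfold momAA
    by_cases h1 : i = j
    · subst h1
      by_cases h2 : w = u
      · subst h2
        simp [(hne w).symm]; ring
      · by_cases h3 : w = τ u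
        · simp [h3, hne, (hne u).symm]
        · simp [h2, h3, Ne.symm h2]
    · have h1' : ¬ j = i := fun h => h1 h.symm
      by_cases h2 : w = u
      · subst h2
        simp [h1, h1', (hne w).symm]
      · by_cases h3 : w = τ u
        · simp [h1, h1', h3, hne]
        · simp [h1, h1', h2, h3]; ring
  simp only [key, Finset.sum_add_distrib, Finset.sum_sub_distrib, Finset.sum_ite_eq',
    Finset.mem_univ, if_true, ← Finset.mul_sum, hf]
  have h4 : ∀ j, (∑ w, if j = i then y1 * f j w else 0) = if j = i then y1 * ∑ w, f j w else 0 := by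
    intro j; split_ifs <;> simp [Finset.mul_sum]
  have h5 : ∀ (j : Fin 3) (z : J) (c : ℝ), (∑ w, if j = i then (if w = z then c * f j w else 0) else 0)
      = if j = i then c * f j z else 0 := by
    intro j z c; split_ifs <;> simp
  simp only [h4, h5, hf, mul_zero, ite_self, Finset.sum_const_zero, Finset.sum_ite_eq',
    Finset.mem_univ, if_true]
  ring

include hτ hne hg hg0 hg1 in
lemma momAB_row (hT : ∑ w, ∑ v, g w v = 0) (y1 y3 : ℝ) (u : J) :
    ∑ w, ∑ v, g w v * momAB τ y1 y3 u w v
      = - 2 * y3 * ∑ v, g u v + 2 * (y1 - y3) * ∑ v, g (τ u) v := by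
  have key : ∀ w v, g w v * momAB τ y1 y3 u w v
      = y3 * g w v - (if w = u then y3 * g w v else 0) - (if v = u then y3 * g w v else 0)
        + (if w = τ u then (y1 - y3) * g w v else 0)
        + (if v = τ u then (y1 - y3) * g w v else 0) := by
    intro w v
    unfold momAB
    by_cases h0 : w = v
    · simp [h0, hg0]
    by_cases h0' : v = τ w
    · simp [h0', hg1]
    have h0'' : w ≠ τ v := fun h => h0' (by rw [h, hτ])
    have c1 : (u = w) = (w = u) := propext eq_comm
    have c2 : (u = v) = (v = u) := propext eq_comm
    have c3 : (τ u = w) = (w = τ u) := propext eq_comm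
    have c4 : (τ u = v) = (v = τ u) := propext eq_comm
    rw [c1, c2, c3, c4]
    have := hne u
    by_cases h1 : w = u
    · subst h1
      simp [Ne.symm h0, h0', Ne.symm this]
    by_cases h2 : v = u
    · subst h2
      simp [h1, h0'', Ne.symm this]
    by_cases h3 : w = τ u
    · have : ¬ v = τ u := fun h => h0 (h3.trans h.symm)
      subst h3; simp [h1, h2, this]; ring
    by_cases h4 : v = τ u
    · subst h4; simp [h1, h2, h3]; ring
    simp [h1, h2, h3, h4]; ring
  have e1 : ∀ z c, (∑ w, ∑ v, if w = z then c * g w v else 0) = c * ∑ v, g z v := by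
    intro z c
    rw [Finset.sum_eq_single z]
    · simp [Finset.mul_sum]
    · intro b _ hb; simp [hb]
    · simp
  have e2 : ∀ z c, (∑ w, ∑ v, if v = z then c * g w v else 0) = c * ∑ v, g z v := by
    intro z c
    simp [Finset.mul_sum, hg]
  simp only [key, Finset.sum_add_distrib, Finset.sum_sub_distrib, e1, e2, ← Finset.mul_sum, hT]
  ring

include hτ hne hg hg0 hg1 in
-- Inclusion and exclusion again: single Kronecker terms give row sums of `g`, double ones give
-- single values. Pairs `w' v'` that coincide or are mates need no attention because `g` vanishes
-- there; since `v` is neither `w` nor its mate, the remaining cases do not overlap.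
lemma momBB_row (hT : ∑ w, ∑ v, g w v = 0) (β y4 y5 : ℝ) {w v : J} (hwv : v ≠ w)
    (hwv' : v ≠ τ w) :
    ∑ w', ∑ v', g w' v' * momBB τ β y4 y5 w v w' v'
      = - 2 * y5 * (∑ z, g w z + ∑ z, g v z) - 2 * (y5 - y4) * (∑ z, g (τ w) z + ∑ z, g (τ v) z)
        + 2 * (β + y5) * g w v + 2 * (y5 - y4) * (g w (τ v) + g (τ w) v)
        + 2 * (y5 - 2 * y4) * g (τ w) (τ v) := by
  have tinj : ∀ a b, τ a = τ b → a = b := fun a b h => by rw [← hτ a, h, hτ]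
  have k1 : w ≠ τ v := fun h => hwv' (by rw [h, hτ])
  have k2 : τ w ≠ τ v := fun h => hwv (tinj _ _ h).symm
  have k3 := hne w
  have k4 := hne v
  have key : ∀ w' v', g w' v' * momBB τ β y4 y5 w v w' v'
      = y5 * g w' v' - (if w' = w then y5 * g w' v' else 0) - (if v' = w then y5 * g w' v' else 0)
        - (if w' = v then y5 * g w' v' else 0) - (if v' = v then y5 * g w' v' else 0)
        - (if w' = τ w then (y5 - y4) * g w' v' else 0)
        - (if v' = τ w then (y5 - y4) * g w' v' else 0)
        - (if w' = τ v then (y5 - y4) * g w' v' else 0)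
        - (if v' = τ v then (y5 - y4) * g w' v' else 0)
        + (if w' = w then (if v' = v then (β + y5) * g w' v' else 0) else 0)
        + (if w' = v then (if v' = w then (β + y5) * g w' v' else 0) else 0)
        + (if w' = w then (if v' = τ v then (y5 - y4) * g w' v' else 0) else 0)
        + (if w' = τ v then (if v' = w then (y5 - y4) * g w' v' else 0) else 0)
        + (if w' = v then (if v' = τ w then (y5 - y4) * g w' v' else 0) else 0)
        + (if w' = τ w then (if v' = v then (y5 - y4) * g w' v' else 0) else 0)
        + (if w' = τ w then (if v' = τ v then (y5 - 2 * y4) * g w' v' else 0) else 0)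
        + (if w' = τ v then (if v' = τ w then (y5 - 2 * y4) * g w' v' else 0) else 0) := by
    intro w' v'
    by_cases h0 : v' = w'
    · simp [h0, hg0]
    by_cases h0' : v' = τ w'
    · simp [h0', hg1]
    have h0'' : w' ≠ τ v' := fun h => h0' (by rw [h, hτ])
    unfold momBB
    have c (a b : J) : (a = b) = (b = a) := propext eq_comm
    rw [c w w', c v v', c w v', c v w', c (τ w) w', c (τ v) v', c (τ w) v', c (τ v) w']
    by_cases a1 : w' = w
    · subst a1
      by_cases b1 : v' = v
      · subst b1; simp [h0, Ne.symm h0, h0', h0'', k1, k2, k3, k4, Ne.symm k3, Ne.symm k4]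
        ring
      · by_cases b2 : v' = τ v
        · subst b2; simp [h0, Ne.symm hwv, h0', Ne.symm k2, k1, Ne.symm k3, k4]
        · simp [h0, h0', b1, b2, Ne.symm hwv, k1, Ne.symm k3]
    by_cases a2 : w' = v
    · subst a2
      by_cases b1 : v' = w
      · subst b1; simp [hwv, hwv', Ne.symm hwv, k1, Ne.symm k3, Ne.symm k4]
        ring
      · by_cases b2 : v' = τ w
        · subst b2; simp [hwv, hwv', k2, Ne.symm k4, k3, Ne.symm hwv', h0]
        · simp [hwv, hwv', b1, b2, h0, h0', Ne.symm k4]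
    by_cases b1 : v' = w
    · subst b1
      by_cases a3 : w' = τ v
      · subst a3; simp [k4, Ne.symm k2, Ne.symm k3, k1, Ne.symm hwv, Ne.symm k1]
      · simp [a1, a2, a3, h0'', Ne.symm k3, k1, Ne.symm hwv]
    by_cases b2 : v' = v
    · subst b2
      by_cases a3 : w' = τ w
      · subst a3; simp [k3, k2, hwv, hwv', Ne.symm k4, Ne.symm hwv']
      · simp [a1, a2, a3, h0'', Ne.symm k4, hwv, hwv']
    by_cases a3 : w' = τ w
    · subst a3
      by_cases b3 : v' = τ v
      · subst b3; simp [a1, a2, b1, b2, k2, Ne.symm k2]; ring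
      · simp [a1, a2, b1, b2, b3, k2, h0]; ring
    by_cases a4 : w' = τ v
    · subst a4
      by_cases b3 : v' = τ w
      · subst b3; simp [a1, a2, b1, b2, k2, Ne.symm k2]; ring
      · simp [a1, a2, b1, b2, b3, h0, Ne.symm k2]; ring
    by_cases b3 : v' = τ w
    · subst b3; simp [a1, a2, a3, a4, b1, b2, k2]; ring
    by_cases b4 : v' = τ v
    · subst b4; simp [a1, a2, a3, a4, b1, b2, b3]; ring
    simp [a1, a2, a3, a4, b1, b2, b3, b4]; ring
  have e1 : ∀ z c, (∑ w, ∑ v, if w = z then c * g w v else 0) = c * ∑ v, g z v := by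
    intro z c
    rw [Finset.sum_eq_single z]
    · simp [Finset.mul_sum]
    · intro b _ hb; simp [hb]
    · simp
  have e2 : ∀ z c, (∑ w, ∑ v, if v = z then c * g w v else 0) = c * ∑ v, g z v := by
    intro z c
    simp [Finset.mul_sum, hg]
  have e3 : ∀ z z' c, (∑ w, ∑ v, if w = z then (if v = z' then c * g w v else 0) else 0)
      = c * g z z' := by
    intro z z' c
    rw [Finset.sum_eq_single z]
    · simp
    · intro b _ hb; simp [hb]
    · simp
  simp only [key, Finset.sum_add_distrib, Finset.sum_sub_distrib, e1, e2, e3, ← Finset.mul_sum, hT]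
  rw [hg v w, hg (τ v) w, hg v (τ w), hg (τ v) (τ w)]
  ring

include hτ hne hg hg0 hg1 hf hG in
/-- Positive semidefiniteness of the second moments on vectors with vanishing vertex sums. -/
theorem zoneForm_nonneg {α β y1 y3 y4 y5 : ℝ} (h1 : 0 ≤ y1) (h13 : y3 ≤ y1) (h45 : y4 ≤ y5)
    (hβ : 2 * (y5 - y4) + |y5 - 2 * y4| ≤ β + y5)
    (hα : 3 * (|2 * y3 - y1 - y5| + y1 + 2 * (y1 - y3) + (y5 - y4)) ≤ α) :
    0 ≤ ∑ i, ∑ u, ∑ j, ∑ w, f i u * (f j w * momAA τ α y1 i u j w)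
      + ∑ i, ∑ u, ∑ w, ∑ v, f i u * (g w v * momAB τ y1 y3 u w v)
      + (1 / 4) * ∑ w, ∑ v, ∑ w', ∑ v', g w v * (g w' v' * momBB τ β y4 y5 w v w' v') := by
  have hT : ∑ w, ∑ v, g w v = 0 := by
    simp only [hG, Finset.sum_neg_distrib]
    rw [Finset.sum_comm]
    simp [hf]
  -- Every row sum of `g` is `-F`, so the mixed terms and the linear parts of the form all turn into
  -- the quantities `Φ` and `Ψ` in `F` alone.
  set F : J → ℝ := fun u => ∑ i, f i u with hF
  have hGF : ∀ u, ∑ w, g u w = - F u := hG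
  set τe : J ≃ J := ⟨τ, τ, hτ, hτ⟩ with hτe
  have reidx : ∀ φ : J → ℝ, ∑ u, φ (τ u) = ∑ u, φ u := fun φ => Equiv.sum_comp τe φ
  set A := ∑ i, ∑ u, f i u ^ 2 with hA
  set A' := ∑ i, ∑ u, f i u * f i (τ u) with hA'
  set Φ := ∑ u, F u ^ 2 with hΦ
  set Ψ := ∑ u, F u * F (τ u) with hΨ
  set B := ∑ w, ∑ v, g w v ^ 2 with hB
  set X := ∑ w, ∑ v, g w v * g w (τ v) with hX
  set X' := ∑ w, ∑ v, g w v * g (τ w) v with hX'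
  set Z := ∑ w, ∑ v, g w v * g (τ w) (τ v) with hZ
  have swapF : ∀ φ : J → ℝ, ∑ i, ∑ u, f i u * φ u = ∑ u, F u * φ u := by
    intro φ
    rw [Finset.sum_comm]
    exact Finset.sum_congr rfl fun u _ => by rw [hF, Finset.sum_mul]
  have t1 : ∑ i, ∑ u, ∑ j, ∑ w, f i u * (f j w * momAA τ α y1 i u j w)
      = (α + y1) * A + y1 * A' - y1 * (Φ + Ψ) := by
    simp only [← Finset.mul_sum, momAA_row hf hne]
    have : ∀ i u, f i u * ((α + y1) * f i u + y1 * f i (τ u) - y1 * (∑ j, f j u + ∑ j, f j (τ u)))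
        = (α + y1) * f i u ^ 2 + y1 * (f i u * f i (τ u)) - y1 * (f i u * (F u + F (τ u))) := by
      intro i u; simp only [hF]; ring
    simp only [this, Finset.sum_add_distrib, Finset.sum_sub_distrib, ← Finset.mul_sum, swapF]
    rw [hΦ, hΨ, ← Finset.sum_add_distrib]
    congr 2
    exact Finset.sum_congr rfl fun u _ => by ring
  have t2 : ∑ i, ∑ u, ∑ w, ∑ v, f i u * (g w v * momAB τ y1 y3 u w v)
      = 2 * y3 * Φ - 2 * (y1 - y3) * Ψ := by
    simp only [← Finset.mul_sum, momAB_row hτ hne hg hg0 hg1 hT, hGF, swapF]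
    rw [hΦ, hΨ, Finset.mul_sum, Finset.mul_sum, ← Finset.sum_sub_distrib]
    exact Finset.sum_congr rfl fun u _ => by ring
  have t3 : ∑ w, ∑ v, ∑ w', ∑ v', g w v * (g w' v' * momBB τ β y4 y5 w v w' v')
      = - 4 * y5 * Φ - 4 * (y5 - y4) * Ψ + 2 * (β + y5) * B + 2 * (y5 - y4) * (X + X')
        + 2 * (y5 - 2 * y4) * Z := by
    simp only [← Finset.mul_sum]
    have : ∀ w v, g w v * ∑ w', ∑ v', g w' v' * momBB τ β y4 y5 w v w' v'
        = 2 * y5 * (g w v * F w) + 2 * y5 * (g w v * F v) + 2 * (y5 - y4) * (g w v * F (τ w))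
          + 2 * (y5 - y4) * (g w v * F (τ v))
          + 2 * (β + y5) * g w v ^ 2 + 2 * (y5 - y4) * (g w v * g w (τ v))
          + 2 * (y5 - y4) * (g w v * g (τ w) v)
          + 2 * (y5 - 2 * y4) * (g w v * g (τ w) (τ v)) := by
      intro w v
      by_cases h : v = w
      · simp [h, hg0]
      by_cases h' : v = τ w
      · simp [h', hg1]
      rw [momBB_row hτ hne hg hg0 hg1 hT β y4 y5 h h']
      simp only [hGF]
      ring
    have s1 : ∀ φ : J → ℝ, ∑ w, ∑ v, g w v * φ w = - ∑ w, F w * φ w := by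
      intro φ
      rw [← Finset.sum_neg_distrib]
      exact Finset.sum_congr rfl fun w _ => by rw [← Finset.sum_mul, hGF]; ring
    have s2 : ∀ φ : J → ℝ, ∑ w, ∑ v, g w v * φ v = - ∑ w, F w * φ w := by
      intro φ
      rw [← s1, Finset.sum_comm]
      exact Finset.sum_congr rfl fun w _ => Finset.sum_congr rfl fun v _ => by rw [hg]
    simp only [this, Finset.sum_add_distrib, ← Finset.mul_sum]
    rw [s1 F, s2 F, s1 fun w => F (τ w), s2 fun w => F (τ w)]
    have : ∑ w, F w * F w = Φ := Finset.sum_congr rfl fun u _ => by ring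
    rw [this]
    ring
  -- After collecting terms, the coefficient of `Φ` is `2 * y3 - y1 - y5`, that of `Ψ` is `-(y1 + 2
  -- * (y1 - y3) + (y5 - y4))`, and `g` contributes half of `(β + y5) * B + (y5 - y4) * (X + X') +
  -- (y5 - 2 * y4) * Z`. It remains to bound everything by the diagonal sums `A` and `B`.
  rw [t1, t2, t3]
  have hA0 : 0 ≤ A := Finset.sum_nonneg fun i _ => Finset.sum_nonneg fun u _ => sq_nonneg _
  have hB0 : 0 ≤ B := Finset.sum_nonneg fun i _ => Finset.sum_nonneg fun u _ => sq_nonneg _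
  have hΦ0 : 0 ≤ Φ := Finset.sum_nonneg fun u _ => sq_nonneg _
  -- Cauchy–Schwarz over the three special ends; this is the factor 3 in `hα`.
  have hΦA : Φ ≤ 3 * A := by
    rw [hΦ, hA, Finset.sum_comm, Finset.mul_sum]
    refine Finset.sum_le_sum fun u _ => ?_
    simp only [hF, Fin.sum_univ_three]
    nlinarith [sq_nonneg (f 0 u - f 1 u), sq_nonneg (f 0 u - f 2 u), sq_nonneg (f 1 u - f 2 u)]
  have hA' : -A ≤ A' := by
    have : ∑ i, ∑ u, f i (τ u) ^ 2 = A :=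
      Finset.sum_congr rfl fun i _ => reidx fun u => f i u ^ 2
    have h : 0 ≤ ∑ i, ∑ u, (f i u + f i (τ u)) ^ 2 :=
      Finset.sum_nonneg fun i _ => Finset.sum_nonneg fun u _ => sq_nonneg _
    have e : ∑ i, ∑ u, (f i u + f i (τ u)) ^ 2 = A + 2 * A' + ∑ i, ∑ u, f i (τ u) ^ 2 := by
      rw [hA, hA']
      simp only [Finset.mul_sum, ← Finset.sum_add_distrib]
      exact Finset.sum_congr rfl fun i _ => Finset.sum_congr rfl fun u _ => by ring
    linarith
  have hΨ1 : Ψ ≤ Φ := by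
    have : ∑ u, F (τ u) ^ 2 = Φ := reidx fun u => F u ^ 2
    have h : 0 ≤ ∑ u, (F u - F (τ u)) ^ 2 := Finset.sum_nonneg fun u _ => sq_nonneg _
    have e : ∑ u, (F u - F (τ u)) ^ 2 = Φ - 2 * Ψ + ∑ u, F (τ u) ^ 2 := by
      rw [hΦ, hΨ, Finset.mul_sum, ← Finset.sum_sub_distrib, ← Finset.sum_add_distrib]
      exact Finset.sum_congr rfl fun u _ => by ring
    linarith
  -- `X`, `X'` and `Z` are inner products of `g` with copies of itself permuted by `τ`, which have
  -- the same norm.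
  have pairB : ∀ φ : J → J → ℝ, ∑ w, ∑ v, φ w v ^ 2 = B →
      |∑ w, ∑ v, g w v * φ w v| ≤ B := by
    intro φ hφ
    have h : 0 ≤ ∑ w, ∑ v, (g w v - φ w v) ^ 2 :=
      Finset.sum_nonneg fun i _ => Finset.sum_nonneg fun u _ => sq_nonneg _
    have h' : 0 ≤ ∑ w, ∑ v, (g w v + φ w v) ^ 2 :=
      Finset.sum_nonneg fun i _ => Finset.sum_nonneg fun u _ => sq_nonneg _
    have e : ∑ w, ∑ v, (g w v - φ w v) ^ 2 = B - 2 * ∑ w, ∑ v, g w v * φ w v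
        + ∑ w, ∑ v, φ w v ^ 2 := by
      rw [hB]
      simp only [Finset.mul_sum, ← Finset.sum_sub_distrib, ← Finset.sum_add_distrib]
      exact Finset.sum_congr rfl fun i _ => Finset.sum_congr rfl fun u _ => by ring
    have e' : ∑ w, ∑ v, (g w v + φ w v) ^ 2 = B + 2 * ∑ w, ∑ v, g w v * φ w v
        + ∑ w, ∑ v, φ w v ^ 2 := by
      rw [hB]
      simp only [Finset.mul_sum, ← Finset.sum_add_distrib]
      exact Finset.sum_congr rfl fun i _ => Finset.sum_congr rfl fun u _ => by ring
    rw [abs_le]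
    constructor <;> linarith
  have hX1 := pairB (fun w v => g w (τ v))
    (Finset.sum_congr rfl fun w _ => reidx fun v => g w v ^ 2)
  have hX2 := pairB (fun w v => g (τ w) v) (reidx fun w => ∑ v, g w v ^ 2)
  have hZ1 := pairB (fun w v => g (τ w) (τ v))
    ((Finset.sum_congr rfl fun w _ => reidx fun v => g (τ w) v ^ 2).trans
      (reidx fun w => ∑ v, g w v ^ 2))
  have p1 : -|2 * y3 - y1 - y5| * Φ ≤ (2 * y3 - y1 - y5) * Φ :=
    mul_le_mul_of_nonneg_right (neg_abs_le _) hΦ0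
  have p2 : -(|y5 - 2 * y4| * B) ≤ (y5 - 2 * y4) * Z := by
    refine (abs_le.1 ?_).1
    rw [abs_mul]
    exact mul_le_mul_of_nonneg_left hZ1 (abs_nonneg _)
  have p3 := mul_le_mul_of_nonneg_left (add_le_add (abs_le.1 hX1).1 (abs_le.1 hX2).1)
    (sub_nonneg.2 h45)
  have p4 := mul_le_mul_of_nonneg_right hβ hB0
  have p5 := mul_le_mul_of_nonneg_left hA' h1
  have p6 := mul_le_mul_of_nonneg_left hΨ1
    (by linarith : 0 ≤ y1 + 2 * (y1 - y3) + (y5 - y4))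
  have p7 := mul_le_mul_of_nonneg_right hα hA0
  have p8 := mul_le_mul_of_nonneg_left hΦA
    (by have := abs_nonneg (2 * y3 - y1 - y5); linarith :
      0 ≤ |2 * y3 - y1 - y5| + (y1 + 2 * (y1 - y3) + (y5 - y4)))
  nlinarith

end ZoneForm
end


/-! ### Configurations of strands and their merges. -/

noncomputable section

open scoped Classical

/-- Weight of an edge between a special end and one of the `N` segment ends of a zone. -/
def alphaW (N : ℝ) : ℝ := 1 / N

/-- Weight of an edge between two segment ends of a zone with `N` segment ends. -/
def betaW (N : ℝ) : ℝ := (N - 3) / (N * (N - 2))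

/-- A configuration of strands: `F` is the graph of the chosen edges, `sp z i` are the three special
free ends of zone `z`, `J z` are the ends of the segments of zone `z`, paired by `τ`, and `c`
labels the strands. -/
structure Conf (V L : Type*) where
  /-- the chosen edges -/
  F : SimpleGraph V
  /-- the special free ends -/
  sp : Bool → Fin 3 → V
  /-- the segment ends -/
  J : Bool → Finset V
  /-- the other end of a segment -/
  τ : V → V
  /-- the strand of a vertex -/
  c : V → L

namespace Conf

variable {V L : Type*} (π : Conf V L)

/-- The free ends of strands. -/
def IsFree (v : V) : Prop := (∃ z i, v = π.sp z i) ∨ ∃ z, v ∈ π.J z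

/-- The number of segment ends of a zone. -/
def N (z : Bool) : ℝ := (π.J z).card

/-- The invariants of a configuration. -/
structure Good [Fintype V] (s t : V) : Prop where
  sp_inj : ∀ {z i z' j}, π.sp z i = π.sp z' j → z = z' ∧ i = j
  sp_notMem : ∀ z i z', π.sp z i ∉ π.J z'
  J_disj : ∀ {z z' x}, x ∈ π.J z → x ∈ π.J z' → z = z'
  τ_mem : ∀ {z x}, x ∈ π.J z → π.τ x ∈ π.J z
  τ_ne : ∀ {z x}, x ∈ π.J z → π.τ x ≠ x
  τ_τ : ∀ {z x}, x ∈ π.J z → π.τ (π.τ x) = x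
  c_τ : ∀ {z x}, x ∈ π.J z → π.c (π.τ x) = π.c x
  c_J : ∀ {z z' x y}, x ∈ π.J z → y ∈ π.J z' → π.c x = π.c y → y = x ∨ y = π.τ x
  c_sp : ∀ {z x}, x ∈ π.J z → ∀ z' i, π.c x ≠ π.c (π.sp z' i)
  -- The special ends 1 and 2 of the two zones are joined by two different strands running from zone
  -- to zone. A vertex set that contains the free ends of one zone and misses those of the other is
  -- therefore cut twice.
  c_one : π.c (π.sp true 1) = π.c (π.sp false 1)
  c_two : π.c (π.sp true 2) = π.c (π.sp false 2)
  c_one_two : π.c (π.sp true 1) ≠ π.c (π.sp true 2)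
  c_s : π.c s = π.c (π.sp true 0)
  c_t : π.c t = π.c (π.sp false 0)
  adj_c : ∀ {u v}, π.F.Adj u v → π.c u = π.c v
  -- Connectedness of a strand in the form used for cuts: a set that separates two of its vertices
  -- is crossed by one of its chosen edges.
  conn : ∀ (S : Set V) (u v : V), π.c u = π.c v → u ∈ S → v ∉ S →
    ∃ a b, a ∈ S ∧ b ∉ S ∧ π.F.Adj a b ∧ π.c a = π.c u
  -- Every strand has a free end; in particular no strand is a closed cycle.
  cover : ∀ v, ∃ u, π.IsFree u ∧ π.c u = π.c v
  -- A free end lacks exactly one unit of its prescribed degree, which the fractional edges supply.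
  -- While `s` is still a free end, it is isolated in `F` and both indicators count.
  deg : ∀ v, (∑ b, if π.F.Adj v b then 1 else 0) + (if v = s then 1 else 0)
    + (if v = t then 1 else 0) + (if π.IsFree v then 1 else 0) = 2

/-- Join the strand of the special end `sp z i` to the segment of `x` by the edge between them. -/
def mergeA (z : Bool) (i : Fin 3) (x : V) : Conf V L where
  F := π.F ⊔ SimpleGraph.edge (π.sp z i) x
  sp := fun z' j => if z' = z ∧ j = i then π.τ x else π.sp z' j
  J := fun z' => ((π.J z').erase x).erase (π.τ x)
  τ := π.τ
  c := fun v => if π.c v = π.c x then π.c (π.sp z i) else π.c v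

/-- Join the segments of `x` and `y` by the edge between them. -/
def mergeB (x y : V) : Conf V L where
  F := π.F ⊔ SimpleGraph.edge x y
  sp := π.sp
  J := fun z' => ((π.J z').erase x).erase y
  τ := fun v => if v = π.τ x then π.τ y else if v = π.τ y then π.τ x else π.τ v
  c := fun v => if π.c v = π.c y then π.c x else π.c v

variable {π}

/-- A pair that has the same label only after the relabelling consists of one vertex with the label
of `p` and one with the label of `q`. A set separating them then separates one of them from its
representative `p` or `q`, or it separates `p` from `q`. -/
lemma conn_relabel {F F' : SimpleGraph V} {c : V → L} {p q : V} (hF : ∀ {a b}, F.Adj a b → F'.Adj a b)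
    (hpq : F'.Adj p q)
    (conn : ∀ (S : Set V) (u v : V), c u = c v → u ∈ S → v ∉ S →
      ∃ a b, a ∈ S ∧ b ∉ S ∧ F.Adj a b ∧ c a = c u)
    (S : Set V) (u v : V)
    (huv : (if c u = c q then c p else c u) = (if c v = c q then c p else c v))
    (hu : u ∈ S) (hv : v ∉ S) :
    ∃ a b, a ∈ S ∧ b ∉ S ∧ F'.Adj a b ∧
      (if c a = c q then c p else c a) = (if c u = c q then c p else c u) := by
  by_cases h : c u = c v
  · obtain ⟨a, b, ha, hb, hab, hc⟩ := conn S u v h hu hv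
    exact ⟨a, b, ha, hb, hF hab, by rw [hc]⟩
  by_cases h1 : c u = c q
  · have h2 : ¬ c v = c q := fun h2 => h (h1.trans h2.symm)
    rw [if_pos h1, if_neg h2] at huv
    rw [if_pos h1]
    by_cases hq : q ∈ S
    · by_cases hp : p ∈ S
      · obtain ⟨a, b, ha, hb, hab, hc⟩ := conn S p v huv hp hv
        exact ⟨a, b, ha, hb, hF hab, by rw [hc]; simp⟩
      · exact ⟨q, p, hq, hp, hpq.symm, by simp⟩
    · obtain ⟨a, b, ha, hb, hab, hc⟩ := conn S u q h1 hu hq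
      exact ⟨a, b, ha, hb, hF hab, by rw [hc, if_pos h1]⟩
  · have h2 : c v = c q := by
      by_contra h2
      rw [if_neg h1, if_neg h2] at huv
      exact h huv
    rw [if_neg h1, if_pos h2] at huv
    rw [if_neg h1]
    by_cases hp : p ∈ S
    · by_cases hq : q ∈ S
      · obtain ⟨a, b, ha, hb, hab, hc⟩ := conn S q v h2.symm hq hv
        exact ⟨a, b, ha, hb, hF hab, by rw [hc, huv]; simp⟩
      · exact ⟨p, q, hp, hq, hpq, by rw [huv]; simp⟩
    · obtain ⟨a, b, ha, hb, hab, hc⟩ := conn S u p huv hu hp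
      exact ⟨a, b, ha, hb, hF hab, by rw [hc, if_neg h1]⟩

lemma sum_adj_sup_edge [Fintype V] {F F' : SimpleGraph V} {p q : V} (hpq : p ≠ q)
    (h : ¬ F.Adj p q) (hF' : F' = F ⊔ SimpleGraph.edge p q) (v : V) :
    (∑ b, if F'.Adj v b then 1 else 0)
      = (∑ b, if F.Adj v b then 1 else 0) + (if v = p then 1 else 0) + (if v = q then 1 else 0) := by
  have h' : ¬ F.Adj q p := fun h' => h h'.symm
  have key : ∀ b, (if F'.Adj v b then 1 else 0)
      = (if F.Adj v b then 1 else 0) + (if b = q then if v = p then 1 else 0 else 0)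
        + (if b = p then if v = q then 1 else 0 else 0) := by
    intro b
    simp only [hF', SimpleGraph.sup_adj, SimpleGraph.edge_adj]
    by_cases h1 : v = p
    · subst h1
      by_cases h2 : b = q
      · subst h2; simp [hpq, h, Ne.symm hpq]
      · by_cases h3 : b = v
        · subst h3; simp [hpq]
        · simp [h2, h3]
    · by_cases h2 : v = q
      · subst h2
        by_cases h3 : b = p
        · subst h3; simp [hpq, h', Ne.symm hpq]
        · simp [h1, h3]
      · simp [h1, h2]
  simp only [key, Finset.sum_add_distrib, Finset.sum_ite_eq', Finset.mem_univ, if_true]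

namespace Good

variable [Fintype V] {s t : V} (h : π.Good s t)
include h

lemma not_adj_sp {z z' i x} (hx : x ∈ π.J z) : ¬ π.F.Adj (π.sp z' i) x := fun ha =>
  h.c_sp hx z' i (h.adj_c ha).symm

lemma not_adj_J {z z' x y} (hx : x ∈ π.J z) (hy : y ∈ π.J z') (hne : y ≠ π.τ x) :
    ¬ π.F.Adj x y := fun ha => by
  rcases h.c_J hx hy (h.adj_c ha) with h1 | h1
  · exact ha.ne h1.symm
  · exact hne h1

lemma sp_ne {z z' i x} (hx : x ∈ π.J z) : x ≠ π.sp z' i := fun h1 =>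
  h.sp_notMem z' i z (h1 ▸ hx)

lemma τ_inj {z z' x y} (hx : x ∈ π.J z) (hy : y ∈ π.J z') (hxy : π.τ x = π.τ y) : x = y := by
  rw [← h.τ_τ hx, hxy, h.τ_τ hy]

/-- The extended strand keeps the label of the special end, and `π.τ x` becomes its new free end, so
which special ends belong together is unaffected. The old special end and `x` each gain one chosen
edge and cease to be free, which preserves the degree identity. -/
theorem mergeA {z i x} (hx : x ∈ π.J z) : (π.mergeA z i x).Good s t := by
  have hτx := h.τ_mem hx
  have hcx := h.c_sp hx
  have hcτ := h.c_τ hx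
  have memJ : ∀ {z' y}, y ∈ (π.mergeA z i x).J z' ↔ y ≠ π.τ x ∧ y ≠ x ∧ y ∈ π.J z' := by
    intro z' y; simp [Conf.mergeA]
  have cJ : ∀ {z' y}, y ∈ (π.mergeA z i x).J z' → π.c y ≠ π.c x := by
    intro z' y hy hc
    obtain ⟨h1, h2, h3⟩ := memJ.1 hy
    rcases h.c_J hx h3 hc.symm with h4 | h4 <;> contradiction
  have csp : ∀ z' j, (π.mergeA z i x).c ((π.mergeA z i x).sp z' j) = π.c (π.sp z' j) := by
    intro z' j
    simp only [Conf.mergeA]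
    by_cases h1 : z' = z ∧ j = i
    · simp [h1, hcτ]
    · rw [if_neg h1, if_neg fun h2 => hcx _ _ h2.symm]
  have hadj : ∀ {a b}, (π.mergeA z i x).F.Adj a b ↔ π.F.Adj a b ∨
      ((a = π.sp z i ∧ b = x) ∨ (a = x ∧ b = π.sp z i)) ∧ a ≠ b := by
    intro a b
    simp only [Conf.mergeA, SimpleGraph.sup_adj, SimpleGraph.edge_adj]
  have cJ' : ∀ {z' y}, y ∈ (π.mergeA z i x).J z' → (π.mergeA z i x).c y = π.c y := by
    intro z' y hy
    simp only [Conf.mergeA, if_neg (cJ hy)]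
  have hfree : ∀ v, (π.mergeA z i x).IsFree v ↔ π.IsFree v ∧ v ≠ π.sp z i ∧ v ≠ x := by
    intro v
    simp only [Conf.IsFree, memJ]
    constructor
    · rintro (⟨z', j, rfl⟩ | ⟨z', h1, h2, h3⟩)
      · simp only [Conf.mergeA]
        by_cases h1 : z' = z ∧ j = i
        · rw [if_pos h1]
          exact ⟨Or.inr ⟨z, hτx⟩, h.sp_ne hτx, h.τ_ne hx⟩
        · rw [if_neg h1]
          exact ⟨Or.inl ⟨_, _, rfl⟩, fun h2 => h1 (h.sp_inj h2), (h.sp_ne hx).symm⟩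
      · exact ⟨Or.inr ⟨_, h3⟩, h.sp_ne h3, h2⟩
    · rintro ⟨⟨z', j, rfl⟩ | ⟨z', h1⟩, h2, h3⟩
      · refine Or.inl ⟨z', j, ?_⟩
        simp only [Conf.mergeA]
        rw [if_neg]
        rintro ⟨rfl, rfl⟩
        exact h2 rfl
      · by_cases h4 : v = π.τ x
        · exact Or.inl ⟨z, i, by simp [Conf.mergeA, h4]⟩
        · exact Or.inr ⟨z', h4, h3, h1⟩
  refine
    { sp_inj := ?_, sp_notMem := ?_, J_disj := ?_, τ_mem := ?_, τ_ne := ?_, τ_τ := ?_, c_τ := ?_,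
      c_J := ?_, c_sp := ?_, c_one := ?_, c_two := ?_, c_one_two := ?_, c_s := ?_, c_t := ?_,
      adj_c := ?_, conn := ?_, cover := ?_, deg := ?_ }
  · intro z1 i1 z2 i2 he
    simp only [Conf.mergeA] at he
    by_cases h1 : z1 = z ∧ i1 = i <;> by_cases h2 : z2 = z ∧ i2 = i
    · rw [h1.1, h1.2, h2.1, h2.2]; simp
    · rw [if_pos h1, if_neg h2] at he
      exact absurd he (h.sp_ne hτx)
    · rw [if_neg h1, if_pos h2] at he
      exact absurd he.symm (h.sp_ne hτx)
    · rw [if_neg h1, if_neg h2] at he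
      exact h.sp_inj he
  · intro z1 i1 z2 hm
    obtain ⟨h1, h2, h3⟩ := memJ.1 hm
    simp only [Conf.mergeA] at h1 h3
    by_cases h4 : z1 = z ∧ i1 = i
    · rw [if_pos h4] at h1; exact h1 rfl
    · rw [if_neg h4] at h3; exact h.sp_notMem _ _ _ h3
  · exact fun h1 h2 => h.J_disj (memJ.1 h1).2.2 (memJ.1 h2).2.2
  · intro z' y hy
    obtain ⟨h1, h2, h3⟩ := memJ.1 hy
    refine memJ.2 ⟨fun h4 => h2 (h.τ_inj h3 hx h4), fun h4 => h1 ?_, h.τ_mem h3⟩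
    change π.τ y = x at h4
    rw [← h4, h.τ_τ h3]
  · exact fun hy => h.τ_ne (memJ.1 hy).2.2
  · exact fun hy => h.τ_τ (memJ.1 hy).2.2
  · intro z' y hy
    have := cJ hy
    simp only [Conf.mergeA, h.c_τ (memJ.1 hy).2.2]
  · intro z1 z2 y1 y2 h1 h2 h3
    rw [cJ' h1, cJ' h2] at h3
    exact h.c_J (memJ.1 h1).2.2 (memJ.1 h2).2.2 h3
  · intro z' y hy z1 j
    rw [cJ' hy, csp]
    exact h.c_sp (memJ.1 hy).2.2 _ _
  · rw [csp, csp, h.c_one]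
  · rw [csp, csp, h.c_two]
  · rw [csp, csp]; exact h.c_one_two
  · rw [csp]
    simp only [Conf.mergeA, h.c_s]
    rw [if_neg (hcx _ _).symm]
  · rw [csp]
    simp only [Conf.mergeA, h.c_t]
    rw [if_neg (hcx _ _).symm]
  · intro u v huv
    rcases hadj.1 huv with h1 | ⟨⟨rfl, rfl⟩ | ⟨rfl, rfl⟩, -⟩
    · simp only [Conf.mergeA, h.adj_c h1]
    · simp [Conf.mergeA]
    · simp [Conf.mergeA]
  · refine conn_relabel (p := π.sp z i) (q := x) (fun h1 => hadj.2 (Or.inl h1)) ?_ h.conn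
    exact hadj.2 (Or.inr ⟨Or.inl ⟨rfl, rfl⟩, (h.sp_ne hx).symm⟩)
  · intro v
    by_cases hv : π.c v = π.c x
    · refine ⟨π.τ x, (hfree _).2 ⟨Or.inr ⟨z, hτx⟩, h.sp_ne hτx, h.τ_ne hx⟩, ?_⟩
      simp only [Conf.mergeA, hcτ, hv]
    · obtain ⟨u, hu, huv⟩ := h.cover v
      by_cases h1 : u = π.sp z i
      · refine ⟨π.τ x, (hfree _).2 ⟨Or.inr ⟨z, hτx⟩, h.sp_ne hτx, h.τ_ne hx⟩, ?_⟩
        simp only [Conf.mergeA, hcτ, if_neg hv, if_true, ← huv, h1, ite_self]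
      · refine ⟨u, (hfree _).2 ⟨hu, h1, fun h2 => hv (by rw [← huv, h2])⟩, ?_⟩
        simp only [Conf.mergeA, huv]
  · intro v
    have hd := h.deg v
    have hs := sum_adj_sup_edge (h.sp_ne hx).symm (h.not_adj_sp hx (z' := z) (i := i))
      (F' := (π.mergeA z i x).F) rfl v
    rw [hs]
    have hf1 : π.IsFree (π.sp z i) := Or.inl ⟨_, _, rfl⟩
    have hf2 : π.IsFree x := Or.inr ⟨_, hx⟩
    have hne := h.sp_ne hx (z' := z) (i := i)
    rw [hfree v]
    by_cases h1 : v = π.sp z i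
    · subst h1
      simp only [hf1, if_true] at hd
      simp only [hne.symm, true_and, not_true_eq_false, false_and, and_false, if_true, if_false, ne_eq] at hd ⊢
      omega
    · by_cases h2 : v = x
      · subst h2
        simp only [hf2, if_true] at hd
        simp only [h1, true_and, not_true_eq_false, false_and, and_false, if_true, if_false, ne_eq] at hd ⊢
        omega
      · simp [h1, h2]; simpa using hd

/-- The far ends `π.τ x` and `π.τ y` become each other's mates on the joint strand. The hypothesis
`y ≠ π.τ x` prevents the new edge from closing a segment into a cycle. -/
theorem mergeB {z x y} (hx : x ∈ π.J z) (hy : y ∈ π.J z) (hxy : y ≠ x) (hxy' : y ≠ π.τ x) :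
    (π.mergeB x y).Good s t := by
  have hτx := h.τ_mem hx
  have hτy := h.τ_mem hy
  have hcx := h.c_sp hx
  have hcy := h.c_sp hy
  have hcτx := h.c_τ hx
  have hcτy := h.c_τ hy
  have hxτy : x ≠ π.τ y := fun h1 => hxy' (by rw [h1, h.τ_τ hy])
  have hττ : π.τ x ≠ π.τ y := fun h1 => hxy (h.τ_inj hx hy h1).symm
  have hcxy : π.c x ≠ π.c y := fun h1 => by rcases h.c_J hx hy h1 with h2 | h2 <;> contradiction
  have memJ : ∀ {z' w}, w ∈ (π.mergeB x y).J z' ↔ w ≠ y ∧ w ≠ x ∧ w ∈ π.J z' := by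
    intro z' y; simp [Conf.mergeB]
  have csp : ∀ z' j, (π.mergeB x y).c ((π.mergeB x y).sp z' j) = π.c (π.sp z' j) := by
    intro z' j
    simp only [Conf.mergeB]
    rw [if_neg fun h2 => hcy _ _ h2.symm]
  have hadj : ∀ {a b}, (π.mergeB x y).F.Adj a b ↔ π.F.Adj a b ∨
      ((a = x ∧ b = y) ∨ (a = y ∧ b = x)) ∧ a ≠ b := by
    intro a b
    simp only [Conf.mergeB, SimpleGraph.sup_adj, SimpleGraph.edge_adj]
  have hfree : ∀ v, (π.mergeB x y).IsFree v ↔ π.IsFree v ∧ v ≠ x ∧ v ≠ y := by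
    intro v
    simp only [Conf.IsFree, memJ]
    constructor
    · rintro (⟨z', j, rfl⟩ | ⟨z', h1, h2, h3⟩)
      · exact ⟨Or.inl ⟨_, _, rfl⟩, (h.sp_ne hx).symm, (h.sp_ne hy).symm⟩
      · exact ⟨Or.inr ⟨_, h3⟩, h2, h1⟩
    · rintro ⟨⟨z', j, rfl⟩ | ⟨z', h1⟩, h2, h3⟩
      · exact Or.inl ⟨z', j, rfl⟩
      · exact Or.inr ⟨z', h3, h2, h1⟩
  have τ1 : (π.mergeB x y).τ (π.τ x) = π.τ y := by simp [Conf.mergeB]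
  have τ2 : (π.mergeB x y).τ (π.τ y) = π.τ x := by simp [Conf.mergeB, hττ.symm]
  have τ3 : ∀ {w}, w ≠ π.τ x → w ≠ π.τ y → (π.mergeB x y).τ w = π.τ w := by
    intro w h1 h2; simp [Conf.mergeB, h1, h2]
  have cτ1 : (π.mergeB x y).c (π.τ x) = π.c x := by simp [Conf.mergeB, hcτx]
  have cτ2 : (π.mergeB x y).c (π.τ y) = π.c x := by simp [Conf.mergeB, hcτy]
  have cc : ∀ {z' w}, w ∈ (π.mergeB x y).J z' → w ≠ π.τ x → w ≠ π.τ y →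
      π.c w ≠ π.c x ∧ π.c w ≠ π.c y := by
    intro z' w hw h1 h2
    obtain ⟨h3, h4, h5⟩ := memJ.1 hw
    constructor
    · intro h6
      rcases h.c_J hx h5 h6.symm with h7 | h7 <;> contradiction
    · intro h6
      rcases h.c_J hy h5 h6.symm with h7 | h7 <;> contradiction
  have c3 : ∀ {z' w}, w ∈ (π.mergeB x y).J z' → w ≠ π.τ x → w ≠ π.τ y →
      (π.mergeB x y).c w = π.c w := by
    intro z' w hw h1 h2
    simp only [Conf.mergeB]
    rw [if_neg (cc hw h1 h2).2]
  have m1 : π.τ x ∈ (π.mergeB x y).J z := memJ.2 ⟨hxy'.symm, h.τ_ne hx, hτx⟩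
  have m2 : π.τ y ∈ (π.mergeB x y).J z := memJ.2 ⟨h.τ_ne hy, hxτy.symm, hτy⟩
  have m3 : ∀ {z' w}, w ∈ (π.mergeB x y).J z' → w ≠ π.τ x → w ≠ π.τ y →
      π.τ w ∈ (π.mergeB x y).J z' ∧ π.τ w ≠ π.τ x ∧ π.τ w ≠ π.τ y := by
    intro z' w hw h1 h2
    obtain ⟨h3, h4, h5⟩ := memJ.1 hw
    refine ⟨memJ.2 ⟨fun h6 => h2 ?_, fun h6 => h1 ?_, h.τ_mem h5⟩,
      fun h6 => h4 (h.τ_inj h5 hx h6), fun h6 => h3 (h.τ_inj h5 hy h6)⟩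
    · rw [← h6, h.τ_τ h5]
    · rw [← h6, h.τ_τ h5]
  refine
    { sp_inj := h.sp_inj, sp_notMem := ?_, J_disj := ?_, τ_mem := ?_, τ_ne := ?_, τ_τ := ?_,
      c_τ := ?_, c_J := ?_, c_sp := ?_, c_one := ?_, c_two := ?_, c_one_two := ?_, c_s := ?_,
      c_t := ?_, adj_c := ?_, conn := ?_, cover := ?_, deg := ?_ }
  · exact fun z1 i1 z2 hm => h.sp_notMem _ _ _ (memJ.1 hm).2.2
  · exact fun h1 h2 => h.J_disj (memJ.1 h1).2.2 (memJ.1 h2).2.2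
  · intro z' w hw
    by_cases h1 : w = π.τ x
    · rw [h1, τ1]
      have := h.J_disj hτx (h1 ▸ (memJ.1 hw).2.2)
      exact this ▸ m2
    · by_cases h2 : w = π.τ y
      · rw [h2, τ2]
        have := h.J_disj hτy (h2 ▸ (memJ.1 hw).2.2)
        exact this ▸ m1
      · rw [τ3 h1 h2]; exact (m3 hw h1 h2).1
  · intro z' w hw
    by_cases h1 : w = π.τ x
    · rw [h1, τ1]; exact hττ.symm
    · by_cases h2 : w = π.τ y
      · rw [h2, τ2]; exact hττ
      · rw [τ3 h1 h2]; exact h.τ_ne (memJ.1 hw).2.2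
  · intro z' w hw
    by_cases h1 : w = π.τ x
    · rw [h1, τ1, τ2]
    · by_cases h2 : w = π.τ y
      · rw [h2, τ2, τ1]
      · rw [τ3 h1 h2, τ3 (m3 hw h1 h2).2.1 (m3 hw h1 h2).2.2]
        exact h.τ_τ (memJ.1 hw).2.2
  · intro z' w hw
    by_cases h1 : w = π.τ x
    · rw [h1, τ1, cτ1, cτ2]
    · by_cases h2 : w = π.τ y
      · rw [h2, τ2, cτ1, cτ2]
      · have h3 := m3 hw h1 h2
        rw [τ3 h1 h2, c3 hw h1 h2, c3 h3.1 h3.2.1 h3.2.2]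
        exact h.c_τ (memJ.1 hw).2.2
  · intro z1 z2 w1 w2 hw1 hw2 hc
    by_cases a1 : w1 = π.τ x
    · by_cases a2 : w2 = π.τ x
      · left; rw [a1, a2]
      · by_cases a3 : w2 = π.τ y
        · right; rw [a1, τ1, a3]
        · rw [a1, cτ1, c3 hw2 a2 a3] at hc
          exact absurd hc.symm (cc hw2 a2 a3).1
    · by_cases a1' : w1 = π.τ y
      · by_cases a2 : w2 = π.τ x
        · right; rw [a1', τ2, a2]
        · by_cases a3 : w2 = π.τ y
          · left; rw [a1', a3]
          · rw [a1', cτ2, c3 hw2 a2 a3] at hc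
            exact absurd hc.symm (cc hw2 a2 a3).1
      · rw [c3 hw1 a1 a1'] at hc
        by_cases a2 : w2 = π.τ x
        · rw [a2, cτ1] at hc
          exact absurd hc (cc hw1 a1 a1').1
        · by_cases a3 : w2 = π.τ y
          · rw [a3, cτ2] at hc
            exact absurd hc (cc hw1 a1 a1').1
          · rw [c3 hw2 a2 a3] at hc
            rw [τ3 a1 a1']
            exact h.c_J (memJ.1 hw1).2.2 (memJ.1 hw2).2.2 hc
  · intro z' w hw z1 j
    rw [csp]
    by_cases h1 : w = π.τ x
    · rw [h1, cτ1]; exact hcx _ _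
    · by_cases h2 : w = π.τ y
      · rw [h2, cτ2]; exact hcx _ _
      · rw [c3 hw h1 h2]; exact h.c_sp (memJ.1 hw).2.2 _ _
  · rw [csp, csp, h.c_one]
  · rw [csp, csp, h.c_two]
  · rw [csp, csp]; exact h.c_one_two
  · rw [csp]
    simp only [Conf.mergeB, h.c_s]
    rw [if_neg (hcy _ _).symm]
  · rw [csp]
    simp only [Conf.mergeB, h.c_t]
    rw [if_neg (hcy _ _).symm]
  · intro u v huv
    rcases hadj.1 huv with h1 | ⟨⟨rfl, rfl⟩ | ⟨rfl, rfl⟩, -⟩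
    · simp only [Conf.mergeB, h.adj_c h1]
    · simp [Conf.mergeB]
    · simp [Conf.mergeB]
  · refine conn_relabel (p := x) (q := y) (fun h1 => hadj.2 (Or.inl h1)) ?_ h.conn
    exact hadj.2 (Or.inr ⟨Or.inl ⟨rfl, rfl⟩, hxy.symm⟩)
  · intro v
    have f1 : (π.mergeB x y).IsFree (π.τ x) := Or.inr ⟨_, m1⟩
    by_cases hv : π.c v = π.c y ∨ π.c v = π.c x
    · refine ⟨π.τ x, f1, ?_⟩
      rw [cτ1]
      simp only [Conf.mergeB]
      rcases hv with hv | hv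
      · rw [if_pos hv]
      · rw [hv, if_neg hcxy]
    · obtain ⟨u, hu, huv⟩ := h.cover v
      push Not at hv
      refine ⟨u, (hfree _).2 ⟨hu, fun h2 => hv.2 (by rw [← huv, h2]),
        fun h2 => hv.1 (by rw [← huv, h2])⟩, ?_⟩
      simp only [Conf.mergeB, huv]
  · intro v
    have hd := h.deg v
    have hs := sum_adj_sup_edge hxy.symm (h.not_adj_J hx hy hxy')
      (F' := (π.mergeB x y).F) rfl v
    rw [hs]
    have hf1 : π.IsFree x := Or.inr ⟨_, hx⟩
    have hf2 : π.IsFree y := Or.inr ⟨_, hy⟩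
    rw [hfree v]
    by_cases h1 : v = x
    · subst h1
      simp only [hf1, if_true] at hd
      simp only [hxy.symm, true_and, not_true_eq_false, false_and, and_false, if_true, if_false, ne_eq] at hd ⊢
      omega
    · by_cases h2 : v = y
      · subst h2
        simp only [hf2, if_true] at hd
        simp only [h1, true_and, not_true_eq_false, false_and, and_false, if_true, if_false, ne_eq] at hd ⊢
        omega
      · simp [h1, h2]; simpa using hd

end Good

end Conf

end


/-! ### The weights of a configuration and their degrees. -/

noncomputable section

open scoped Classical

namespace Conf

variable {V L : Type*} (π : Conf V L)

/-- The fractional part of the weight. -/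
def frac (u w : V) : ℝ :=
  ∑ z, if ((∃ i, u = π.sp z i) ∧ w ∈ π.J z) ∨ ((∃ i, w = π.sp z i) ∧ u ∈ π.J z)
    then alphaW (π.N z)
    else if u ∈ π.J z ∧ w ∈ π.J z ∧ u ≠ w ∧ w ≠ π.τ u ∧ u ≠ π.τ w then betaW (π.N z) else 0

/-- The weight of a pair of vertices: one on chosen edges, fractional between free ends. -/
def wt (u w : V) : ℝ := (if π.F.Adj u w then 1 else 0) + π.frac u w

lemma frac_comm (u w : V) : π.frac u w = π.frac w u := by
  unfold frac
  refine Finset.sum_congr rfl fun z _ => ?_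
  congr 1
  · exact propext or_comm
  · congr 1
    apply propext
    constructor <;> rintro ⟨h1, h2, h3, h4, h5⟩ <;> exact ⟨h2, h1, h3.symm, h5, h4⟩

lemma wt_comm (u w : V) : π.wt u w = π.wt w u := by
  rw [wt, wt, frac_comm, SimpleGraph.adj_comm]

/-- An edge between a special end and a segment end. -/
def IsA (z : Bool) (i : Fin 3) (x u w : V) : Prop :=
  x ∈ π.J z ∧ ((u = π.sp z i ∧ w = x) ∨ (u = x ∧ w = π.sp z i))

/-- An edge between the ends of two different segments. -/
def IsB (z : Bool) (u w : V) : Prop := u ∈ π.J z ∧ w ∈ π.J z ∧ w ≠ u ∧ w ≠ π.τ u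

variable {π}

lemma frac_eq_zero {u w : V} (hA : ∀ z i x, ¬ π.IsA z i x u w) (hB : ∀ z, ¬ π.IsB z u w) :
    π.frac u w = 0 := by
  unfold frac
  refine Finset.sum_eq_zero fun z _ => ?_
  rw [if_neg, if_neg]
  · rintro ⟨h1, h2, h3, h4, -⟩
    exact hB z ⟨h1, h2, h3.symm, h4⟩
  · rintro (⟨⟨i, h1⟩, h2⟩ | ⟨⟨i, h1⟩, h2⟩)
    · exact hA z i w ⟨h2, Or.inl ⟨h1, rfl⟩⟩
    · exact hA z i u ⟨h2, Or.inr ⟨rfl, h1⟩⟩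

lemma frac_of_not_free {u : V} (h : ¬ π.IsFree u) (w : V) : π.frac u w = 0 := by
  apply frac_eq_zero
  · rintro z i x ⟨hx, ⟨h1, -⟩ | ⟨h1, -⟩⟩
    · exact h (Or.inl ⟨z, i, h1⟩)
    · exact h (Or.inr ⟨z, h1 ▸ hx⟩)
  · rintro z ⟨h1, -⟩
    exact h (Or.inr ⟨z, h1⟩)

namespace Good

variable [Fintype V] {s t : V} (h : π.Good s t)
include h

lemma frac_sp_J (z : Bool) (i : Fin 3) {z' : Bool} {x : V} (hx : x ∈ π.J z') :
    π.frac (π.sp z i) x = if z' = z then alphaW (π.N z) else 0 := by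
  unfold frac
  rw [Finset.sum_eq_single z]
  · by_cases hz : z' = z
    · subst hz
      rw [if_pos (Or.inl ⟨⟨i, rfl⟩, hx⟩), if_pos rfl]
    · rw [if_neg, if_neg, if_neg hz]
      · rintro ⟨h1, -⟩
        exact h.sp_notMem _ _ _ h1
      · rintro (⟨-, h1⟩ | ⟨-, h1⟩)
        · exact hz (h.J_disj hx h1)
        · exact h.sp_notMem _ _ _ h1
  · intro z0 _ hz
    rw [if_neg, if_neg]
    · rintro ⟨h1, -⟩
      exact h.sp_notMem _ _ _ h1
    · rintro (⟨⟨j, h1⟩, -⟩ | ⟨-, h1⟩)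
      · exact hz (h.sp_inj h1).1.symm
      · exact h.sp_notMem _ _ _ h1
  · simp

lemma frac_sp_sp (z z' : Bool) (i j : Fin 3) : π.frac (π.sp z i) (π.sp z' j) = 0 := by
  apply frac_eq_zero
  · rintro z i x ⟨hx, ⟨-, h1⟩ | ⟨h1, -⟩⟩
    · exact h.sp_notMem _ _ _ (h1 ▸ hx)
    · exact h.sp_notMem _ _ _ (h1 ▸ hx)
  · rintro z ⟨h1, -⟩
    exact h.sp_notMem _ _ _ h1

lemma frac_J_J {z z' : Bool} {x y : V} (hx : x ∈ π.J z) (hy : y ∈ π.J z') :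
    π.frac x y = if z' = z ∧ y ≠ x ∧ y ≠ π.τ x then betaW (π.N z) else 0 := by
  unfold frac
  rw [Finset.sum_eq_single z]
  · rw [if_neg]
    · congr 1
      apply propext
      constructor
      · rintro ⟨-, h2, h3, h4, -⟩
        exact ⟨h.J_disj hy h2, h3.symm, h4⟩
      · rintro ⟨rfl, h2, h3⟩
        exact ⟨hx, hy, h2.symm, h3, fun h4 => h3 (by rw [h4, h.τ_τ hy])⟩
    · rintro (⟨⟨i, h1⟩, -⟩ | ⟨⟨i, h1⟩, -⟩)
      · exact h.sp_ne hx h1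
      · exact h.sp_ne hy h1
  · intro z0 _ hz
    rw [if_neg, if_neg]
    · rintro ⟨h1, -⟩
      exact hz (h.J_disj h1 hx)
    · rintro (⟨⟨i, h1⟩, -⟩ | ⟨⟨i, h1⟩, -⟩)
      · exact h.sp_ne hx h1
      · exact h.sp_ne hy h1
  · simp

lemma IsB.symm {z u w} (hB : π.IsB z u w) : π.IsB z w u := by
  obtain ⟨h1, h2, h3, h4⟩ := hB
  exact ⟨h2, h1, h3.symm, fun h5 => h4 (by rw [h5, h.τ_τ h2])⟩

lemma not_adj_A {z i x u w} (hA : π.IsA z i x u w) : ¬ π.F.Adj u w := by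
  obtain ⟨hx, ⟨rfl, rfl⟩ | ⟨rfl, rfl⟩⟩ := hA
  · exact h.not_adj_sp hx
  · exact fun ha => h.not_adj_sp hx ha.symm

lemma not_adj_B {z u w} (hB : π.IsB z u w) : ¬ π.F.Adj u w :=
  h.not_adj_J hB.1 hB.2.1 hB.2.2.2

lemma wt_of_adj {u w : V} (ha : π.F.Adj u w) : π.wt u w = 1 := by
  rw [wt, if_pos ha, frac_eq_zero, add_zero]
  · exact fun z i x hA => h.not_adj_A hA ha
  · exact fun z hB => h.not_adj_B hB ha

lemma wt_sp_J {z : Bool} (i : Fin 3) {x : V} (hx : x ∈ π.J z) :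
    π.wt (π.sp z i) x = alphaW (π.N z) := by
  rw [wt, if_neg (h.not_adj_sp hx), h.frac_sp_J z i hx, if_pos rfl, zero_add]

lemma wt_IsB {z : Bool} {x y : V} (hB : π.IsB z x y) : π.wt x y = betaW (π.N z) := by
  rw [wt, if_neg (h.not_adj_B hB), h.frac_J_J hB.1 hB.2.1, if_pos ⟨rfl, hB.2.2⟩, zero_add]

omit [Fintype V] h in
-- Induction principle for symmetric statements about pairs: chosen edges, pairs of weight zero, and
-- the two kinds of fractional pairs. It organises all later comparisons of conditioned weights.
lemma edge_cases {P : V → V → Prop} (symm : ∀ u w, P u w → P w u)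
    (adj : ∀ u w, π.F.Adj u w → P u w)
    (zero : ∀ u w, ¬ π.F.Adj u w → (∀ z i x, ¬ π.IsA z i x u w) → (∀ z, ¬ π.IsB z u w) → P u w)
    (spJ : ∀ z i x, x ∈ π.J z → P (π.sp z i) x) (JJ : ∀ z u w, π.IsB z u w → P u w) (u w : V) :
    P u w := by
  by_cases h1 : π.F.Adj u w
  · exact adj u w h1
  by_cases h2 : ∃ z i x, π.IsA z i x u w
  · obtain ⟨z, i, x, hx, ⟨rfl, rfl⟩ | ⟨rfl, rfl⟩⟩ := h2
    · exact spJ z i _ hx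
    · exact symm _ _ (spJ z i _ hx)
  by_cases h3 : ∃ z, π.IsB z u w
  · obtain ⟨z, hz⟩ := h3
    exact JJ z u w hz
  push Not at h2 h3
  exact zero u w h1 h2 h3

/-- Sums over the vertices of a function supported on the free ends. -/
lemma sum_free (φ : V → ℝ) (hφ : ∀ v, ¬ π.IsFree v → φ v = 0) :
    ∑ v, φ v = ∑ z, (∑ i, φ (π.sp z i) + ∑ x ∈ π.J z, φ x) := by
  let S : Finset V := (Finset.univ : Finset (Bool × Fin 3)).image (fun p => π.sp p.1 p.2)
  let T : Finset V := (Finset.univ : Finset Bool).biUnion π.J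
  have hST : Disjoint S T := by
    rw [Finset.disjoint_left]
    intro v hv hv'
    simp only [S, T, Finset.mem_image, Finset.mem_biUnion, Finset.mem_univ, true_and] at hv hv'
    obtain ⟨p, rfl⟩ := hv
    obtain ⟨z, hz⟩ := hv'
    exact h.sp_notMem _ _ _ hz
  have h1 : ∑ v, φ v = ∑ v ∈ S ∪ T, φ v := by
    symm
    apply Finset.sum_subset (Finset.subset_univ _)
    intro v _ hv
    apply hφ
    rintro (⟨z, i, rfl⟩ | ⟨z, hz⟩)
    · exact hv (Finset.mem_union_left _ (Finset.mem_image.2 ⟨(z, i), by simp, rfl⟩))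
    · exact hv (Finset.mem_union_right _ (Finset.mem_biUnion.2 ⟨z, by simp, hz⟩))
  rw [h1, Finset.sum_union hST, Finset.sum_image, Finset.sum_biUnion, Finset.sum_add_distrib,
    ← Finset.univ_product_univ, Finset.sum_product]
  · intro z _ z' _ hz
    rw [Function.onFun, Finset.disjoint_left]
    exact fun x hx hx' => hz (h.J_disj hx hx')
  · rintro ⟨z, i⟩ _ ⟨z', j⟩ _ he
    obtain ⟨rfl, rfl⟩ := h.sp_inj he
    rfl

lemma sum_J_ne {z : Bool} {x : V} (hx : x ∈ π.J z) (φ : V → ℝ) :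
    ∑ y ∈ π.J z, (if y ≠ x ∧ y ≠ π.τ x then φ y else 0)
      = ∑ y ∈ π.J z, φ y - φ x - φ (π.τ x) := by
  have key : ∀ y, (if y ≠ x ∧ y ≠ π.τ x then φ y else 0)
      = φ y - (if y = x then φ y else 0) - (if y = π.τ x then φ y else 0) := by
    intro y
    by_cases h1 : y = x
    · subst h1; simp [(h.τ_ne hx).symm]
    · by_cases h2 : y = π.τ x <;> simp [h1, h2, h.τ_ne hx]
  simp only [key, Finset.sum_sub_distrib, Finset.sum_ite_eq', hx, h.τ_mem hx, if_true]

/-- These identities determine the weights: a special end sees `N` edges of weight `1 / N`, and a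
segment end sees `3 / N` from the special ends and `(N - 2) * betaW N = (N - 3) / N` from the other
segments. -/
lemma sum_frac (hN : ∀ z, 2 < π.N z) (v : V) :
    ∑ b, π.frac v b = if π.IsFree v then 1 else 0 := by
  by_cases hv : π.IsFree v
  swap
  · simp [hv, frac_of_not_free hv]
  rw [if_pos hv, h.sum_free _ fun b hb => by rw [frac_comm, frac_of_not_free hb]]
  rcases hv with ⟨z, i, rfl⟩ | ⟨z, hz⟩
  · simp only [h.frac_sp_sp, Finset.sum_const_zero, zero_add]
    have : ∀ z', ∑ x ∈ π.J z', π.frac (π.sp z i) x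
        = if z' = z then 1 else 0 := by
      intro z'
      rw [Finset.sum_congr rfl fun x hx => h.frac_sp_J z i hx]
      by_cases hz : z' = z
      · subst hz
        have := hN z'
        simp only [if_true, Finset.sum_const, nsmul_eq_mul, alphaW]
        change π.N z' * (1 / π.N z') = 1
        field_simp
      · simp [hz]
    simp [this]
  · have h1 : ∀ z' j, π.frac v (π.sp z' j) = if z' = z then alphaW (π.N z) else 0 := by
      intro z' j
      rw [frac_comm, h.frac_sp_J z' j hz]
      by_cases hz' : z = z'
      · simp [hz']
      · simp [hz', Ne.symm hz']
    have h2 : ∀ z', ∑ x ∈ π.J z', π.frac v x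
        = if z' = z then (π.N z - 2) * betaW (π.N z) else 0 := by
      intro z'
      by_cases hz' : z' = z
      · subst hz'
        have : ∀ x ∈ π.J z', π.frac v x
            = if x ≠ v ∧ x ≠ π.τ v then betaW (π.N z') else 0 := by
          intro x hx
          rw [h.frac_J_J hz hx]; simp
        rw [Finset.sum_congr rfl this, h.sum_J_ne hz fun _ => betaW (π.N z')]
        simp only [Finset.sum_const, nsmul_eq_mul, if_true]
        change π.N z' * _ - _ - _ = _
        ring
      · rw [if_neg hz']
        exact Finset.sum_eq_zero fun x hx => by rw [h.frac_J_J hz hx]; simp [hz']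
    simp only [h1, h2, Finset.sum_add_distrib, Finset.sum_const, Finset.card_univ,
      Fintype.card_fin, Finset.sum_ite_eq', Finset.mem_univ, if_true, smul_ite, smul_zero]
    have := hN z
    have h3 : π.N z - 2 ≠ 0 := by linarith
    have h4 : π.N z ≠ 0 := by linarith
    simp only [alphaW, betaW, nsmul_eq_mul]
    push_cast
    field_simp
    ring

lemma frac_nonneg (hN : ∀ z, 3 ≤ π.N z) (u w : V) : 0 ≤ π.frac u w := by
  unfold frac
  refine Finset.sum_nonneg fun z _ => ?_
  have := hN z
  split_ifs
  · unfold alphaW; positivity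
  · unfold betaW
    exact div_nonneg (by linarith) (mul_nonneg (by linarith) (by linarith))
  · exact le_rfl

lemma wt_nonneg (hN : ∀ z, 3 ≤ π.N z) (u w : V) : 0 ≤ π.wt u w := by
  unfold wt
  have := h.frac_nonneg hN u w
  split_ifs <;> linarith

/-- A fractional edge weighs at most the total fractional degree of its end, which is at most one.
-/
lemma wt_le_one (hN : ∀ z, 3 ≤ π.N z) (u w : V) : π.wt u w ≤ 1 := by
  by_cases ha : π.F.Adj u w
  · exact (h.wt_of_adj ha).le
  · rw [wt, if_neg ha, zero_add]
    have h1 : π.frac u w ≤ ∑ b, π.frac u b :=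
      Finset.single_le_sum (f := fun b => π.frac u b) (fun b _ => h.frac_nonneg hN u b)
        (Finset.mem_univ w)
    rw [h.sum_frac fun z => by linarith [hN z]] at h1
    split_ifs at h1 <;> linarith

lemma wt_self (u : V) : π.wt u u = 0 := by
  rw [wt, if_neg (by simp), frac_eq_zero, add_zero]
  · rintro z i x ⟨hx, ⟨h1, h2⟩ | ⟨h1, h2⟩⟩
    · exact h.sp_ne hx (h2.symm.trans h1)
    · exact h.sp_ne hx (h1.symm.trans h2)
  · rintro z ⟨-, -, h1, -⟩
    exact h1 rfl

lemma sum_wt (hN : ∀ z, 2 < π.N z) (v : V) :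
    ∑ b, π.wt v b = 2 - (if v = s then 1 else 0) - (if v = t then 1 else 0) := by
  have hd := h.deg v
  have h1 : ((∑ b, if π.F.Adj v b then 1 else 0 : ℕ) : ℝ) = ∑ b, if π.F.Adj v b then 1 else 0 := by
    push_cast; rfl
  have h2 : ((∑ b, if π.F.Adj v b then 1 else 0 : ℕ) : ℝ) + (if v = s then 1 else 0)
    + (if v = t then 1 else 0) + (if π.IsFree v then 1 else 0) = 2 := by exact_mod_cast hd
  simp only [wt, Finset.sum_add_distrib, h.sum_frac hN]
  rw [← h1]
  linarith

end Good

end Conf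

end


/-! ### Fractional cuts inside one zone. -/

noncomputable section

open scoped Classical

/-- The fractional weight of a cut of a zone: `a` special ends and `n` segment ends are on one
side, and `k` segments are split. -/
def zoneCut (N a n k : ℝ) : ℝ :=
  alphaW N * (a * (N - n) + (3 - a) * n) + betaW N * (n * (N - n) - k)

lemma zoneCut_compl (N a n k : ℝ) : zoneCut N (3 - a) (N - n) k = zoneCut N a n k := by
  unfold zoneCut; ring

section

variable {N n k : ℝ} (hN : 9 ≤ N)
include hN

lemma betaW_nonneg : 0 ≤ betaW N :=
  div_nonneg (by linarith) (mul_nonneg (by linarith) (by linarith))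

/-- Three regimes. For `n = 1` this is the fractional degree of that end, apart from its mate. For
`3 * n ≥ N` the edges to the three special ends suffice. In between, at least `4 / 3 * N - 2` pairs
of segment ends are separated, more than the `N - 2` that occur at a single end. -/
lemma zoneCut_zero_ge_one (hn1 : n = 1 ∨ 2 ≤ n) (hnN : n ≤ N) (hk : k ≤ n) (hk' : k ≤ n * (N - n)) :
    1 ≤ zoneCut N 0 n k := by
  have hβ := betaW_nonneg hN
  have hN0 : 0 < N := by linarith
  have hN2 : 0 < N - 2 := by linarith
  have hα : alphaW N * N = 1 := by unfold alphaW; field_simp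
  have hα0 : 0 < alphaW N := by unfold alphaW; positivity
  have hβ' : betaW N * (N - 2) = 1 - 3 * alphaW N := by unfold alphaW betaW; field_simp
  unfold zoneCut
  rcases hn1 with rfl | hn2
  · nlinarith
  · rcases le_or_gt N (3 * n) with h | h
    · nlinarith [mul_nonneg hβ (sub_nonneg.2 hk')]
    · have h1 : 4 / 3 * N - 2 ≤ n * (N - n) - k := by nlinarith
      have h2 := mul_le_mul_of_nonneg_left h1 hβ
      have h3 : 1 - 3 * alphaW N ≤ betaW N * (4 / 3 * N - 2) := by
        rw [← hβ']; nlinarith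
      nlinarith

/-- With no segment split the excess over 2 factors; it vanishes at `n = 2`, and the other factor is
at least `N` at the extreme `n = N`. -/
lemma zoneCut_zero_ge_two (hn : 2 ≤ n) (hnN : n ≤ N) : 2 ≤ zoneCut N 0 n 0 := by
  have hN0 : 0 < N := by linarith
  have hN2 : 0 < N - 2 := by linarith
  have e : zoneCut N 0 n 0 - 2 = (n - 2) * (N * (N - 2) - n * (N - 3)) / (N * (N - 2)) := by
    unfold zoneCut alphaW betaW
    field_simp
    ring
  have : 0 ≤ (n - 2) * (N * (N - 2) - n * (N - 3)) / (N * (N - 2)) := by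
    apply div_nonneg
    · apply mul_nonneg (by linarith)
      nlinarith
    · positivity
  linarith

/-- With special ends on both sides, every segment end is separated from at least one of them, which
already gives `N * alphaW N = 1`. -/
lemma zoneCut_middle {a : ℝ} (ha : a = 1 ∨ a = 2) (hn0 : 0 ≤ n) (hnN : n ≤ N)
    (hk' : k ≤ n * (N - n)) : 1 ≤ zoneCut N a n k := by
  have hβ := betaW_nonneg hN
  have hN0 : 0 < N := by linarith
  have hα : alphaW N * N = 1 := by unfold alphaW; field_simp
  have hα0 : 0 < alphaW N := by unfold alphaW; positivity
  have h1 := mul_nonneg hβ (sub_nonneg.2 hk')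
  have h2 := mul_nonneg hα0.le hn0
  have h3 := mul_nonneg hα0.le (sub_nonneg.2 hnN)
  unfold zoneCut
  rcases ha with rfl | rfl <;> nlinarith

end

namespace Conf

variable {V L : Type*} (π : Conf V L)

/-- The number of special ends of a zone in a vertex set. -/
def numSp (S : Finset V) (z : Bool) : ℕ := ∑ i, if π.sp z i ∈ S then 1 else 0

/-- The number of segment ends of a zone in a vertex set. -/
def numJ (S : Finset V) (z : Bool) : ℕ := ∑ x ∈ π.J z, if x ∈ S then 1 else 0

/-- The number of segment ends of a zone in a vertex set with the other end outside. -/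
def numSplit (S : Finset V) (z : Bool) : ℕ :=
  ∑ x ∈ π.J z, if x ∈ S ∧ π.τ x ∉ S then 1 else 0

/-- No free end of the zone is in the set. -/
def ZoneOut (S : Finset V) (z : Bool) : Prop := (∀ i, π.sp z i ∉ S) ∧ ∀ x ∈ π.J z, x ∉ S

/-- The point of the edge space that belongs to a configuration. -/
def pt : (⊤ : SimpleGraph V).edgeSet → ℝ := edgePt π.wt

variable {π}

lemma numJ_le (S : Finset V) (z : Bool) : π.numJ S z ≤ (π.J z).card := by
  unfold numJ
  rw [Finset.card_eq_sum_ones]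
  exact Finset.sum_le_sum fun x _ => by split_ifs <;> simp

namespace Good

variable [Fintype V] {s t : V} (h : π.Good s t)
include h

lemma pairFn_pt (a b : V) : pairFn π.pt a b = π.wt a b := by
  by_cases hab : a = b
  · subst hab; simp [h.wt_self]
  · exact pairFn_edgePt π.wt_comm hab

/-- Expand the cut in the indicator of `S`. The product count `n * (N - n)` of separated segment
ends includes pairs of mates, which carry no fractional weight; `numSplit` takes them out. -/
lemma sum_frac_cut (S : Finset V) :
    ∑ a ∈ S, ∑ b ∈ Sᶜ, π.frac a b
      = ∑ z, zoneCut (π.N z) (π.numSp S z) (π.numJ S z) (π.numSplit S z) := by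
  let q : V → ℝ := fun v => if v ∈ S then 1 else 0
  have h1 : ∑ a ∈ S, ∑ b ∈ Sᶜ, π.frac a b = ∑ a, ∑ b, q a * ((1 - q b) * π.frac a b) := by
    rw [← Finset.sum_subset (Finset.subset_univ S)]
    · refine Finset.sum_congr rfl fun a ha => ?_
      rw [← Finset.sum_subset (Finset.subset_univ Sᶜ)]
      · refine Finset.sum_congr rfl fun b hb => ?_
        have : b ∉ S := by simpa using hb
        simp [q, ha, this]
      · intro b _ hb
        have : b ∈ S := by simpa using hb
        simp [q, this]
    · intro a _ ha
      simp [q, ha]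
  rw [h1, h.sum_free _ fun v hv => by simp [frac_of_not_free hv]]
  refine Finset.sum_congr rfl fun z _ => ?_
  have e1 : ∀ i, ∑ b, q (π.sp z i) * ((1 - q b) * π.frac (π.sp z i) b)
      = alphaW (π.N z) * (q (π.sp z i) * (π.N z - ∑ x ∈ π.J z, q x)) := by
    intro i
    rw [h.sum_free _ fun v hv => by rw [frac_comm, frac_of_not_free hv]; simp]
    have : ∀ z', ∑ x ∈ π.J z', q (π.sp z i) * ((1 - q x) * π.frac (π.sp z i) x)
        = if z' = z then alphaW (π.N z) * (q (π.sp z i) * (π.N z - ∑ x ∈ π.J z, q x)) else 0 := by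
      intro z'
      by_cases hz : z' = z
      · subst hz
        rw [if_pos rfl, Finset.sum_congr rfl fun x hx => by rw [h.frac_sp_J z' i hx, if_pos rfl],
          ← Finset.mul_sum, ← Finset.sum_mul, Finset.sum_sub_distrib]
        simp only [Finset.sum_const, nsmul_eq_mul, mul_one]
        change _ * ((π.N z' - _) * _) = _
        ring
      · rw [if_neg hz]
        exact Finset.sum_eq_zero fun x hx => by rw [h.frac_sp_J z i hx, if_neg hz]; simp
    simp [h.frac_sp_sp, this]
  have e2 : ∀ x ∈ π.J z, ∑ b, q x * ((1 - q b) * π.frac x b)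
      = alphaW (π.N z) * (q x * (3 - ∑ i, q (π.sp z i)))
        + betaW (π.N z) * (q x * (π.N z - ∑ y ∈ π.J z, q y) - q x * (1 - q (π.τ x))) := by
    intro x hx
    rw [h.sum_free _ fun v hv => by rw [frac_comm, frac_of_not_free hv]; simp]
    have a1 : ∀ z', ∑ i, q x * ((1 - q (π.sp z' i)) * π.frac x (π.sp z' i))
        = if z' = z then alphaW (π.N z) * (q x * (3 - ∑ i, q (π.sp z i))) else 0 := by
      intro z'
      by_cases hz : z' = z
      · subst hz
        rw [if_pos rfl, Finset.sum_congr rfl fun i _ => by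
          rw [frac_comm, h.frac_sp_J z' i hx, if_pos rfl],
          ← Finset.mul_sum, ← Finset.sum_mul, Finset.sum_sub_distrib]
        simp only [Finset.sum_const, nsmul_eq_mul, mul_one, Finset.card_univ, Fintype.card_fin]
        push_cast
        ring
      · rw [if_neg hz]
        exact Finset.sum_eq_zero fun i _ => by
          rw [frac_comm, h.frac_sp_J z' i hx, if_neg (Ne.symm hz)]; simp
    have a2 : ∀ z', ∑ y ∈ π.J z', q x * ((1 - q y) * π.frac x y)
        = if z' = z then
          betaW (π.N z) * (q x * (π.N z - ∑ y ∈ π.J z, q y) - q x * (1 - q (π.τ x))) else 0 := by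
      intro z'
      by_cases hz : z' = z
      · subst hz
        have : ∀ y ∈ π.J z', q x * ((1 - q y) * π.frac x y)
            = if y ≠ x ∧ y ≠ π.τ x then q x * betaW (π.N z') * (1 - q y) else 0 := by
          intro y hy
          rw [h.frac_J_J hx hy]
          split_ifs with b1 b2 b2
          · ring
          · exact absurd b1.2 b2
          · exact absurd ⟨rfl, b2⟩ b1
          · ring
        rw [if_pos rfl, Finset.sum_congr rfl this, h.sum_J_ne hx, ← Finset.mul_sum,
          Finset.sum_sub_distrib]
        simp only [Finset.sum_const, nsmul_eq_mul, mul_one]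
        change _ * (π.N z' - _) - _ - _ = _
        have : q x * (1 - q x) = 0 := by simp only [q]; split_ifs <;> simp
        linear_combination (-betaW (π.N z')) * this
      · rw [if_neg hz]
        exact Finset.sum_eq_zero fun y hy => by rw [h.frac_J_J hx hy]; simp [hz]
    simp only [a1, a2, Finset.sum_add_distrib, Finset.sum_ite_eq', Finset.mem_univ, if_true]
  rw [Finset.sum_congr rfl fun i _ => e1 i, Finset.sum_congr rfl e2]
  have n1 : ((π.numSp S z : ℕ) : ℝ) = ∑ i, q (π.sp z i) := by simp [numSp, q]
  have n2 : ((π.numJ S z : ℕ) : ℝ) = ∑ x ∈ π.J z, q x := by simp [numJ, q]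
  have n3 : ((π.numSplit S z : ℕ) : ℝ) = ∑ x ∈ π.J z, q x * (1 - q (π.τ x)) := by
    simp only [numSplit, q]
    push_cast
    refine Finset.sum_congr rfl fun x _ => ?_
    by_cases b1 : x ∈ S <;> by_cases b2 : π.τ x ∈ S <;> simp [b1, b2]
  rw [n1, n2, n3]
  simp only [← Finset.mul_sum, ← Finset.sum_mul, Finset.sum_add_distrib, Finset.sum_sub_distrib,
    zoneCut]
  ring

lemma numSplit_le (S : Finset V) (z : Bool) : π.numSplit S z ≤ π.numJ S z := by
  unfold numSplit numJ
  refine Finset.sum_le_sum fun x _ => ?_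
  split_ifs <;> simp_all

lemma sum_τ (φ : V → ℕ) (z : Bool) : ∑ x ∈ π.J z, φ (π.τ x) = ∑ x ∈ π.J z, φ x := by
  refine Finset.sum_bij' (fun x _ => π.τ x) (fun x _ => π.τ x) ?_ ?_ ?_ ?_ ?_
  · exact fun x hx => h.τ_mem hx
  · exact fun x hx => h.τ_mem hx
  · exact fun x hx => h.τ_τ hx
  · exact fun x hx => h.τ_τ hx
  · exact fun x hx => rfl

lemma numSplit_add_le (S : Finset V) (z : Bool) :
    π.numSplit S z + π.numJ S z ≤ (π.J z).card := by
  unfold numSplit numJ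
  rw [← h.sum_τ, ← Finset.sum_add_distrib, Finset.card_eq_sum_ones]
  refine Finset.sum_le_sum fun x hx => ?_
  by_cases b1 : x ∈ S <;> by_cases b2 : π.τ x ∈ S <;> simp [b1, b2, h.τ_τ hx]

lemma numSplit_le_mul (S : Finset V) (z : Bool) :
    (π.numSplit S z : ℝ) ≤ π.numJ S z * (π.N z - π.numJ S z) := by
  have h1 : (π.numSplit S z : ℝ) ≤ π.numJ S z := by exact_mod_cast h.numSplit_le S z
  have h2 : (π.numSplit S z : ℝ) + π.numJ S z ≤ π.N z := by
    unfold N; exact_mod_cast h.numSplit_add_le S z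
  have h3 := numJ_le (π := π) S z
  rcases Nat.eq_zero_or_pos (π.numJ S z) with h4 | h4
  · rw [h4] at h1 ⊢; simpa using h1
  · have h5 : (1 : ℝ) ≤ π.numJ S z := by exact_mod_cast h4
    have h6 : (0 : ℝ) ≤ π.numSplit S z := by positivity
    nlinarith

lemma zoneCut_nonneg (hN : ∀ z, 9 ≤ π.N z) (S : Finset V) (z : Bool) :
    0 ≤ zoneCut (π.N z) (π.numSp S z) (π.numJ S z) (π.numSplit S z) := by
  have h1 := h.numSplit_le_mul S z
  have h2 : (π.numJ S z : ℝ) ≤ π.N z := by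
    unfold N; exact_mod_cast numJ_le (π := π) S z
  have h3 : (π.numSp S z : ℝ) ≤ 3 := by
    have : π.numSp S z ≤ 3 := by
      unfold numSp
      simp only [Fin.sum_univ_three]
      split_ifs <;> simp
    exact_mod_cast this
  have hβ := betaW_nonneg (hN z)
  have hα0 : 0 ≤ alphaW (π.N z) := by
    have := hN z
    unfold alphaW; positivity
  unfold zoneCut
  have h4 : (0 : ℝ) ≤ π.numSp S z := by positivity
  have h5 : (0 : ℝ) ≤ π.numJ S z := by positivity
  have := mul_nonneg hα0 (add_nonneg (mul_nonneg h4 (sub_nonneg.2 h2))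
    (mul_nonneg (sub_nonneg.2 h3) h5))
  have := mul_nonneg hβ (sub_nonneg.2 h1)
  linarith

lemma zoneCut_ge_one (hN : ∀ z, 9 ≤ π.N z) (S : Finset V) (z : Bool)
    (h1 : ¬ π.ZoneOut S z) (h2 : ¬ π.ZoneOut Sᶜ z) :
    1 ≤ zoneCut (π.N z) (π.numSp S z) (π.numJ S z) (π.numSplit S z) := by
  have k1 := h.numSplit_le_mul S z
  have k2 : (π.numJ S z : ℝ) ≤ π.N z := by
    unfold N; exact_mod_cast numJ_le (π := π) S z
  have k3 : (π.numSplit S z : ℝ) ≤ π.numJ S z := by exact_mod_cast h.numSplit_le S z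
  have k4 : (π.numSplit S z : ℝ) + π.numJ S z ≤ π.N z := by
    unfold N; exact_mod_cast h.numSplit_add_le S z
  have hNz := hN z
  have sp0 : π.numSp S z = 0 → ∀ i, π.sp z i ∉ S := by
    intro h0 i hi
    rw [numSp, Finset.sum_eq_zero_iff] at h0
    simpa [hi] using h0 i (Finset.mem_univ i)
  have sp3 : π.numSp S z = 3 → ∀ i, π.sp z i ∈ S := by
    intro h0 i
    rw [numSp, Fin.sum_univ_three] at h0
    by_contra hi
    fin_cases i <;> simp at hi <;> simp only [hi, if_false] at h0 <;>
      (split_ifs at h0 <;> omega)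
  have J0 : π.numJ S z = 0 → ∀ x ∈ π.J z, x ∉ S := by
    intro h0 x hx hi
    rw [numJ, Finset.sum_eq_zero_iff] at h0
    simpa [hi] using h0 x hx
  have JN : π.numJ S z = (π.J z).card → ∀ x ∈ π.J z, x ∈ S := by
    intro h0 x hx
    rw [numJ, Finset.card_eq_sum_ones] at h0
    by_contra hi
    have := Finset.sum_lt_sum (s := π.J z) (f := fun x => if x ∈ S then 1 else 0)
      (g := fun _ => 1) (fun y _ => by split_ifs <;> simp) ⟨x, hx, by simp [hi]⟩
    omega
  have hle : π.numSp S z ≤ 3 := by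
    unfold numSp
    simp only [Fin.sum_univ_three]
    split_ifs <;> simp
  have hcard := numJ_le (π := π) S z
  obtain h0 | h0 | h0 | h0 : π.numSp S z = 0 ∨ π.numSp S z = 1 ∨ π.numSp S z = 2 ∨
      π.numSp S z = 3 := by omega
  · have hn : π.numJ S z ≠ 0 := fun hn => h1 ⟨sp0 h0, J0 hn⟩
    rw [h0, Nat.cast_zero]
    refine zoneCut_zero_ge_one hNz ?_ k2 k3 k1
    rcases Nat.lt_or_ge (π.numJ S z) 2 with h3 | h3
    · left
      have : π.numJ S z = 1 := by omega
      exact_mod_cast this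
    · right; exact_mod_cast h3
  · exact zoneCut_middle hNz (Or.inl (by rw [h0]; simp)) (by positivity) k2 k1
  · exact zoneCut_middle hNz (Or.inr (by rw [h0]; simp)) (by positivity) k2 k1
  · have hn : π.numJ S z ≠ (π.J z).card := fun hn => h2 ⟨fun i => by simpa using sp3 h0 i,
      fun x hx => by simpa using JN hn x hx⟩
    -- All three special ends are inside, so the complement falls under the case without special
    -- ends.
    rw [← zoneCut_compl, h0]
    have e : (3 : ℝ) - ((3 : ℕ) : ℝ) = 0 := by norm_num
    rw [e]
    have e2 : π.N z - π.numJ S z = (((π.J z).card - π.numJ S z : ℕ) : ℝ) := by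
      rw [Nat.cast_sub hcard]; rfl
    refine zoneCut_zero_ge_one hNz ?_ (by linarith [(Nat.cast_nonneg (π.numJ S z) : (0:ℝ) ≤ _)])
      (by linarith) (by linarith)
    rw [e2]
    rcases Nat.lt_or_ge ((π.J z).card - π.numJ S z) 2 with h3 | h3
    · left
      have : (π.J z).card - π.numJ S z = 1 := by omega
      exact_mod_cast this
    · right; exact_mod_cast h3

end Good

end Conf

end


/-! ### Cut constraints: configuration points lie in the path polytope. -/

noncomputable section

open scoped Classical

namespace Conf

variable {V L : Type*} {π : Conf V L}

/-- The number of chosen edges in a cut. -/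
def cutF [Fintype V] (π : Conf V L) (S : Finset V) : ℕ :=
  ∑ a ∈ S, ∑ b ∈ Sᶜ, if π.F.Adj a b then 1 else 0

/-- The weight of a cut. -/
def cutWt [Fintype V] (π : Conf V L) (S : Finset V) : ℝ := ∑ a ∈ S, ∑ b ∈ Sᶜ, π.wt a b

lemma cutWt_compl [Fintype V] (S : Finset V) : π.cutWt Sᶜ = π.cutWt S := by
  unfold cutWt
  rw [Finset.sum_comm, compl_compl]
  exact Finset.sum_congr rfl fun a _ => Finset.sum_congr rfl fun b _ => π.wt_comm b a

namespace Good

variable [Fintype V] {s t : V} (h : π.Good s t)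
include h

lemma cutWt_eq (S : Finset V) : π.cutWt S = π.cutF S
    + ∑ z, zoneCut (π.N z) (π.numSp S z) (π.numJ S z) (π.numSplit S z) := by
  rw [← h.sum_frac_cut, cutWt, cutF]
  push_cast
  simp only [wt, Finset.sum_add_distrib]

lemma cutF_pos {S : Finset V} {u v : V} (huv : π.c u = π.c v) (hu : u ∈ S) (hv : v ∉ S) :
    1 ≤ π.cutF S := by
  obtain ⟨a, b, ha, hb, hab, -⟩ := h.conn S u v huv hu hv
  have h1 : ∑ b ∈ Sᶜ, (if π.F.Adj a b then 1 else 0) ≤ π.cutF S :=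
    Finset.single_le_sum (f := fun a => ∑ b ∈ Sᶜ, if π.F.Adj a b then 1 else 0)
      (fun _ _ => Nat.zero_le _) ha
  have h2 : (if π.F.Adj a b then 1 else 0) ≤ ∑ b ∈ Sᶜ, (if π.F.Adj a b then 1 else 0) :=
    Finset.single_le_sum (f := fun b => if π.F.Adj a b then 1 else 0)
      (fun _ _ => Nat.zero_le _) (by simpa using hb)
  rw [if_pos hab] at h2
  omega

/-- Each of the two strands is crossed by a chosen edge, and the inner ends of these edges differ
because their labels do. -/
lemma cutF_ge_two {S : Finset V} {u v u' v' : V} (huv : π.c u = π.c v) (hu : u ∈ S) (hv : v ∉ S)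
    (huv' : π.c u' = π.c v') (hu' : u' ∈ S) (hv' : v' ∉ S) (hne : π.c u ≠ π.c u') :
    2 ≤ π.cutF S := by
  obtain ⟨a, b, ha, hb, hab, hc⟩ := h.conn S u v huv hu hv
  obtain ⟨a', b', ha', hb', hab', hc'⟩ := h.conn S u' v' huv' hu' hv'
  have hcc : π.c a = π.c u := hc
  have haa : a ≠ a' := fun h1 => hne (by rw [← hc, ← hc', h1])
  have key : ∀ {a b}, a ∈ S → b ∉ S → π.F.Adj a b →
      1 ≤ ∑ b ∈ Sᶜ, (if π.F.Adj a b then 1 else 0) := by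
    intro a b _ hb hab
    have h2 : (if π.F.Adj a b then 1 else 0) ≤ ∑ b ∈ Sᶜ, (if π.F.Adj a b then 1 else 0) :=
      Finset.single_le_sum (f := fun b => if π.F.Adj a b then 1 else 0)
        (fun _ _ => Nat.zero_le _) (by simpa using hb)
    rwa [if_pos hab] at h2
  have h1 : ∑ a ∈ ({a, a'} : Finset V), ∑ b ∈ Sᶜ, (if π.F.Adj a b then 1 else 0) ≤ π.cutF S := by
    apply Finset.sum_le_sum_of_subset
    intro x hx
    simp only [Finset.mem_insert, Finset.mem_singleton] at hx
    rcases hx with rfl | rfl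
    · exact ha
    · exact ha'
  rw [Finset.sum_pair haa] at h1
  have := key ha hb hab
  have := key ha' hb' hab'
  omega

/-- Summing the degree identity over `S` gives an even number, and edges inside `S` are counted
twice. -/
lemma cutF_parity (S : Finset V) :
    Even (π.cutF S + (if s ∈ S then 1 else 0) + (if t ∈ S then 1 else 0)
      + ∑ a ∈ S, if π.IsFree a then 1 else 0) := by
  have h1 := cut_parity (fun a b => if π.F.Adj a b then 1 else 0)
    (fun a b => by simp only [SimpleGraph.adj_comm]) (fun a => by simp) S
  have h2 : ∑ a ∈ S, ((∑ b, if π.F.Adj a b then 1 else 0) + (if a = s then 1 else 0)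
    + (if a = t then 1 else 0) + (if π.IsFree a then 1 else 0)) = ∑ a ∈ S, 2 :=
    Finset.sum_congr rfl fun a _ => h.deg a
  simp only [Finset.sum_add_distrib, Finset.sum_ite_eq', Finset.sum_const, smul_eq_mul] at h2
  change π.cutF S % 2 = _ at h1
  rw [Nat.even_iff]
  omega

/-- Cuts of a set without free ends of one zone. -/
lemma cut_of_zoneOut (hN : ∀ z, 9 ≤ π.N z) {S : Finset V} (hS : S.Nonempty) {W : Bool}
    (hW : π.ZoneOut S W) : 1 ≤ π.cutWt S ∧ ((s ∈ S ↔ t ∈ S) → 2 ≤ π.cutWt S) := by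
  have hz := h.zoneCut_nonneg hN S
  have hF : (π.cutF S : ℝ) ≤ π.cutWt S := by
    rw [h.cutWt_eq]
    have := Finset.sum_nonneg fun z (_ : z ∈ Finset.univ) => hz z
    linarith
  have hF2 : 2 ≤ π.cutF S → 2 ≤ π.cutWt S := fun h2 => by
    have : (2 : ℝ) ≤ π.cutF S := by exact_mod_cast h2
    linarith
  have hF1 : 1 ≤ π.cutF S → 1 ≤ π.cutWt S := fun h2 => by
    have : (1 : ℝ) ≤ π.cutF S := by exact_mod_cast h2
    linarith
  have hZW : ∀ z, z ≠ W → z = !W := by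
    intro z; cases z <;> cases W <;> simp
  have c1 : ∀ z, π.c (π.sp z 1) = π.c (π.sp W 1) := by
    intro z; cases z <;> cases W <;> simp [h.c_one]
  have c2 : ∀ z, π.c (π.sp z 2) = π.c (π.sp W 2) := by
    intro z; cases z <;> cases W <;> simp [h.c_two]
  have c12 : π.c (π.sp W 1) ≠ π.c (π.sp W 2) := by
    rw [← c1 true, ← c2 true]; exact h.c_one_two
  -- If `S` contains no free end at all, some strand leaves it on the way to a free end, and parity
  -- supplies a second crossing when `s` and `t` are on the same side.
  by_cases hZ : π.ZoneOut S (!W)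
  · have hout : ∀ z, π.ZoneOut S z := by
      intro z
      by_cases hz : z = W
      · rw [hz]; exact hW
      · rw [hZW z hz]; exact hZ
    obtain ⟨v, hv⟩ := hS
    obtain ⟨u, hu, huv⟩ := h.cover v
    have hfree : ∀ a ∈ S, ¬ π.IsFree a := by
      rintro a ha (⟨z, i, rfl⟩ | ⟨z, hz⟩)
      · exact (hout z).1 i ha
      · exact (hout z).2 a hz ha
    have hF0 := h.cutF_pos huv.symm hv fun hu' => hfree u hu' hu
    refine ⟨hF1 hF0, fun hst => hF2 ?_⟩
    have hp := h.cutF_parity S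
    have : ∑ a ∈ S, (if π.IsFree a then 1 else 0) = 0 :=
      Finset.sum_eq_zero fun a ha => by simp [hfree a ha]
    rw [this, Nat.even_iff] at hp
    by_cases hs : s ∈ S
    · simp only [hs, hst.1 hs, if_true] at hp; omega
    · have ht : t ∉ S := fun ht => hs (hst.2 ht)
      simp only [hs, ht, if_false] at hp; omega
  -- If `S` contains all free ends of the other zone, both strands that run between the zones are
  -- cut.
  by_cases hZ' : π.ZoneOut Sᶜ (!W)
  · have hin : ∀ i, π.sp (!W) i ∈ S := fun i => by simpa using hZ'.1 i
    have := h.cutF_ge_two (c1 (!W)) (hin 1) (hW.1 1) (c2 (!W)) (hin 2) (hW.1 2)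
      (by rw [c1, c2]; exact c12)
    exact ⟨hF1 (by omega), fun _ => hF2 this⟩
  · have h1 := h.zoneCut_ge_one hN S _ hZ hZ'
    have hle : π.cutF S + zoneCut (π.N (!W)) (π.numSp S (!W)) (π.numJ S (!W)) (π.numSplit S (!W))
        ≤ π.cutWt S := by
      rw [h.cutWt_eq]
      have := Finset.single_le_sum (f := fun z =>
        zoneCut (π.N z) (π.numSp S z) (π.numJ S z) (π.numSplit S z)) (fun z _ => hz z)
        (Finset.mem_univ (!W))
      linarith
    have hF0 : (0 : ℝ) ≤ π.cutF S := by positivity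
    refine ⟨by linarith, fun hst => ?_⟩
    rcases Nat.eq_zero_or_pos (π.cutF S) with h0 | h0
    swap
    · have : (1 : ℝ) ≤ π.cutF S := by exact_mod_cast h0
      linarith
    -- With no chosen edge in the cut, `S` is a union of strands. The strands of `s`, `t` and of all
    -- special ends then avoid `S`, so `S` contains whole segments of one zone only and
    -- `zoneCut_zero_ge_two` applies.
    have hcl : ∀ u v, π.c u = π.c v → u ∉ S → v ∉ S := by
      intro u v huv hu hv
      have := h.cutF_pos huv.symm hv hu
      omega
    have hterm : ∀ z, (if z then s else t) ∉ S ↔ π.sp z 0 ∉ S := by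
      have key : ∀ z, π.c (if z then s else t) = π.c (π.sp z 0) := by
        intro z; cases z
        · simpa using h.c_t
        · simpa using h.c_s
      exact fun z => ⟨hcl _ _ (key z), hcl _ _ (key z).symm⟩
    have hst' : s ∉ S ∧ t ∉ S := by
      have := (hterm W).2 (hW.1 0)
      cases W
      · have ht : t ∉ S := by simpa using this
        exact ⟨fun hs => ht (hst.1 hs), ht⟩
      · have hs : s ∉ S := by simpa using this
        exact ⟨hs, fun ht => hs (hst.2 ht)⟩
    have hsp : ∀ i, π.sp (!W) i ∉ S := by
      intro i
      fin_cases i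
      · refine (hterm (!W)).1 ?_
        cases W <;> simp [hst']
      · exact hcl _ _ (c1 (!W)).symm (hW.1 1)
      · exact hcl _ _ (c2 (!W)).symm (hW.1 2)
    have e1 : π.numSp S (!W) = 0 := Finset.sum_eq_zero fun i _ => by simp [hsp i]
    have e2 : π.numSplit S (!W) = 0 := by
      refine Finset.sum_eq_zero fun x hx => ?_
      rw [if_neg]
      rintro ⟨hx1, hx2⟩
      exact hcl _ _ (h.c_τ hx) hx2 hx1
    have e3 : 2 ≤ π.numJ S (!W) := by
      have : ∃ x ∈ π.J (!W), x ∈ S := by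
        by_contra hno
        push Not at hno
        exact hZ ⟨hsp, hno⟩
      obtain ⟨x, hx, hxS⟩ := this
      have hτS : π.τ x ∈ S := by
        by_contra h2
        exact hcl _ _ (h.c_τ hx) h2 hxS
      have h3 : ∑ x ∈ ({x, π.τ x} : Finset V), (if x ∈ S then 1 else 0) ≤ π.numJ S (!W) := by
        apply Finset.sum_le_sum_of_subset
        intro y hy
        simp only [Finset.mem_insert, Finset.mem_singleton] at hy
        rcases hy with rfl | rfl
        · exact hx
        · exact h.τ_mem hx
      rw [Finset.sum_pair (h.τ_ne hx).symm, if_pos hxS, if_pos hτS] at h3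
      exact h3
    have h4 : (π.numJ S (!W) : ℝ) ≤ π.N (!W) := by
      unfold N; exact_mod_cast numJ_le (π := π) S (!W)
    have := zoneCut_zero_ge_two (hN (!W)) (by exact_mod_cast e3) h4
    rw [e1, e2] at hle
    simp only [Nat.cast_zero] at hle
    linarith

/-- If each zone has free ends on both sides, each contributes at least one unit. Otherwise `S` or
its complement misses the free ends of a zone, and the cut is the same for both. -/
theorem cut_bound (hN : ∀ z, 9 ≤ π.N z) {S : Finset V} (hS : S ≠ ∅) (hS' : S ≠ Finset.univ) :
    1 ≤ π.cutWt S ∧ ((s ∈ S ↔ t ∈ S) → 2 ≤ π.cutWt S) := by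
  have hne : S.Nonempty := Finset.nonempty_iff_ne_empty.2 hS
  have hne' : Sᶜ.Nonempty := by
    rw [Finset.nonempty_iff_ne_empty]
    intro h0
    exact hS' (by rwa [Finset.compl_eq_empty_iff] at h0)
  by_cases h1 : ∃ W, π.ZoneOut S W
  · obtain ⟨W, hW⟩ := h1
    exact h.cut_of_zoneOut hN hne hW
  by_cases h2 : ∃ W, π.ZoneOut Sᶜ W
  · obtain ⟨W, hW⟩ := h2
    have := h.cut_of_zoneOut hN hne' hW
    rw [cutWt_compl] at this
    refine ⟨this.1, fun hst => this.2 ?_⟩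
    simp only [Finset.mem_compl, hst]
  push Not at h1 h2
  have h3 := fun z => h.zoneCut_ge_one hN S z (h1 z) (h2 z)
  have : 2 ≤ π.cutWt S := by
    rw [h.cutWt_eq, Fintype.sum_bool]
    have := h3 true
    have := h3 false
    have hF0 : (0 : ℝ) ≤ π.cutF S := by positivity
    linarith
  exact ⟨by linarith, fun _ => this⟩

lemma cutWeight_pt (S : Finset V) : cutWeight π.pt S = π.cutWt S := by
  rw [cutWeight_eq, cutWt]
  simp only [h.pairFn_pt]

omit h in
lemma card_inter_pair_ne_one {s t : V} (S : Finset V) (hst : s ≠ t) :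
    (S ∩ {s, t}).card ≠ 1 ↔ (s ∈ S ↔ t ∈ S) := by
  by_cases hs : s ∈ S <;> by_cases ht : t ∈ S
  · have : S ∩ {s, t} = {s, t} := by ext x; simp; rintro (rfl | rfl) <;> assumption
    simp [this, hs, ht, Finset.card_pair hst]
  · have : S ∩ {s, t} = {s} := by
      ext x; simp only [Finset.mem_inter, Finset.mem_insert, Finset.mem_singleton]
      constructor
      · rintro ⟨h1, rfl | rfl⟩ <;> [rfl; exact absurd h1 ht]
      · rintro rfl; exact ⟨hs, Or.inl rfl⟩
    simp [this, hs, ht]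
  · have : S ∩ {s, t} = {t} := by
      ext x; simp only [Finset.mem_inter, Finset.mem_insert, Finset.mem_singleton]
      constructor
      · rintro ⟨h1, rfl | rfl⟩ <;> [exact absurd h1 hs; rfl]
      · rintro rfl; exact ⟨ht, Or.inr rfl⟩
    simp [this, hs, ht]
  · have : S ∩ {s, t} = ∅ := by
      ext x; simp only [Finset.mem_inter, Finset.mem_insert, Finset.mem_singleton]
      simp; rintro h1; constructor <;> rintro rfl <;> contradiction
    simp [this, hs, ht]

theorem pt_mem (hst : s ≠ t) (hN : ∀ z, 9 ≤ π.N z) :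
    π.pt ∈ symPathPolytope (⊤ : SimpleGraph V) s t := by
  have hN2 : ∀ z, 2 < π.N z := fun z => by linarith [hN z]
  have hN3 : ∀ z, 3 ≤ π.N z := fun z => by linarith [hN z]
  have hdeg : ∀ v, cutWeight π.pt {v} = ∑ b, π.wt v b := fun v => by
    rw [cutWeight_singleton]; simp only [h.pairFn_pt]
  refine ⟨fun S h1 h2 h3 => ?_, fun S h1 h2 _ => ?_, fun v h1 h2 => ?_, ?_, ?_, fun e => ?_⟩
  · rw [h.cutWeight_pt]
    exact (h.cut_bound hN h1 h2).2 ((card_inter_pair_ne_one S hst).1 h3)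
  · rw [h.cutWeight_pt]
    exact (h.cut_bound hN h1 h2).1
  · rw [hdeg, h.sum_wt hN2]; simp [h1, h2]
  · rw [hdeg, h.sum_wt hN2]; simp [hst]; norm_num
  · rw [hdeg, h.sum_wt hN2]; simp [hst.symm]; norm_num
  · exact ⟨h.wt_nonneg hN3 _ _, h.wt_le_one hN3 _ _⟩

end Good

end Conf

end


/-! ### Counting ordered pairs of ends of different segments. -/

noncomputable section

open scoped Classical

section PairSums

variable {V : Type*} {K : Finset V} {τ : V → V} (hmem : ∀ x ∈ K, τ x ∈ K)
  (hne : ∀ x ∈ K, τ x ≠ x) (hττ : ∀ x ∈ K, τ (τ x) = x)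

include hmem hne in
lemma sum_ne_partner (φ : V → ℝ) {p : V} (hp : p ∈ K) :
    ∑ q ∈ K, (if q ≠ p ∧ q ≠ τ p then φ q else 0) = ∑ q ∈ K, φ q - φ p - φ (τ p) := by
  have key : ∀ y, (if y ≠ p ∧ y ≠ τ p then φ y else 0)
      = φ y - (if y = p then φ y else 0) - (if y = τ p then φ y else 0) := by
    intro y
    by_cases h1 : y = p
    · subst h1; simp [(hne y hp).symm]
    · by_cases h2 : y = τ p <;> simp [h1, h2, hne p hp]
  simp only [key, Finset.sum_sub_distrib, Finset.sum_ite_eq', hp, hmem p hp, if_true]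

include hmem hne in
lemma sum_pairs_const (c : ℝ) :
    ∑ p ∈ K, ∑ q ∈ K, (if q ≠ p ∧ q ≠ τ p then c else 0) = c * (K.card * (K.card - 2)) := by
  rw [Finset.sum_congr rfl fun p hp => sum_ne_partner hmem hne (fun _ => c) hp]
  simp only [Finset.sum_const, nsmul_eq_mul]
  ring

include hmem hne hττ in
-- For `K` ends, the choice `p = τ w` leaves `K - 2` choices of `q`, while each of the other `K - 2`
-- admissible `p` leaves `K - 3`.
lemma sum_pairs_avoid (c : ℝ) {w : V} (hw : w ∈ K) :
    ∑ p ∈ K, ∑ q ∈ K, (if q ≠ p ∧ q ≠ τ p then (if w = p ∨ w = q then 0 else c) else 0)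
      = c * (K.card - 2) ^ 2 := by
  have key : ∀ p ∈ K, ∑ q ∈ K, (if q ≠ p ∧ q ≠ τ p then (if w = p ∨ w = q then 0 else c) else 0)
      = c * (K.card - 3) - (if p = w then c * (K.card - 3) else 0) + (if p = τ w then c else 0) := by
    intro p hp
    rw [sum_ne_partner hmem hne _ hp]
    by_cases h1 : p = w
    · subst h1
      simp [(hne p hp).symm]
    · have h1' : ¬ w = p := fun h => h1 h.symm
      have e : ∑ q ∈ K, (if w = p ∨ w = q then 0 else c) = c * (K.card - 1) := by
        have : ∀ q, (if w = p ∨ w = q then 0 else c) = c - (if q = w then c else 0) := by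
          intro q
          by_cases h2 : q = w
          · simp [h2]
          · simp [h1', h2, Ne.symm h2]
        simp only [this, Finset.sum_sub_distrib, Finset.sum_ite_eq', hw, if_true,
          Finset.sum_const, nsmul_eq_mul]
        ring
      rw [e]
      by_cases h2 : p = τ w
      · subst h2
        simp [hττ w hw, h1, h1']
        ring
      · have h3 : ¬ w = τ p := fun h3 => h2 (by rw [h3, hττ p hp])
        simp only [h1, h1', h2, h3, or_self, if_false]
        ring
  rw [Finset.sum_congr rfl key]
  simp only [Finset.sum_add_distrib, Finset.sum_sub_distrib, Finset.sum_ite_eq', hw, hmem w hw,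
    if_true, Finset.sum_const, nsmul_eq_mul]
  ring

include hmem hne hττ in
-- The pair `u w` itself occurs in two orders. Every `p` other than `u` and `w` leaves `K - 4`
-- choices of `q`; if `p` is `τ u` or `τ w`, this relies on the exclusion of the pair of both mates.
lemma sum_pairs_edge (c : ℝ) {u w : V} (hu : u ∈ K) (hw : w ∈ K) (huw : w ≠ u) (huw' : w ≠ τ u) :
    ∑ p ∈ K, ∑ q ∈ K, (if q ≠ p ∧ q ≠ τ p then
      (if (p = u ∧ q = w) ∨ (p = w ∧ q = u) then 1
        else if p = u ∨ p = w ∨ q = u ∨ q = w then 0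
        else if (τ p = u ∧ τ q = w) ∨ (τ p = w ∧ τ q = u) then 0 else c) else 0)
      = 2 + c * ((K.card - 4) * (K.card - 2)) := by
  have hwu' : u ≠ τ w := fun h => huw' (by rw [h, hττ w hw])
  have hcard : ∀ S : Finset V, S ⊆ K → ∑ q ∈ K, (if q ∈ S then 0 else c) = c * (K.card - S.card) := by
    intro S hS
    have : ∀ q, (if q ∈ S then 0 else c) = c - (if q ∈ S then c else 0) := by
      intro q; split_ifs <;> simp
    simp only [this, Finset.sum_sub_distrib, Finset.sum_const, nsmul_eq_mul, ← Finset.sum_filter]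
    rw [Finset.filter_mem_eq_inter, Finset.inter_eq_right.2 hS]
    ring
  have key : ∀ p ∈ K, ∑ q ∈ K, (if q ≠ p ∧ q ≠ τ p then
      (if (p = u ∧ q = w) ∨ (p = w ∧ q = u) then 1
        else if p = u ∨ p = w ∨ q = u ∨ q = w then 0
        else if (τ p = u ∧ τ q = w) ∨ (τ p = w ∧ τ q = u) then 0 else c) else 0)
      = c * (K.card - 4) + (if p = u then 1 - c * (K.card - 4) else 0)
        + (if p = w then 1 - c * (K.card - 4) else 0) := by
    intro p hp
    rw [sum_ne_partner hmem hne _ hp]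
    by_cases h1 : p = u
    · subst h1
      have : ∀ q, (if (p = p ∧ q = w) ∨ (p = w ∧ q = p) then 1
        else if p = p ∨ p = w ∨ q = p ∨ q = w then 0
        else if (τ p = p ∧ τ q = w) ∨ (τ p = w ∧ τ q = p) then 0 else c)
          = if q = w then 1 else 0 := by
        intro q; simp [huw.symm]
      rw [Finset.sum_congr rfl fun q _ => this q, this p, this (τ p)]
      simp only [Finset.sum_ite_eq', hw, if_true, huw.symm, huw'.symm, if_false]
      ring
    by_cases h2 : p = w
    · subst h2
      have : ∀ q, (if (p = u ∧ q = p) ∨ (p = p ∧ q = u) then 1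
        else if p = u ∨ p = p ∨ q = u ∨ q = p then 0
        else if (τ p = u ∧ τ q = p) ∨ (τ p = p ∧ τ q = u) then 0 else c)
          = if q = u then 1 else 0 := by
        intro q; simp [h1]
      rw [Finset.sum_congr rfl fun q _ => this q, this p, this (τ p)]
      simp only [Finset.sum_ite_eq', hu, if_true, h1, hwu'.symm, if_false]
      ring
    by_cases h3 : p = τ u
    · have : ∀ q ∈ K, (if (p = u ∧ q = w) ∨ (p = w ∧ q = u) then 1
        else if p = u ∨ p = w ∨ q = u ∨ q = w then 0
        else if (τ p = u ∧ τ q = w) ∨ (τ p = w ∧ τ q = u) then 0 else c)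
          = if q ∈ ({u, w, τ w} : Finset V) then 0 else c := by
        intro q hq
        have e1 : τ p = u := by rw [h3, hττ u hu]
        have e2 : (τ q = w) = (q = τ w) := propext
          ⟨fun h => by rw [← h, hττ q hq], fun h => by rw [h, hττ w hw]⟩
        by_cases a1 : q = u <;> by_cases a2 : q = w <;> by_cases a3 : q = τ w <;>
          simp [a1, a2, a3, h1, h2, e1, e2, huw.symm]
        all_goals simp_all
      rw [Finset.sum_congr rfl this, this p hp, this (τ p) (hmem p hp), hcard]
      · have hpw : p ≠ τ w := fun h => huw (by
          rw [← hττ w hw, ← h, h3, hττ u hu])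
        rw [Finset.card_insert_of_notMem, Finset.card_pair (hne w hw).symm]
        · have e1 : τ p = u := by rw [h3, hττ u hu]
          simp [h1, h2, hpw, e1]; ring
        · simp [huw.symm, hwu']
      · intro y hy
        simp only [Finset.mem_insert, Finset.mem_singleton] at hy
        rcases hy with rfl | rfl | rfl
        exacts [hu, hw, hmem _ hw]
    by_cases h4 : p = τ w
    · have : ∀ q ∈ K, (if (p = u ∧ q = w) ∨ (p = w ∧ q = u) then 1
        else if p = u ∨ p = w ∨ q = u ∨ q = w then 0
        else if (τ p = u ∧ τ q = w) ∨ (τ p = w ∧ τ q = u) then 0 else c)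
          = if q ∈ ({u, w, τ u} : Finset V) then 0 else c := by
        intro q hq
        have e1 : τ p = w := by rw [h4, hττ w hw]
        have e2 : (τ q = u) = (q = τ u) := propext
          ⟨fun h => by rw [← h, hττ q hq], fun h => by rw [h, hττ u hu]⟩
        by_cases a1 : q = u <;> by_cases a2 : q = w <;> by_cases a3 : q = τ u <;>
          simp [a1, a2, a3, h1, h2, e1, e2, huw]
        all_goals simp_all
      rw [Finset.sum_congr rfl this, this p hp, this (τ p) (hmem p hp), hcard]
      · rw [Finset.card_insert_of_notMem, Finset.card_pair huw']
        · have e1 : τ p = w := by rw [h4, hττ w hw]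
          simp [h1, h2, h3, e1]; ring
        · simp [huw.symm, (hne u hu).symm]
      · intro y hy
        simp only [Finset.mem_insert, Finset.mem_singleton] at hy
        rcases hy with rfl | rfl | rfl
        exacts [hu, hw, hmem _ hu]
    · have : ∀ q ∈ K, (if (p = u ∧ q = w) ∨ (p = w ∧ q = u) then 1
        else if p = u ∨ p = w ∨ q = u ∨ q = w then 0
        else if (τ p = u ∧ τ q = w) ∨ (τ p = w ∧ τ q = u) then 0 else c)
          = if q ∈ ({u, w} : Finset V) then 0 else c := by
        intro q hq
        have e1 : τ p ≠ u := fun h => h3 (by rw [← h, hττ p hp])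
        have e2 : τ p ≠ w := fun h => h4 (by rw [← h, hττ p hp])
        simp [h1, h2, e1, e2]
      have e1 : τ p ≠ u := fun h => h3 (by rw [← h, hττ p hp])
      have e2 : τ p ≠ w := fun h => h4 (by rw [← h, hττ p hp])
      rw [Finset.sum_congr rfl this, this p hp, this (τ p) (hmem p hp), hcard]
      · rw [Finset.card_pair huw.symm]
        simp [h1, h2, e1, e2]; ring
      · intro y hy
        simp only [Finset.mem_insert, Finset.mem_singleton] at hy
        rcases hy with rfl | rfl
        exacts [hu, hw]
  rw [Finset.sum_congr rfl key]
  simp only [Finset.sum_add_distrib, Finset.sum_ite_eq', hu, hw,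
    if_true, Finset.sum_const, nsmul_eq_mul]
  ring

end PairSums

/-! ### The weights after one merge. -/

namespace Conf

variable {V L : Type*} {π : Conf V L}

namespace Good

variable [Fintype V] {s t : V} (h : π.Good s t)
include h

section MergeA

variable {z : Bool} (i : Fin 3) {x : V} (hx : x ∈ π.J z)
include hx

lemma mergeA_J_other {z' : Bool} (hz : z' ≠ z) : (π.mergeA z i x).J z' = π.J z' := by
  simp only [Conf.mergeA]
  rw [Finset.erase_eq_of_notMem, Finset.erase_eq_of_notMem]
  · exact fun hx' => hz (h.J_disj hx' hx)
  · exact fun hx' => hz (h.J_disj (Finset.mem_of_mem_erase hx') (h.τ_mem hx))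

lemma mergeA_N_other {z' : Bool} (hz : z' ≠ z) : (π.mergeA z i x).N z' = π.N z' := by
  unfold N; rw [h.mergeA_J_other i hx hz]

lemma mergeA_N : (π.mergeA z i x).N z = π.N z - 2 := by
  have h1 : x ∈ π.J z := hx
  have h2 : π.τ x ∈ (π.J z).erase x := Finset.mem_erase.2 ⟨h.τ_ne hx, h.τ_mem hx⟩
  simp only [N, Conf.mergeA]
  rw [Finset.card_erase_of_mem h2, Finset.card_erase_of_mem h1]
  have : 1 ≤ (π.J z).card - 1 := by
    rw [← Finset.card_erase_of_mem h1]
    exact Finset.card_pos.2 ⟨_, h2⟩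
  have e : (π.J z).card - 1 - 1 = (π.J z).card - 2 := by omega
  rw [e, Nat.cast_sub (by omega)]
  norm_num

lemma mem_mergeA_J {z' : Bool} {y : V} :
    y ∈ (π.mergeA z i x).J z' ↔ y ≠ π.τ x ∧ y ≠ x ∧ y ∈ π.J z' := by
  simp [Conf.mergeA]

lemma mergeA_sp {z' : Bool} {j : Fin 3} (hj : ¬ (z' = z ∧ j = i)) :
    (π.mergeA z i x).sp z' j = π.sp z' j := by
  simp only [Conf.mergeA, if_neg hj]

lemma mergeA_sp_self : (π.mergeA z i x).sp z i = π.τ x := by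
  simp [Conf.mergeA]

lemma mergeA_not_free : ¬ (π.mergeA z i x).IsFree x ∧ ¬ (π.mergeA z i x).IsFree (π.sp z i) := by
  constructor
  · rintro (⟨z', j, h1⟩ | ⟨z', h1⟩)
    · by_cases hj : z' = z ∧ j = i
      · rw [hj.1, hj.2, h.mergeA_sp_self i hx] at h1
        exact h.τ_ne hx h1.symm
      · rw [h.mergeA_sp i hx hj] at h1
        exact h.sp_ne hx h1
    · exact ((h.mem_mergeA_J i hx).1 h1).2.1 rfl
  · rintro (⟨z', j, h1⟩ | ⟨z', h1⟩)
    · by_cases hj : z' = z ∧ j = i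
      · rw [hj.1, hj.2, h.mergeA_sp_self i hx] at h1
        exact h.sp_ne (h.τ_mem hx) h1.symm
      · rw [h.mergeA_sp i hx hj] at h1
        have := h.sp_inj h1
        exact hj ⟨this.1.symm, this.2.symm⟩
    · exact h.sp_notMem _ _ _ ((h.mem_mergeA_J i hx).1 h1).2.2

lemma mergeA_wt {u w : V} (ha : ¬ π.F.Adj u w) (h1 : ¬ (u = π.sp z i ∧ w = x))
    (h2 : ¬ (u = x ∧ w = π.sp z i)) :
    (π.mergeA z i x).wt u w = (π.mergeA z i x).frac u w := by
  rw [wt, if_neg, zero_add]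
  simp only [Conf.mergeA, SimpleGraph.sup_adj, SimpleGraph.edge_adj]
  tauto

lemma mergeA_adj {u w : V} (ha : π.F.Adj u w) : (π.mergeA z i x).wt u w = 1 := by
  apply (h.mergeA hx).wt_of_adj
  simp only [Conf.mergeA, SimpleGraph.sup_adj]
  exact Or.inl ha

lemma mergeA_self : (π.mergeA z i x).wt (π.sp z i) x = 1 := by
  apply (h.mergeA hx).wt_of_adj
  simp only [Conf.mergeA, SimpleGraph.sup_adj, SimpleGraph.edge_adj]
  exact Or.inr ⟨Or.inl (by simp), (h.sp_ne hx).symm⟩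

lemma mergeA_zero {u w : V} (ha : ¬ π.F.Adj u w) (hA : ∀ z i x, ¬ π.IsA z i x u w)
    (hB : ∀ z, ¬ π.IsB z u w) : (π.mergeA z i x).wt u w = 0 := by
  rw [h.mergeA_wt i hx ha (fun h1 => hA z i x ⟨hx, Or.inl h1⟩)
    (fun h1 => hA z i x ⟨hx, Or.inr h1⟩)]
  have hsp : ∀ {z' j y}, y ∈ (π.mergeA z i x).J z' → ∀ {u w}, u = (π.mergeA z i x).sp z' j →
      w = y → (∃ z i x, π.IsA z i x u w) ∨ ∃ z, π.IsB z u w := by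
    intro z' j y hy u w hu hw
    obtain ⟨h1, h2, h3⟩ := (h.mem_mergeA_J i hx).1 hy
    subst hw
    by_cases hj : z' = z ∧ j = i
    · obtain ⟨rfl, rfl⟩ := hj
      rw [h.mergeA_sp_self j hx] at hu
      subst hu
      exact Or.inr ⟨z', h.τ_mem hx, h3, h1, by rw [h.τ_τ hx]; exact h2⟩
    · rw [h.mergeA_sp i hx hj] at hu
      exact Or.inl ⟨z', j, w, h3, Or.inl ⟨hu, rfl⟩⟩
  apply frac_eq_zero
  · rintro z' j y ⟨hy, ⟨h1, h2⟩ | ⟨h1, h2⟩⟩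
    · rcases hsp hy h1 h2 with ⟨z, i, x, h3⟩ | ⟨z, h3⟩
      · exact hA _ _ _ h3
      · exact hB _ h3
    · rcases hsp hy h2 h1 with ⟨z, i, x, h3, h4⟩ | ⟨z, h3⟩
      · exact hA z i x ⟨h3, h4.symm.imp And.symm And.symm⟩
      · exact hB _ (IsB.symm h h3)
  · rintro z' ⟨h1, h2, h3, h4⟩
    exact hB z' ⟨((h.mem_mergeA_J i hx).1 h1).2.2, ((h.mem_mergeA_J i hx).1 h2).2.2, h3, h4⟩

lemma mergeA_A_other {z' : Bool} (hz : z' ≠ z) (j : Fin 3) {y : V} (hy : y ∈ π.J z') :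
    (π.mergeA z i x).wt (π.sp z' j) y = alphaW (π.N z') := by
  have hj : ¬ (z' = z ∧ j = i) := fun hj => hz hj.1
  have hy' : y ∈ (π.mergeA z i x).J z' := by rwa [h.mergeA_J_other i hx hz]
  have := (h.mergeA hx (i := i)).wt_sp_J j hy'
  rwa [h.mergeA_sp i hx hj, h.mergeA_N_other i hx hz] at this

lemma mergeA_B_other {z' : Bool} (hz : z' ≠ z) {u w : V} (hB : π.IsB z' u w) :
    (π.mergeA z i x).wt u w = betaW (π.N z') := by
  have hB' : (π.mergeA z i x).IsB z' u w := by
    refine ⟨?_, ?_, hB.2.2⟩ <;> rw [h.mergeA_J_other i hx hz]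
    exacts [hB.1, hB.2.1]
  rw [(h.mergeA hx).wt_IsB hB', h.mergeA_N_other i hx hz]

/-- The old special end and `x` are used up, so of their other edges none keeps any weight. The
vertex `π.τ x` is now special itself, hence gets no edge to other special ends. -/
lemma mergeA_A (j : Fin 3) {y : V} (hy : y ∈ π.J z) :
    (π.mergeA z i x).wt (π.sp z j) y
      = if i = j then (if x = y then 1 else 0) else if y = x ∨ y = π.τ x then 0
        else alphaW (π.N z - 2) := by
  by_cases hij : i = j
  · subst hij
    rw [if_pos rfl]
    by_cases hxy : x = y
    · subst hxy; rw [if_pos rfl, h.mergeA_self i hx]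
    · rw [if_neg hxy, h.mergeA_wt i hx (h.not_adj_sp hy) (fun h1 => hxy h1.2.symm)
        (fun h1 => h.sp_ne hx h1.1.symm), frac_of_not_free (h.mergeA_not_free i hx).2]
  · have hj : ¬ (z = z ∧ j = i) := fun hj => hij hj.2.symm
    rw [if_neg hij]
    have hw : (π.mergeA z i x).wt (π.sp z j) y = (π.mergeA z i x).frac (π.sp z j) y :=
      h.mergeA_wt i hx (h.not_adj_sp hy) (fun h1 => hij (h.sp_inj h1.1).2.symm)
        (fun h1 => h.sp_ne hx h1.1.symm)
    by_cases hyx : y = x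
    · rw [if_pos (Or.inl hyx), hw, hyx, frac_comm, frac_of_not_free (h.mergeA_not_free i hx).1]
    by_cases hyτ : y = π.τ x
    · rw [if_pos (Or.inr hyτ), hw, hyτ, ← h.mergeA_sp i hx hj, ← h.mergeA_sp_self i hx]
      exact (h.mergeA hx).frac_sp_sp _ _ _ _
    · rw [if_neg (by tauto)]
      have := (h.mergeA hx (i := i)).wt_sp_J j ((h.mem_mergeA_J i hx).2 ⟨hyτ, hyx, hy⟩)
      rwa [h.mergeA_sp i hx hj, h.mergeA_N i hx] at this

/-- Edges at `π.τ x` change from segment–segment to special–segment edges and so carry `alphaW`;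
those away from the segment of `x` only see `N` drop by 2. -/
lemma mergeA_B {u w : V} (hB : π.IsB z u w) :
    (π.mergeA z i x).wt u w
      = if x = u ∨ x = w then 0 else if π.τ x = u ∨ π.τ x = w then alphaW (π.N z - 2)
        else betaW (π.N z - 2) := by
  have hw : (π.mergeA z i x).wt u w = (π.mergeA z i x).frac u w :=
    h.mergeA_wt i hx (h.not_adj_B hB) (fun h1 => h.sp_ne hB.1 h1.1)
      (fun h1 => h.sp_ne hB.2.1 h1.2)
  by_cases h1 : x = u
  · subst h1
    rw [if_pos (Or.inl rfl), hw, frac_of_not_free (h.mergeA_not_free i hx).1]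
  by_cases h2 : x = w
  · subst h2
    rw [if_pos (Or.inr rfl), hw, frac_comm, frac_of_not_free (h.mergeA_not_free i hx).1]
  rw [if_neg (by tauto)]
  have hsp : ∀ {y}, y ∈ π.J z → y ≠ π.τ x → y ≠ x →
      (π.mergeA z i x).wt (π.τ x) y = alphaW (π.N z - 2) := by
    intro y hy hyτ hyx
    have := (h.mergeA hx (i := i)).wt_sp_J i ((h.mem_mergeA_J i hx).2 ⟨hyτ, hyx, hy⟩)
    rwa [h.mergeA_sp_self i hx, h.mergeA_N i hx] at this
  by_cases h3 : π.τ x = u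
  · rw [if_pos (Or.inl h3), ← h3]
    exact hsp hB.2.1 (fun h4 => hB.2.2.1 (h4.trans h3)) (Ne.symm h2)
  by_cases h4 : π.τ x = w
  · rw [if_pos (Or.inr h4), ← h4, wt_comm]
    exact hsp hB.1 (Ne.symm h3) (Ne.symm h1)
  rw [if_neg (by tauto), ← h.mergeA_N i hx]
  refine (h.mergeA hx).wt_IsB ⟨(h.mem_mergeA_J i hx).2 ⟨Ne.symm h3, Ne.symm h1, hB.1⟩,
    (h.mem_mergeA_J i hx).2 ⟨Ne.symm h4, Ne.symm h2, hB.2.1⟩, hB.2.2⟩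

end MergeA

section MergeB

variable {z : Bool} {x y : V} (hxy : π.IsB z x y)
include hxy

lemma mergeB' : (π.mergeB x y).Good s t := h.mergeB hxy.1 hxy.2.1 hxy.2.2.1 hxy.2.2.2

lemma mergeB_J_other {z' : Bool} (hz : z' ≠ z) : (π.mergeB x y).J z' = π.J z' := by
  simp only [Conf.mergeB]
  rw [Finset.erase_eq_of_notMem, Finset.erase_eq_of_notMem]
  · exact fun hx' => hz (h.J_disj hx' hxy.1)
  · exact fun hx' => hz (h.J_disj (Finset.mem_of_mem_erase hx') hxy.2.1)

lemma mergeB_N_other {z' : Bool} (hz : z' ≠ z) : (π.mergeB x y).N z' = π.N z' := by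
  unfold N; rw [h.mergeB_J_other hxy hz]

lemma mergeB_N : (π.mergeB x y).N z = π.N z - 2 := by
  have h2 : y ∈ (π.J z).erase x := Finset.mem_erase.2 ⟨hxy.2.2.1, hxy.2.1⟩
  simp only [N, Conf.mergeB]
  rw [Finset.card_erase_of_mem h2, Finset.card_erase_of_mem hxy.1]
  have : 1 ≤ (π.J z).card - 1 := by
    rw [← Finset.card_erase_of_mem hxy.1]
    exact Finset.card_pos.2 ⟨_, h2⟩
  have e : (π.J z).card - 1 - 1 = (π.J z).card - 2 := by omega
  rw [e, Nat.cast_sub (by omega)]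
  norm_num

omit [Fintype V] h hxy in
lemma mem_mergeB_J {z' : Bool} {w : V} :
    w ∈ (π.mergeB x y).J z' ↔ w ≠ y ∧ w ≠ x ∧ w ∈ π.J z' := by
  simp [Conf.mergeB]

omit [Fintype V] h hxy in
lemma mergeB_τ (w : V) : (π.mergeB x y).τ w
    = if w = π.τ x then π.τ y else if w = π.τ y then π.τ x else π.τ w := rfl

lemma mergeB_not_free : ¬ (π.mergeB x y).IsFree x ∧ ¬ (π.mergeB x y).IsFree y := by
  constructor
  · rintro (⟨z', j, h1⟩ | ⟨z', h1⟩)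
    · exact h.sp_ne hxy.1 h1
    · exact (mem_mergeB_J.1 h1).2.1 rfl
  · rintro (⟨z', j, h1⟩ | ⟨z', h1⟩)
    · exact h.sp_ne hxy.2.1 h1
    · exact (mem_mergeB_J.1 h1).1 rfl

omit [Fintype V] h hxy in
lemma mergeB_wt {u w : V} (ha : ¬ π.F.Adj u w) (h1 : ¬ (u = x ∧ w = y))
    (h2 : ¬ (u = y ∧ w = x)) :
    (π.mergeB x y).wt u w = (π.mergeB x y).frac u w := by
  rw [wt, if_neg, zero_add]
  simp only [Conf.mergeB, SimpleGraph.sup_adj, SimpleGraph.edge_adj]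
  tauto

lemma mergeB_adj {u w : V} (ha : π.F.Adj u w) : (π.mergeB x y).wt u w = 1 := by
  apply (h.mergeB' hxy).wt_of_adj
  simp only [Conf.mergeB, SimpleGraph.sup_adj]
  exact Or.inl ha

lemma mergeB_F : (π.mergeB x y).F.Adj x y := by
  simp only [Conf.mergeB, SimpleGraph.sup_adj, SimpleGraph.edge_adj]
  exact Or.inr ⟨Or.inl (by simp), hxy.2.2.1.symm⟩

lemma mergeB_self : (π.mergeB x y).wt x y = 1 :=
  (h.mergeB' hxy).wt_of_adj (h.mergeB_F hxy)

lemma mergeB_IsB {z' : Bool} {u w : V} : (π.mergeB x y).IsB z' u w ↔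
    π.IsB z' u w ∧ u ≠ x ∧ u ≠ y ∧ w ≠ x ∧ w ≠ y ∧
      ¬ ((π.τ x = u ∧ π.τ y = w) ∨ (π.τ x = w ∧ π.τ y = u)) := by
  have hττ : π.τ x ≠ π.τ y := fun h1 => hxy.2.2.1 (h.τ_inj hxy.1 hxy.2.1 h1).symm
  unfold IsB
  rw [mem_mergeB_J, mem_mergeB_J, mergeB_τ]
  constructor
  · rintro ⟨⟨h1, h2, h3⟩, ⟨h4, h5, h6⟩, h7, h8⟩
    refine ⟨⟨h3, h6, h7, ?_⟩, h2, h1, h5, h4, ?_⟩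
    · rintro rfl
      split_ifs at h8 with h9 h10
      · rw [h9, h.τ_τ hxy.1] at h5; exact h5 rfl
      · rw [h10, h.τ_τ hxy.2.1] at h4; exact h4 rfl
      · exact h8 rfl
    · rintro (⟨rfl, rfl⟩ | ⟨rfl, rfl⟩)
      · simp at h8
      · simp [hττ.symm] at h8
  · rintro ⟨⟨h1, h2, h3, h4⟩, h5, h6, h7, h8, h9⟩
    refine ⟨⟨h6, h5, h1⟩, ⟨h8, h7, h2⟩, h3, ?_⟩
    split_ifs with h10 h11
    · rintro rfl; exact h9 (Or.inl ⟨h10.symm, rfl⟩)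
    · rintro rfl; exact h9 (Or.inr ⟨rfl, h11.symm⟩)
    · exact h4

lemma mergeB_zero {u w : V} (ha : ¬ π.F.Adj u w) (hA : ∀ z i x, ¬ π.IsA z i x u w)
    (hB : ∀ z, ¬ π.IsB z u w) : ¬ (π.mergeB x y).F.Adj u w ∧
      (∀ z' j v, ¬ (π.mergeB x y).IsA z' j v u w) ∧ ∀ z', ¬ (π.mergeB x y).IsB z' u w := by
  refine ⟨?_, ?_, fun z' h1 => hB z' ((h.mergeB_IsB hxy).1 h1).1⟩
  · simp only [Conf.mergeB, SimpleGraph.sup_adj, SimpleGraph.edge_adj]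
    rintro (h1 | ⟨⟨rfl, rfl⟩ | ⟨rfl, rfl⟩, -⟩)
    · exact ha h1
    · exact hB z hxy
    · exact hB z (IsB.symm h hxy)
  · rintro z' j v ⟨h1, h2⟩
    exact hA z' j v ⟨(mem_mergeB_J.1 h1).2.2, h2⟩

lemma mergeB_A_other {z' : Bool} (hz : z' ≠ z) (j : Fin 3) {v : V} (hv : v ∈ π.J z') :
    (π.mergeB x y).wt (π.sp z' j) v = alphaW (π.N z') := by
  have hv' : v ∈ (π.mergeB x y).J z' := by rwa [h.mergeB_J_other hxy hz]
  have := (h.mergeB' hxy).wt_sp_J j hv'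
  rwa [h.mergeB_N_other hxy hz] at this

lemma mergeB_A (j : Fin 3) {v : V} (hv : v ∈ π.J z) :
    (π.mergeB x y).wt (π.sp z j) v = if v = x ∨ v = y then 0 else alphaW (π.N z - 2) := by
  have hw : (π.mergeB x y).wt (π.sp z j) v = (π.mergeB x y).frac (π.sp z j) v :=
    mergeB_wt (h.not_adj_sp hv) (fun h1 => h.sp_ne hxy.1 h1.1.symm)
      (fun h1 => h.sp_ne hxy.2.1 h1.1.symm)
  by_cases h1 : v = x
  · rw [if_pos (Or.inl h1), hw, h1, frac_comm, frac_of_not_free (h.mergeB_not_free hxy).1]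
  by_cases h2 : v = y
  · rw [if_pos (Or.inr h2), hw, h2, frac_comm, frac_of_not_free (h.mergeB_not_free hxy).2]
  · rw [if_neg (by tauto)]
    have := (h.mergeB' hxy).wt_sp_J j (mem_mergeB_J.2 ⟨h2, h1, hv⟩)
    rwa [h.mergeB_N hxy] at this

lemma mergeB_B_other {z' : Bool} (hz : z' ≠ z) {u w : V} (hB : π.IsB z' u w) :
    (π.mergeB x y).IsB z' u w := by
  have hx : ∀ {v v'}, v ∈ π.J z → v' ∈ π.J z' → v ≠ v' := fun hv hv' h1 =>
    hz (h.J_disj hv' (h1 ▸ hv))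
  refine (h.mergeB_IsB hxy).2 ⟨hB, (hx hxy.1 hB.1).symm, (hx hxy.2.1 hB.1).symm,
    (hx hxy.1 hB.2.1).symm, (hx hxy.2.1 hB.2.1).symm, ?_⟩
  rintro (⟨h1, -⟩ | ⟨h1, -⟩)
  · exact hx (h.τ_mem hxy.1) hB.1 h1
  · exact hx (h.τ_mem hxy.1) hB.2.1 h1

lemma mergeB_wt_B_other {z' : Bool} (hz : z' ≠ z) {u w : V} (hB : π.IsB z' u w) :
    (π.mergeB x y).wt u w = betaW (π.N z') := by
  rw [(h.mergeB' hxy).wt_IsB (h.mergeB_B_other hxy hz hB), h.mergeB_N_other hxy hz]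

/-- The edge between `π.τ x` and `π.τ y` would close a cycle: they are mates now and carry no
weight. -/
lemma mergeB_B {u w : V} (hB : π.IsB z u w) :
    (π.mergeB x y).wt u w
      = if (x = u ∧ y = w) ∨ (x = w ∧ y = u) then 1
        else if x = u ∨ x = w ∨ y = u ∨ y = w then 0
        else if (π.τ x = u ∧ π.τ y = w) ∨ (π.τ x = w ∧ π.τ y = u) then 0
        else betaW (π.N z - 2) := by
  by_cases h1 : (x = u ∧ y = w) ∨ (x = w ∧ y = u)
  · rw [if_pos h1]
    rcases h1 with ⟨rfl, rfl⟩ | ⟨rfl, rfl⟩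
    · exact h.mergeB_self hxy
    · rw [wt_comm]; exact h.mergeB_self hxy
  rw [if_neg h1]
  have hw : (π.mergeB x y).wt u w = (π.mergeB x y).frac u w :=
    mergeB_wt (h.not_adj_B hB) (fun h2 => h1 (Or.inl ⟨h2.1.symm, h2.2.symm⟩))
      (fun h2 => h1 (Or.inr ⟨h2.2.symm, h2.1.symm⟩))
  by_cases h2 : x = u ∨ x = w ∨ y = u ∨ y = w
  · rw [if_pos h2, hw]
    rcases h2 with rfl | rfl | rfl | rfl
    · exact frac_of_not_free (h.mergeB_not_free hxy).1 _
    · rw [frac_comm]; exact frac_of_not_free (h.mergeB_not_free hxy).1 _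
    · exact frac_of_not_free (h.mergeB_not_free hxy).2 _
    · rw [frac_comm]; exact frac_of_not_free (h.mergeB_not_free hxy).2 _
  rw [if_neg h2]
  push Not at h2
  by_cases h3 : (π.τ x = u ∧ π.τ y = w) ∨ (π.τ x = w ∧ π.τ y = u)
  · rw [if_pos h3, hw]
    apply frac_eq_zero
    · rintro z' j v ⟨-, ⟨h4, -⟩ | ⟨-, h4⟩⟩
      · exact h.sp_ne hB.1 h4
      · exact h.sp_ne hB.2.1 h4
    · exact fun z' h4 => ((h.mergeB_IsB hxy).1 h4).2.2.2.2.2 h3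
  · rw [if_neg h3, ← h.mergeB_N hxy]
    exact (h.mergeB' hxy).wt_IsB ((h.mergeB_IsB hxy).2
      ⟨hB, h2.1.symm, h2.2.2.1.symm, h2.2.1.symm, h2.2.2.2.symm, h3⟩)

end MergeB

end Good

end Conf

end


/-! ### Conditioning on an edge between two segments. -/

noncomputable section

open scoped Classical

namespace Conf

variable {V L : Type*} (π : Conf V L)

/-- The segment ends of a zone that stay away from the segments of `x` and `y`. -/
def awayJ (z : Bool) (x y : V) : Finset V :=
  (π.J z).filter fun v => v ≠ x ∧ v ≠ y ∧ v ≠ π.τ x ∧ v ≠ π.τ y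

/-- The weight conditioned on an edge `xy` between two segments: a mixture of the weight after
joining the two segments and of the weights after joining two further segments. -/
def condB (z : Bool) (x y u w : V) : ℝ :=
  -- There are `(N - 4) * (N - 6)` ordered pairs `p q`, so the second merge has total mass `(N - 4)
  -- / (2 * (N - 3))`. The proportion is dictated by symmetry: an edge from a special end to `π.τ x`
  -- must get weight `1 / (N - 3)`, because `betaW N / (N - 3) = alphaW N * alphaW (N - 2)`. One
  -- merge alone gives `1 / (N - 2)`, a merge elsewhere in addition gives `1 / (N - 4)`.
  (π.N z - 2) / (2 * (π.N z - 3)) * (π.mergeB x y).wt u w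
    + 1 / (2 * (π.N z - 3) * (π.N z - 6)) *
      ∑ p ∈ π.awayJ z x y, ∑ q ∈ π.awayJ z x y,
        if q ≠ p ∧ q ≠ π.τ p then ((π.mergeB x y).mergeB p q).wt u w else 0

variable {π}

namespace Good

variable [Fintype V] {s t : V} (h : π.Good s t) {z : Bool} {x y : V} (hxy : π.IsB z x y)
  (hN : 6 < π.N z)
include h hxy

omit [Fintype V] h hxy in
lemma mem_awayJ {v : V} : v ∈ π.awayJ z x y ↔
    v ∈ π.J z ∧ v ≠ x ∧ v ≠ y ∧ v ≠ π.τ x ∧ v ≠ π.τ y := by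
  simp [awayJ]

omit [Fintype V] h hxy in
lemma mem_awayJ_iff {v : V} (hv : v ∈ π.J z) (h1 : v ≠ x) (h2 : v ≠ y) :
    v ∈ π.awayJ z x y ↔ ¬ (π.τ x = v ∨ π.τ y = v) := by
  rw [mem_awayJ, not_or]
  exact ⟨fun h3 => ⟨h3.2.2.2.1.symm, h3.2.2.2.2.symm⟩,
    fun h3 => ⟨hv, h1, h2, Ne.symm h3.1, Ne.symm h3.2⟩⟩

lemma card_awayJ : ((π.awayJ z x y).card : ℝ) = π.N z - 4 := by
  obtain ⟨hx, hy, hne, hne'⟩ := hxy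
  have h1 : π.awayJ z x y = π.J z \ {x, y, π.τ x, π.τ y} := by
    ext v; simp [awayJ]
  have h2 : ({x, y, π.τ x, π.τ y} : Finset V).card = 4 := by
    have a1 : x ≠ π.τ y := fun h1 => hne' (by rw [h1, h.τ_τ hy])
    have a2 : π.τ x ≠ π.τ y := fun h1 => hne (h.τ_inj hx hy h1).symm
    rw [Finset.card_insert_of_notMem, Finset.card_insert_of_notMem, Finset.card_pair a2]
    · simp [hne', (h.τ_ne hy).symm]
    · simp [hne.symm, (h.τ_ne hx).symm, a1]
  have h3 : ({x, y, π.τ x, π.τ y} : Finset V) ⊆ π.J z := by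
    intro v hv
    simp only [Finset.mem_insert, Finset.mem_singleton] at hv
    rcases hv with rfl | rfl | rfl | rfl
    exacts [hx, hy, h.τ_mem hx, h.τ_mem hy]
  have h4 := Finset.card_le_card h3
  rw [h1, Finset.card_sdiff_of_subset h3, Nat.cast_sub h4, h2]
  rfl

lemma τ_mem_awayJ {v : V} (hv : v ∈ π.awayJ z x y) : π.τ v ∈ π.awayJ z x y := by
  obtain ⟨h1, h2, h3, h4, h5⟩ := mem_awayJ.1 hv
  have hi : ∀ {a b}, a ∈ π.J z → π.τ a = b → a = π.τ b := fun ha hb => by rw [← hb, h.τ_τ ha]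
  exact mem_awayJ.2 ⟨h.τ_mem h1, fun h6 => h4 (hi h1 h6), fun h6 => h5 (hi h1 h6),
    fun h6 => h2 (h.τ_inj h1 hxy.1 h6), fun h6 => h3 (h.τ_inj h1 hxy.2.1 h6)⟩

omit [Fintype V] h hxy in
lemma mergeB_τ_away {v : V} (hv : v ∈ π.awayJ z x y) : (π.mergeB x y).τ v = π.τ v := by
  obtain ⟨h1, h2, h3, h4, h5⟩ := mem_awayJ.1 hv
  rw [mergeB_τ, if_neg h4, if_neg h5]

omit [Fintype V] h hxy in
lemma IsB_away {p q : V} (hp : p ∈ π.awayJ z x y) (hq : q ∈ π.awayJ z x y) (h1 : q ≠ p)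
    (h2 : q ≠ π.τ p) : (π.mergeB x y).IsB z p q := by
  obtain ⟨p1, p2, p3, -⟩ := mem_awayJ.1 hp
  obtain ⟨q1, q2, q3, -⟩ := mem_awayJ.1 hq
  refine ⟨mem_mergeB_J.2 ⟨p3, p2, p1⟩, mem_mergeB_J.2 ⟨q3, q2, q1⟩, h1, ?_⟩
  rwa [mergeB_τ_away hp]

omit [Fintype V] h hxy in
lemma condB_eq {u w : V} {c : ℝ} {ψ : V → V → ℝ} (h1 : (π.mergeB x y).wt u w = c)
    (h2 : ∀ p ∈ π.awayJ z x y, ∀ q ∈ π.awayJ z x y, (π.mergeB x y).IsB z p q →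
      ((π.mergeB x y).mergeB p q).wt u w = ψ p q) :
    π.condB z x y u w = (π.N z - 2) / (2 * (π.N z - 3)) * c
      + 1 / (2 * (π.N z - 3) * (π.N z - 6)) *
        ∑ p ∈ π.awayJ z x y, ∑ q ∈ π.awayJ z x y, if q ≠ p ∧ q ≠ π.τ p then ψ p q else 0 := by
  rw [condB, h1]
  congr 2
  refine Finset.sum_congr rfl fun p hp => Finset.sum_congr rfl fun q hq => ?_
  split_ifs with h3
  · exact h2 p hp q hq (IsB_away hp hq h3.1 h3.2)
  · rfl

lemma sum_away_const (c : ℝ) : ∑ p ∈ π.awayJ z x y, ∑ q ∈ π.awayJ z x y,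
    (if q ≠ p ∧ q ≠ π.τ p then c else 0) = c * ((π.N z - 4) * (π.N z - 6)) := by
  rw [sum_pairs_const (fun v => h.τ_mem_awayJ hxy) (fun v hv => h.τ_ne (mem_awayJ.1 hv).1),
    h.card_awayJ hxy]
  ring

include hN in
lemma condB_const {u w : V} {c c' d : ℝ} (h1 : (π.mergeB x y).wt u w = c)
    (h2 : ∀ p ∈ π.awayJ z x y, ∀ q ∈ π.awayJ z x y, (π.mergeB x y).IsB z p q →
      ((π.mergeB x y).mergeB p q).wt u w = c')
    (hd : d = ((π.N z - 2) * c + (π.N z - 4) * c') / (2 * (π.N z - 3))) :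
    π.condB z x y u w = d := by
  rw [condB_eq h1 h2, h.sum_away_const hxy, hd]
  have h3 : π.N z - 6 ≠ 0 := by linarith
  have h4 : π.N z - 3 ≠ 0 := by linarith
  field_simp

include hN in
lemma condB_same {u w : V} {c : ℝ} (h1 : (π.mergeB x y).wt u w = c)
    (h2 : ∀ p ∈ π.awayJ z x y, ∀ q ∈ π.awayJ z x y, (π.mergeB x y).IsB z p q →
      ((π.mergeB x y).mergeB p q).wt u w = c) :
    π.condB z x y u w = c := by
  apply h.condB_const hxy hN h1 h2
  have h4 : π.N z - 3 ≠ 0 := by linarith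
  field_simp
  ring

include hN in
lemma condB_adj {u w : V} (ha : π.F.Adj u w) : π.condB z x y u w = 1 := by
  have h' := h.mergeB' hxy
  refine h.condB_same hxy hN (h.mergeB_adj hxy ha) fun p _ q _ hpq => h'.mergeB_adj hpq ?_
  simp only [Conf.mergeB, SimpleGraph.sup_adj]
  exact Or.inl ha

include hN in
lemma condB_self : π.condB z x y x y = 1 :=
  h.condB_same hxy hN (h.mergeB_self hxy) fun _ _ _ _ hpq =>
    (h.mergeB' hxy).mergeB_adj hpq (h.mergeB_F hxy)

include hN in
lemma condB_zero' {u w : V} (ha : ¬ (π.mergeB x y).F.Adj u w)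
    (hA : ∀ z i v, ¬ (π.mergeB x y).IsA z i v u w) (hB : ∀ z, ¬ (π.mergeB x y).IsB z u w) :
    π.condB z x y u w = 0 := by
  have h' := h.mergeB' hxy
  refine h.condB_same hxy hN ?_ fun p _ q _ hpq => ?_
  · rw [wt, if_neg ha, frac_eq_zero hA hB, add_zero]
  · obtain ⟨h1, h2, h3⟩ := h'.mergeB_zero hpq ha hA hB
    rw [wt, if_neg h1, frac_eq_zero h2 h3, add_zero]

include hN in
lemma condB_zero {u w : V} (ha : ¬ π.F.Adj u w) (hA : ∀ z i v, ¬ π.IsA z i v u w)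
    (hB : ∀ z, ¬ π.IsB z u w) : π.condB z x y u w = 0 := by
  obtain ⟨h1, h2, h3⟩ := h.mergeB_zero hxy ha hA hB
  exact h.condB_zero' hxy hN h1 h2 h3

include hN in
lemma condB_A_other {z' : Bool} (hz : z' ≠ z) (j : Fin 3) {v : V} (hv : v ∈ π.J z') :
    π.condB z x y (π.sp z' j) v = alphaW (π.N z') := by
  have h' := h.mergeB' hxy
  refine h.condB_same hxy hN (h.mergeB_A_other hxy hz j hv) fun p _ q _ hpq => ?_
  have := h'.mergeB_A_other hpq hz j (v := v) (by rwa [h.mergeB_J_other hxy hz])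
  rwa [h.mergeB_N_other hxy hz] at this

include hN in
lemma condB_B_other {z' : Bool} (hz : z' ≠ z) {u w : V} (hB : π.IsB z' u w) :
    π.condB z x y u w = betaW (π.N z') := by
  have h' := h.mergeB' hxy
  refine h.condB_same hxy hN (h.mergeB_wt_B_other hxy hz hB) fun p _ q _ hpq => ?_
  have := h'.mergeB_wt_B_other hpq hz (h.mergeB_B_other hxy hz hB)
  rwa [h.mergeB_N_other hxy hz] at this

omit [Fintype V] hxy h in
lemma mergeB_not_adj {u w : V} (ha : ¬ π.F.Adj u w)
    (h1 : ¬ ((x = u ∧ y = w) ∨ (x = w ∧ y = u))) : ¬ (π.mergeB x y).F.Adj u w := by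
  simp only [Conf.mergeB, SimpleGraph.sup_adj, SimpleGraph.edge_adj]
  rintro (h2 | ⟨⟨rfl, rfl⟩ | ⟨rfl, rfl⟩, -⟩)
  · exact ha h2
  · exact h1 (Or.inl ⟨rfl, rfl⟩)
  · exact h1 (Or.inr ⟨rfl, rfl⟩)

include hN in
-- Multiplied by `betaW N`, the two nonzero values become `mom₁` and `mom₃`, the same numbers that
-- arise from conditioning on the special edge first. An end linked to `x` or `y` is never touched
-- by the second merge; any other end may be used up by it.
lemma condB_A (j : Fin 3) {v : V} (hv : v ∈ π.J z) :
    π.condB z x y (π.sp z j) v = if v = x ∨ v = y then 0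
      else if π.τ v = x ∨ π.τ v = y then 1 / (π.N z - 3)
      else (π.N z - 5) / ((π.N z - 3) * (π.N z - 4)) := by
  have h' := h.mergeB' hxy
  have e3 : π.N z - 3 ≠ 0 := by linarith
  have e2 : π.N z - 2 ≠ 0 := by linarith
  have e4 : π.N z - 4 ≠ 0 := by linarith
  have e6 : π.N z - 6 ≠ 0 := by linarith
  have e4' : π.N z - 2 - 2 ≠ 0 := by linarith
  have hW := h.mergeB_A hxy j hv
  have hW2 : v ≠ x → v ≠ y → ∀ p ∈ π.awayJ z x y, ∀ q ∈ π.awayJ z x y, (π.mergeB x y).IsB z p q →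
      ((π.mergeB x y).mergeB p q).wt (π.sp z j) v
        = if v = p ∨ v = q then 0 else alphaW (π.N z - 2 - 2) := by
    intro h1 h2 p _ q _ hpq
    have := h'.mergeB_A hpq j (mem_mergeB_J.2 ⟨h2, h1, hv⟩)
    rwa [h.mergeB_N hxy] at this
  by_cases h1 : v = x ∨ v = y
  · rw [if_pos h1]
    apply h.condB_zero' hxy hN
    · apply mergeB_not_adj (h.not_adj_sp hv)
      rintro (⟨h2, -⟩ | ⟨-, h2⟩)
      · exact h.sp_ne hxy.1 h2
      · exact h.sp_ne hxy.2.1 h2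
    · rintro z' i w ⟨hw, ⟨h2, h3⟩ | ⟨h2, h3⟩⟩
      · obtain ⟨h4, h5, -⟩ := mem_mergeB_J.1 hw
        rw [← h3] at h4 h5; tauto
      · exact h.sp_notMem _ _ _ (h2 ▸ (mem_mergeB_J.1 hw).2.2)
    · rintro z' ⟨h2, -⟩
      exact h.sp_notMem _ _ _ (mem_mergeB_J.1 h2).2.2
  rw [if_neg h1]
  rw [if_neg h1] at hW
  push Not at h1
  have hW2 := hW2 h1.1 h1.2
  by_cases h2 : π.τ v = x ∨ π.τ v = y
  · rw [if_pos h2]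
    have hva : v ∉ π.awayJ z x y := by
      intro hva
      have := mem_awayJ.1 hva
      rcases h2 with h2 | h2
      · exact this.2.2.2.1 (by rw [← h2, h.τ_τ hv])
      · exact this.2.2.2.2 (by rw [← h2, h.τ_τ hv])
    apply h.condB_const hxy hN hW (c' := alphaW (π.N z - 2 - 2))
    · intro p hp q hq hpq
      rw [hW2 p hp q hq hpq, if_neg]
      rintro (rfl | rfl)
      exacts [hva hp, hva hq]
    · unfold alphaW
      field_simp
      ring
  · rw [if_neg h2]
    push Not at h2
    have hva : v ∈ π.awayJ z x y := mem_awayJ.2 ⟨hv, h1.1, h1.2,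
      fun h3 => h2.1 (by rw [h3, h.τ_τ hxy.1]), fun h3 => h2.2 (by rw [h3, h.τ_τ hxy.2.1])⟩
    rw [condB_eq hW hW2, sum_pairs_avoid (fun v => h.τ_mem_awayJ hxy)
      (fun v hv => h.τ_ne (mem_awayJ.1 hv).1) (fun v hv => h.τ_τ (mem_awayJ.1 hv).1) _ hva,
      h.card_awayJ hxy]
    unfold alphaW
    field_simp
    ring

include hN in
-- The value depends on how many of `u`, `w` the second merge can use. If one of them is linked to
-- `x` or `y`, only the other can be used up and `sum_pairs_avoid` counts. If neither is linked, the
-- second merge may choose the edge itself and `sum_pairs_edge` counts.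
lemma condB_B {u w : V} (hB : π.IsB z u w) :
    π.condB z x y u w = if (x = u ∧ y = w) ∨ (x = w ∧ y = u) then 1
      else if x = u ∨ x = w ∨ y = u ∨ y = w then 0
      else if (π.τ x = u ∧ π.τ y = w) ∨ (π.τ x = w ∧ π.τ y = u) then 0
      else if π.τ x = u ∨ π.τ x = w ∨ π.τ y = u ∨ π.τ y = w
        then (π.N z - 6) / ((π.N z - 3) * (π.N z - 4))
      else ((π.N z - 6) ^ 2 + 3) / ((π.N z - 3) * (π.N z - 4) * (π.N z - 6)) := by
  have h' := h.mergeB' hxy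
  have e3 : π.N z - 3 ≠ 0 := by linarith
  have e2 : π.N z - 2 ≠ 0 := by linarith
  have e4 : π.N z - 4 ≠ 0 := by linarith
  have e6 : π.N z - 6 ≠ 0 := by linarith
  have e4' : π.N z - 2 - 2 ≠ 0 := by linarith
  have e6' : π.N z - 2 - 2 - 2 ≠ 0 := by intro h; apply e6; linarith
  have hW := h.mergeB_B hxy hB
  by_cases h1 : (x = u ∧ y = w) ∨ (x = w ∧ y = u)
  · rw [if_pos h1] at hW
    rw [if_pos h1]
    refine h.condB_same hxy hN hW fun p _ q _ hpq => ?_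
    apply h'.mergeB_adj hpq
    rcases h1 with ⟨rfl, rfl⟩ | ⟨rfl, rfl⟩
    · exact h.mergeB_F hxy
    · exact (h.mergeB_F hxy).symm
  rw [if_neg h1] at hW ⊢
  have hadj := mergeB_not_adj (h.not_adj_B hB) h1
  have hA : ∀ z i v, ¬ (π.mergeB x y).IsA z i v u w := by
    rintro z' i v ⟨-, ⟨h2, -⟩ | ⟨-, h2⟩⟩
    · exact h.sp_ne hB.1 h2
    · exact h.sp_ne hB.2.1 h2
  by_cases h2 : x = u ∨ x = w ∨ y = u ∨ y = w
  · rw [if_pos h2]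
    apply h.condB_zero' hxy hN hadj hA
    rintro z' h3
    obtain ⟨-, h4⟩ := (h.mergeB_IsB hxy).1 h3
    rcases h2 with h2 | h2 | h2 | h2
    exacts [h4.1 h2.symm, h4.2.2.1 h2.symm, h4.2.1 h2.symm, h4.2.2.2.1 h2.symm]
  rw [if_neg h2] at hW ⊢
  by_cases h3 : (π.τ x = u ∧ π.τ y = w) ∨ (π.τ x = w ∧ π.τ y = u)
  · rw [if_pos h3]
    apply h.condB_zero' hxy hN hadj hA
    exact fun z' h4 => ((h.mergeB_IsB hxy).1 h4).2.2.2.2.2 h3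
  rw [if_neg h3] at hW ⊢
  push Not at h2
  have hB1 : (π.mergeB x y).IsB z u w := (h.mergeB_IsB hxy).2
    ⟨hB, h2.1.symm, h2.2.2.1.symm, h2.2.1.symm, h2.2.2.2.symm, h3⟩
  have hW2 : ∀ p ∈ π.awayJ z x y, ∀ q ∈ π.awayJ z x y, (π.mergeB x y).IsB z p q →
      ((π.mergeB x y).mergeB p q).wt u w = if (p = u ∧ q = w) ∨ (p = w ∧ q = u) then 1
        else if p = u ∨ p = w ∨ q = u ∨ q = w then 0
        else if (π.τ p = u ∧ π.τ q = w) ∨ (π.τ p = w ∧ π.τ q = u) then 0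
        else betaW (π.N z - 2 - 2) := by
    intro p hp q hq hpq
    have := h'.mergeB_B hpq hB1
    rwa [h.mergeB_N hxy, mergeB_τ_away hp, mergeB_τ_away hq] at this
  have hu := mem_awayJ_iff hB.1 h2.1.symm h2.2.2.1.symm
  have hw := mem_awayJ_iff hB.2.1 h2.2.1.symm h2.2.2.2.symm
  have hK1 := fun v => h.τ_mem_awayJ hxy (v := v)
  have hK2 : ∀ v ∈ π.awayJ z x y, π.τ v ≠ v := fun v hv => h.τ_ne (mem_awayJ.1 hv).1
  have hK3 : ∀ v ∈ π.awayJ z x y, π.τ (π.τ v) = v := fun v hv => h.τ_τ (mem_awayJ.1 hv).1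
  by_cases h4 : π.τ x = u ∨ π.τ x = w ∨ π.τ y = u ∨ π.τ y = w
  · rw [if_pos h4]
    obtain ⟨v, hv, hW3⟩ : ∃ v ∈ π.awayJ z x y, ∀ p ∈ π.awayJ z x y, ∀ q ∈ π.awayJ z x y,
        (π.mergeB x y).IsB z p q → ((π.mergeB x y).mergeB p q).wt u w
          = if v = p ∨ v = q then 0 else betaW (π.N z - 2 - 2) := by
      have huw : u ∉ π.awayJ z x y ∧ w ∈ π.awayJ z x y ∨
          u ∈ π.awayJ z x y ∧ w ∉ π.awayJ z x y := by
        rw [hu, hw, not_not, not_not]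
        have hne : u ≠ w := hB.2.2.1.symm
        rcases h4 with h4 | h4 | h4 | h4
        · exact Or.inl ⟨Or.inl h4, fun h5 => h5.elim (fun h5 => hne (h4.symm.trans h5))
            fun h5 => h3 (Or.inl ⟨h4, h5⟩)⟩
        · exact Or.inr ⟨fun h5 => h5.elim (fun h5 => hne (h5.symm.trans h4))
            fun h5 => h3 (Or.inr ⟨h4, h5⟩), Or.inl h4⟩
        · exact Or.inl ⟨Or.inr h4, fun h5 => h5.elim (fun h5 => h3 (Or.inr ⟨h5, h4⟩))
            fun h5 => hne (h4.symm.trans h5)⟩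
        · exact Or.inr ⟨fun h5 => h5.elim (fun h5 => h3 (Or.inl ⟨h5, h4⟩))
            fun h5 => hne (h5.symm.trans h4), Or.inr h4⟩
      have key : ∀ {u p q}, u ∉ π.awayJ z x y → p ∈ π.awayJ z x y → q ∈ π.awayJ z x y →
          p ≠ u ∧ q ≠ u ∧ π.τ p ≠ u ∧ π.τ q ≠ u := by
        intro u p q hu hp hq
        exact ⟨fun h => hu (h ▸ hp), fun h => hu (h ▸ hq), fun h => hu (h ▸ hK1 _ hp),
          fun h => hu (h ▸ hK1 _ hq)⟩
      rcases huw with ⟨g1, g2⟩ | ⟨g1, g2⟩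
      · refine ⟨w, g2, fun p hp q hq hpq => ?_⟩
        obtain ⟨k1, k2, k3, k4⟩ := key g1 hp hq
        rw [hW2 p hp q hq hpq]
        simp only [k1, k2, k3, k4, false_and, and_false, or_self, if_false, false_or]
        congr 1
        exact propext (or_congr eq_comm eq_comm)
      · refine ⟨u, g1, fun p hp q hq hpq => ?_⟩
        obtain ⟨k1, k2, k3, k4⟩ := key g2 hp hq
        rw [hW2 p hp q hq hpq]
        simp only [k1, k2, k3, k4, false_and, and_false, or_self, if_false, false_or, or_false]
        congr 1
        exact propext (or_congr eq_comm eq_comm)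
    rw [condB_eq hW hW3, sum_pairs_avoid hK1 hK2 hK3 _ hv, h.card_awayJ hxy]
    unfold betaW
    field_simp
    ring
  · rw [if_neg h4]
    have hu' := hu.2 fun h5 => h4 (h5.elim Or.inl fun h5 => Or.inr (Or.inr (Or.inl h5)))
    have hw' := hw.2 fun h5 => h4 (h5.elim (fun h5 => Or.inr (Or.inl h5))
      fun h5 => Or.inr (Or.inr (Or.inr h5)))
    rw [condB_eq hW hW2, sum_pairs_edge hK1 hK2 hK3 _ hu' hw' hB.2.2.1 hB.2.2.2,
      h.card_awayJ hxy]
    unfold betaW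
    field_simp
    ring

include hN in
lemma condB_mem {S : Set (V → V → ℝ)} (hS : Convex ℝ S) (h1 : (π.mergeB x y).wt ∈ S)
    (h2 : ∀ p q, (π.mergeB x y).IsB z p q → ((π.mergeB x y).mergeB p q).wt ∈ S) :
    π.condB z x y ∈ S := by
  have e3 : 0 < π.N z - 3 := by linarith
  have e4 : 0 < π.N z - 4 := by linarith
  have e6 : 0 < π.N z - 6 := by linarith
  let T := (π.awayJ z x y ×ˢ π.awayJ z x y).filter fun p => p.2 ≠ p.1 ∧ p.2 ≠ π.τ p.1
  have hT : ∀ φ : V → V → ℝ, ∑ p ∈ T, φ p.1 p.2 = ∑ p ∈ π.awayJ z x y, ∑ q ∈ π.awayJ z x y,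
      if q ≠ p ∧ q ≠ π.τ p then φ p q else 0 := by
    intro φ
    rw [Finset.sum_filter, Finset.sum_product]
  have hm : ∑ p ∈ T, (1 / ((π.N z - 4) * (π.N z - 6))) • ((π.mergeB x y).mergeB p.1 p.2).wt ∈ S := by
    apply hS.sum_mem
    · intro p _; positivity
    · rw [hT fun _ _ => _, h.sum_away_const hxy]
      field_simp
    · intro p hp
      obtain ⟨hp1, hp2⟩ := Finset.mem_filter.1 hp
      obtain ⟨hp3, hp4⟩ := Finset.mem_product.1 hp1
      exact h2 _ _ (IsB_away hp3 hp4 hp2.1 hp2.2)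
  have := hS h1 hm (a := (π.N z - 2) / (2 * (π.N z - 3))) (b := (π.N z - 4) / (2 * (π.N z - 3)))
    (div_nonneg (by linarith) (by linarith)) (div_nonneg (by linarith) (by linarith))
    (by field_simp; ring)
  convert this using 1
  funext u w
  rw [condB, ← hT fun p q => ((π.mergeB x y).mergeB p q).wt u w]
  simp only [Pi.add_apply, Pi.smul_apply, Finset.sum_apply, smul_eq_mul, ← Finset.mul_sum]
  congr 1
  rw [← mul_assoc]
  congr 1
  field_simp

end Good

end Conf

end


/-! ### Conditioned points and symmetry of the second moments. -/

noncomputable section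

open scoped Classical

/-- Second moment of edges at different special ends, or of disjoint edges that are linked by a
segment at a special end. -/
def mom₁ (N : ℝ) : ℝ := 1 / (N * (N - 2))

/-- Second moment of unlinked edges at a special end and between segments. -/
def mom₃ (N : ℝ) : ℝ := (N - 5) / (N * (N - 2) * (N - 4))

/-- Second moment of edges between segments that have one segment in common. -/
def mom₄ (N : ℝ) : ℝ := (N - 6) / (N * (N - 2) * (N - 4))

/-- Second moment of unlinked edges between segments. -/
def mom₅ (N : ℝ) : ℝ := ((N - 6) ^ 2 + 3) / (N * (N - 2) * (N - 4) * (N - 6))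

namespace Conf

variable {V L : Type*} (π : Conf V L)

/-- The weight conditioned on an edge. -/
def cond (u w : V) : V → V → ℝ :=
  if h : ∃ p : Bool × Fin 3 × V, π.IsA p.1 p.2.1 p.2.2 u w then
    (π.mergeA h.choose.1 h.choose.2.1 h.choose.2.2).wt
  -- The default value serves two kinds of pairs: conditioning on an edge of weight one changes
  -- nothing, and for weight zero the value is multiplied by zero in `mom` but still has to lie in
  -- the relaxation.
  else if h : ∃ z, π.IsB z u w then π.condB h.choose u w else π.wt

/-- The second moment of two edges. -/
def mom (u w a b : V) : ℝ := π.wt u w * π.cond u w a b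

variable {π}

lemma cond_other {u w : V} (hA : ∀ z i x, ¬ π.IsA z i x u w) (hB : ∀ z, ¬ π.IsB z u w) :
    π.cond u w = π.wt := by
  rw [cond, dif_neg, dif_neg]
  · rintro ⟨z, hz⟩; exact hB z hz
  · rintro ⟨p, hp⟩; exact hA _ _ _ hp

lemma IsA.swap {z : Bool} {i : Fin 3} {x u w : V} (hA : π.IsA z i x u w) : π.IsA z i x w u :=
  ⟨hA.1, hA.2.symm.imp And.symm And.symm⟩

namespace Good

variable [Fintype V] {s t : V} (h : π.Good s t)
include h

lemma isA_sp_J {z : Bool} (i : Fin 3) {x : V} (hx : x ∈ π.J z) : π.IsA z i x (π.sp z i) x :=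
  ⟨hx, Or.inl ⟨rfl, rfl⟩⟩

lemma isA_unique {z z' : Bool} {i j : Fin 3} {x y u w : V} (h1 : π.IsA z i x u w)
    (h2 : π.IsA z' j y u w) : z' = z ∧ j = i ∧ y = x := by
  obtain ⟨hx, h1⟩ := h1
  obtain ⟨hy, h2⟩ := h2
  rcases h1 with ⟨rfl, rfl⟩ | ⟨rfl, rfl⟩ <;> rcases h2 with ⟨h2, h3⟩ | ⟨h2, h3⟩
  · have := h.sp_inj h2
    exact ⟨this.1.symm, this.2.symm, h3.symm⟩
  · exact absurd h3 (h.sp_ne hx)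
  · exact absurd h2 (h.sp_ne hx)
  · have := h.sp_inj h3
    exact ⟨this.1.symm, this.2.symm, h2.symm⟩

lemma not_isA_of_isB {z z' : Bool} {i : Fin 3} {x u w : V} (hB : π.IsB z u w) :
    ¬ π.IsA z' i x u w := by
  rintro ⟨-, ⟨h1, -⟩ | ⟨-, h1⟩⟩
  · exact h.sp_ne hB.1 h1
  · exact h.sp_ne hB.2.1 h1

lemma cond_A {z : Bool} {i : Fin 3} {x u w : V} (hA : π.IsA z i x u w) :
    π.cond u w = (π.mergeA z i x).wt := by
  have hex : ∃ p : Bool × Fin 3 × V, π.IsA p.1 p.2.1 p.2.2 u w := ⟨(z, i, x), hA⟩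
  rw [cond, dif_pos hex]
  obtain ⟨h1, h2, h3⟩ := h.isA_unique hA hex.choose_spec
  rw [h1, h2, h3]

lemma cond_B {z : Bool} {u w : V} (hB : π.IsB z u w) : π.cond u w = π.condB z u w := by
  have hex : ∃ z, π.IsB z u w := ⟨z, hB⟩
  rw [cond, dif_neg, dif_pos hex, h.J_disj hex.choose_spec.1 hB.1]
  rintro ⟨p, hp⟩
  exact h.not_isA_of_isB hB hp

lemma cond_of_adj {u w : V} (ha : π.F.Adj u w) : π.cond u w = π.wt :=
  cond_other (fun _ _ _ hA => h.not_adj_A hA ha) fun _ hB => h.not_adj_B hB ha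

/-- The conditioned point is a convex combination of points reached by at most two merges. Degrees,
symmetry and membership in the previous relaxation are all convex conditions and pass to it in this
way. -/
lemma cond_mem {S : Set (V → V → ℝ)} (hS : Convex ℝ S) (hN : ∀ z, 6 < π.N z) (h0 : π.wt ∈ S)
    (hA : ∀ z i x, x ∈ π.J z → (π.mergeA z i x).wt ∈ S)
    (hB : ∀ z x y, π.IsB z x y → (π.mergeB x y).wt ∈ S ∧
      ∀ p q, (π.mergeB x y).IsB z p q → ((π.mergeB x y).mergeB p q).wt ∈ S) (u w : V) :
    π.cond u w ∈ S := by
  by_cases h1 : ∃ z i x, π.IsA z i x u w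
  · obtain ⟨z, i, x, h1⟩ := h1
    rw [h.cond_A h1]
    exact hA z i x h1.1
  by_cases h2 : ∃ z, π.IsB z u w
  · obtain ⟨z, h2⟩ := h2
    rw [h.cond_B h2]
    exact h.condB_mem h2 (hN z) hS (hB z u w h2).1 (hB z u w h2).2
  push Not at h1 h2
  rwa [cond_other h1 h2]

variable (hN : ∀ z, 9 ≤ π.N z)
include hN

omit h in
lemma six_lt (z : Bool) : 6 < π.N z := by linarith [hN z]

/-- Conditioning never changes a degree. This is the source both of the kernel of the covariance and
of the decomposition of the complementary rows. -/
lemma cond_sum (u w v : V) :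
    ∑ b, π.cond u w v b = 2 - (if v = s then 1 else 0) - (if v = t then 1 else 0) := by
  let S : Set (V → V → ℝ) :=
    {φ | ∀ v, ∑ b, φ v b = 2 - (if v = s then 1 else 0) - (if v = t then 1 else 0)}
  have hS : Convex ℝ S := by
    intro φ hφ ψ hψ a b _ _ hab v
    simp only [Pi.add_apply, Pi.smul_apply, smul_eq_mul, Finset.sum_add_distrib,
      ← Finset.mul_sum]
    rw [hφ v, hψ v, ← add_mul, hab, one_mul]
  refine h.cond_mem hS (six_lt hN) (h.sum_wt fun z => by linarith [hN z]) (fun z i x hx => ?_)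
    (fun z x y hB => ⟨?_, fun p q hpq => ?_⟩) u w v
  · refine (h.mergeA hx).sum_wt fun z' => ?_
    by_cases hz : z' = z
    · subst hz; rw [h.mergeA_N i hx]; linarith [hN z']
    · rw [h.mergeA_N_other i hx hz]; linarith [hN z']
  · refine (h.mergeB' hB).sum_wt fun z' => ?_
    by_cases hz : z' = z
    · subst hz; rw [h.mergeB_N hB]; linarith [hN z']
    · rw [h.mergeB_N_other hB hz]; linarith [hN z']
  · have h' := h.mergeB' hB
    refine (h'.mergeB' hpq).sum_wt fun z' => ?_
    by_cases hz : z' = z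
    · subst hz; rw [h'.mergeB_N hpq, h.mergeB_N hB]; linarith [hN z']
    · rw [h'.mergeB_N_other hpq hz, h.mergeB_N_other hB hz]; linarith [hN z']

lemma cond_comm_right (u w a b : V) : π.cond u w a b = π.cond u w b a := by
  let S : Set (V → V → ℝ) := {φ | ∀ a b, φ a b = φ b a}
  have hS : Convex ℝ S := by
    intro φ hφ ψ hψ a b _ _ _ v w
    simp only [Pi.add_apply, Pi.smul_apply, hφ v w, hψ v w]
  exact h.cond_mem hS (six_lt hN) (wt_comm _) (fun _ _ _ _ => wt_comm _)
    (fun _ _ _ _ => ⟨wt_comm _, fun _ _ _ => wt_comm _⟩) u w a b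

lemma cond_adj (u w : V) {a b : V} (ha : π.F.Adj a b) : π.cond u w a b = 1 := by
  by_cases h1 : ∃ z i x, π.IsA z i x u w
  · obtain ⟨z, i, x, h1⟩ := h1
    rw [h.cond_A h1, h.mergeA_adj i h1.1 ha]
  by_cases h2 : ∃ z, π.IsB z u w
  · obtain ⟨z, h2⟩ := h2
    rw [h.cond_B h2, h.condB_adj h2 (six_lt hN z) ha]
  push Not at h1 h2
  rw [cond_other h1 h2, h.wt_of_adj ha]

lemma cond_zero (u w : V) {a b : V} (ha : ¬ π.F.Adj a b) (hA : ∀ z i x, ¬ π.IsA z i x a b)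
    (hB : ∀ z, ¬ π.IsB z a b) : π.cond u w a b = 0 := by
  by_cases h1 : ∃ z i x, π.IsA z i x u w
  · obtain ⟨z, i, x, h1⟩ := h1
    rw [h.cond_A h1, h.mergeA_zero i h1.1 ha hA hB]
  by_cases h2 : ∃ z, π.IsB z u w
  · obtain ⟨z, h2⟩ := h2
    rw [h.cond_B h2, h.condB_zero h2 (six_lt hN z) ha hA hB]
  push Not at h1 h2
  rw [cond_other h1 h2, wt, if_neg ha, frac_eq_zero hA hB, add_zero]

lemma mom_AA {z z' : Bool} (i j : Fin 3) {x y : V} (hx : x ∈ π.J z) (hy : y ∈ π.J z') :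
    π.mom (π.sp z i) x (π.sp z' j) y = if z = z'
      then momAA π.τ (alphaW (π.N z)) (mom₁ (π.N z)) i x j y
      else alphaW (π.N z) * alphaW (π.N z') := by
  rw [mom, h.wt_sp_J i hx, h.cond_A (h.isA_sp_J i hx)]
  split_ifs with hz
  · subst hz
    rw [h.mergeA_A i hx j hy, momAA]
    have h1 : π.N z ≠ 0 := by linarith [hN z]
    have h2 : π.N z - 2 ≠ 0 := by linarith [hN z]
    split_ifs
    · ring
    · ring
    · ring
    · rw [alphaW, alphaW, mom₁]; field_simp
  · rw [h.mergeA_A_other i hx (Ne.symm hz) j hy]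

lemma mom_AB {z z' : Bool} (i : Fin 3) {x u w : V} (hx : x ∈ π.J z) (hB : π.IsB z' u w) :
    π.mom (π.sp z i) x u w = if z = z'
      then momAB π.τ (mom₁ (π.N z)) (mom₃ (π.N z)) x u w
      else alphaW (π.N z) * betaW (π.N z') := by
  rw [mom, h.wt_sp_J i hx, h.cond_A (h.isA_sp_J i hx)]
  split_ifs with hz
  · subst hz
    rw [h.mergeA_B i hx hB, momAB]
    have h1 : π.N z ≠ 0 := by linarith [hN z]
    have h2 : π.N z - 2 ≠ 0 := by linarith [hN z]
    have h3 : π.N z - 2 - 2 ≠ 0 := by linarith [hN z]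
    have h4 : π.N z - 4 ≠ 0 := by linarith [hN z]
    split_ifs
    · ring
    · rw [alphaW, alphaW, mom₁]; field_simp
    · rw [alphaW, betaW, mom₃]; field_simp; ring
  · rw [h.mergeA_B_other i hx (Ne.symm hz) hB]

lemma mom_BA {z z' : Bool} (j : Fin 3) {x u w : V} (hx : x ∈ π.J z') (hB : π.IsB z u w) :
    π.mom u w (π.sp z' j) x = if z = z'
      then momAB π.τ (mom₁ (π.N z)) (mom₃ (π.N z)) x u w
      else betaW (π.N z) * alphaW (π.N z') := by
  rw [mom, h.wt_IsB hB, h.cond_B hB]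
  split_ifs with hz
  · subst hz
    rw [h.condB_A hB (six_lt hN z) j hx, momAB]
    have h1 : π.N z ≠ 0 := by linarith [hN z]
    have h2 : π.N z - 2 ≠ 0 := by linarith [hN z]
    have h3 : π.N z - 3 ≠ 0 := by linarith [hN z]
    have h4 : π.N z - 4 ≠ 0 := by linarith [hN z]
    split_ifs
    · ring
    · rw [betaW, mom₁]; field_simp
    · rw [betaW, mom₃]; field_simp
  · rw [h.condB_A_other hB (six_lt hN z) (Ne.symm hz) j hx]

lemma mom_BB {z z' : Bool} {u w a b : V} (hB : π.IsB z u w) (hB' : π.IsB z' a b) :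
    π.mom u w a b = if z = z'
      then momBB π.τ (betaW (π.N z)) (mom₄ (π.N z)) (mom₅ (π.N z)) u w a b
      else betaW (π.N z) * betaW (π.N z') := by
  rw [mom, h.wt_IsB hB, h.cond_B hB]
  split_ifs with hz
  · subst hz
    rw [h.condB_B hB (six_lt hN z) hB', momBB]
    have h1 : π.N z ≠ 0 := by linarith [hN z]
    have h2 : π.N z - 2 ≠ 0 := by linarith [hN z]
    have h3 : π.N z - 3 ≠ 0 := by linarith [hN z]
    have h4 : π.N z - 4 ≠ 0 := by linarith [hN z]
    have h6 : π.N z - 6 ≠ 0 := by linarith [hN z]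
    split_ifs
    · ring
    · ring
    · ring
    · rw [betaW, mom₄]; field_simp
    · rw [betaW, mom₅]; field_simp
  · rw [h.condB_B_other hB (six_lt hN z) (Ne.symm hz) hB']

lemma cond_comm_left (u w a b : V) : π.cond u w a b = π.cond w u a b := by
  by_cases h1 : ∃ z i x, π.IsA z i x u w
  · obtain ⟨z, i, x, h1⟩ := h1
    rw [h.cond_A h1, h.cond_A h1.swap]
  by_cases h2 : ∃ z, π.IsB z u w
  swap
  · push Not at h1 h2
    rw [cond_other h1 h2, cond_other (fun z i x hA => h1 z i x hA.swap)
      fun z hB => h2 z (IsB.symm h hB)]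
  obtain ⟨z, h2⟩ := h2
  have h3 := IsB.symm h h2
  revert a b
  refine edge_cases ?_ ?_ ?_ ?_ ?_ (π := π)
  · intro a b hab
    rw [h.cond_comm_right hN, hab, h.cond_comm_right hN]
  · intro a b ha
    rw [h.cond_adj hN _ _ ha, h.cond_adj hN _ _ ha]
  · intro a b ha hA hB
    rw [h.cond_zero hN _ _ ha hA hB, h.cond_zero hN _ _ ha hA hB]
  · intro z' j x hx
    rw [h.cond_B h2, h.cond_B h3]
    by_cases hz : z' = z
    · subst hz
      rw [h.condB_A h2 (six_lt hN _) j hx, h.condB_A h3 (six_lt hN _) j hx]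
      simp only [or_comm]
    · rw [h.condB_A_other h2 (six_lt hN _) hz j hx, h.condB_A_other h3 (six_lt hN _) hz j hx]
  · intro z' a b hB
    rw [h.cond_B h2, h.cond_B h3]
    by_cases hz : z' = z
    · subst hz
      rw [h.condB_B h2 (six_lt hN _) hB, h.condB_B h3 (six_lt hN _) hB]
      congr 1
      · apply propext; constructor <;> rintro (⟨h1, h2⟩ | ⟨h1, h2⟩) <;> simp [h1, h2]
      congr 1
      · apply propext; constructor <;> rintro (h1 | h1 | h1 | h1) <;> simp [h1]
      congr 1
      · apply propext; constructor <;> rintro (⟨h1, h2⟩ | ⟨h1, h2⟩) <;> simp [h1, h2]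
      congr 1
      · apply propext; constructor <;> rintro (h1 | h1 | h1 | h1) <;> simp [h1]
    · rw [h.condB_B_other h2 (six_lt hN _) hz hB, h.condB_B_other h3 (six_lt hN _) hz hB]

lemma mom_comm_left (u w a b : V) : π.mom u w a b = π.mom w u a b := by
  rw [mom, mom, wt_comm, h.cond_comm_left hN]

lemma mom_comm_right (u w a b : V) : π.mom u w a b = π.mom u w b a := by
  rw [mom, mom, h.cond_comm_right hN]

lemma momAA_comm {z : Bool} {α y : ℝ} {i j : Fin 3} {u w : V} (hu : u ∈ π.J z) (hw : w ∈ π.J z) :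
    momAA π.τ α y i u j w = momAA π.τ α y j w i u := by
  unfold momAA
  have h1 : (w = π.τ u) = (u = π.τ w) := propext
    ⟨fun h1 => by rw [h1, h.τ_τ hu], fun h1 => by rw [h1, h.τ_τ hw]⟩
  rw [h1]
  simp only [eq_comm]

lemma momBB_comm {z : Bool} {β y y' : ℝ} {u w a b : V} (hB : π.IsB z u w) (hB' : π.IsB z a b) :
    momBB π.τ β y y' u w a b = momBB π.τ β y y' a b u w := by
  unfold momBB
  have key : ∀ {p q}, p ∈ π.J z → q ∈ π.J z → (π.τ p = q) = (π.τ q = p) := fun hp hq => propext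
    ⟨fun h1 => by rw [← h1, h.τ_τ hp], fun h1 => by rw [← h1, h.τ_τ hq]⟩
  rw [key hB.1 hB'.1, key hB.1 hB'.2.1, key hB.2.1 hB'.1, key hB.2.1 hB'.2.1]
  have c1 : (u = a) = (a = u) := propext eq_comm
  have c2 : (u = b) = (b = u) := propext eq_comm
  have c3 : (w = a) = (a = w) := propext eq_comm
  have c4 : (w = b) = (b = w) := propext eq_comm
  rw [c1, c2, c3, c4]
  congr 1
  · apply propext; constructor <;> rintro (⟨h1, h2⟩ | ⟨h1, h2⟩) <;> simp [h1, h2]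
  congr 1
  · apply propext; constructor <;> rintro (h1 | h1 | h1 | h1) <;> simp [h1]
  congr 1
  · apply propext; constructor <;> rintro (⟨h1, h2⟩ | ⟨h1, h2⟩) <;> simp [h1, h2]
  congr 1
  · apply propext; constructor <;> rintro (h1 | h1 | h1 | h1) <;> simp [h1]

/-- The critical case is an edge at a special end against an edge between segments, where the two
orders of conditioning use different recipes; the mixture in `condB` was chosen to make them agree.
Across zones the moments are products. -/
lemma mom_symm (u w a b : V) : π.mom u w a b = π.mom a b u w := by
  have wt0 : ∀ {u w}, ¬ π.F.Adj u w → (∀ z i x, ¬ π.IsA z i x u w) → (∀ z, ¬ π.IsB z u w) →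
      π.wt u w = 0 := fun ha hA hB => by rw [wt, if_neg ha, frac_eq_zero hA hB, add_zero]
  have adj : ∀ {u w}, π.F.Adj u w → ∀ a b, π.mom u w a b = π.mom a b u w := fun ha a b => by
    rw [mom, mom, h.wt_of_adj ha, h.cond_of_adj ha, h.cond_adj hN a b ha, mul_comm]
  have zero : ∀ {u w}, ¬ π.F.Adj u w → (∀ z i x, ¬ π.IsA z i x u w) → (∀ z, ¬ π.IsB z u w) →
      ∀ a b, π.mom u w a b = π.mom a b u w := fun ha hA hB a b => by
    rw [mom, mom, wt0 ha hA hB, h.cond_zero hN a b ha hA hB, zero_mul, mul_zero]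
  refine edge_cases (P := fun u w => ∀ a b, π.mom u w a b = π.mom a b u w) ?_
    (fun u w ha => adj ha) (fun u w => zero) ?_ ?_ u w a b (π := π)
  · intro u w huw a b
    rw [h.mom_comm_left hN, huw, h.mom_comm_right hN]
  · intro z i x hx
    refine edge_cases ?_ (fun a b ha => (adj ha _ _).symm)
      (fun a b ha hA hB => (zero ha hA hB _ _).symm) ?_ ?_ (π := π)
    · intro a b hab
      rw [h.mom_comm_right hN, hab, h.mom_comm_left hN]
    · intro z' j y hy
      rw [h.mom_AA hN i j hx hy, h.mom_AA hN j i hy hx]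
      by_cases hz : z = z'
      · subst hz
        rw [if_pos rfl, if_pos rfl, h.momAA_comm hN hx hy]
      · rw [if_neg hz, if_neg (Ne.symm hz), mul_comm]
    · intro z' a b hB
      rw [h.mom_AB hN i hx hB, h.mom_BA hN i hx hB]
      by_cases hz : z = z'
      · subst hz; rw [if_pos rfl, if_pos rfl]
      · rw [if_neg hz, if_neg (Ne.symm hz), mul_comm]
  · intro z u w hB
    refine edge_cases ?_ (fun a b ha => (adj ha _ _).symm)
      (fun a b ha hA hB => (zero ha hA hB _ _).symm) ?_ ?_ (π := π)
    · intro a b hab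
      rw [h.mom_comm_right hN, hab, h.mom_comm_left hN]
    · intro z' j y hy
      rw [h.mom_AB hN j hy hB, h.mom_BA hN j hy hB]
      by_cases hz : z = z'
      · subst hz; rw [if_pos rfl, if_pos rfl]
      · rw [if_neg hz, if_neg (Ne.symm hz), mul_comm]
    · intro z' a b hB'
      rw [h.mom_BB hN hB hB', h.mom_BB hN hB' hB]
      by_cases hz : z = z'
      · subst hz
        rw [if_pos rfl, if_pos rfl, h.momBB_comm hN hB hB']
      · rw [if_neg hz, if_neg (Ne.symm hz), mul_comm]

lemma mom_self {u w : V} (huw : u ≠ w) : π.mom u w u w = π.wt u w := by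
  revert huw
  refine edge_cases (P := fun u w => u ≠ w → π.mom u w u w = π.wt u w) ?_ ?_ ?_ ?_ ?_ u w (π := π)
  · intro u w huw hne
    rw [h.mom_comm_right hN, h.mom_comm_left hN, huw hne.symm, wt_comm]
  · intro u w ha _
    rw [mom, h.cond_adj hN _ _ ha, mul_one]
  · intro u w ha hA hB _
    rw [mom, wt, if_neg ha, frac_eq_zero hA hB, add_zero, zero_mul]
  · intro z i x hx _
    rw [mom, h.cond_A (h.isA_sp_J i hx), h.mergeA_self i hx, mul_one]
  · intro z u w hB _
    rw [mom, h.cond_B hB, h.condB_self hB (six_lt hN z), mul_one]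

end Good

end Conf

end


/-! ### Reduction of semidefiniteness to fluctuations within one zone. -/

noncomputable section

open scoped Classical

/-- A quadratic form that kills the vectors `σ u` is nonnegative if it is so on their orthogonal
complement. -/
lemma quadForm_nonneg_of_orthogonal {E U : Type*} [Fintype E] {D : E → E → ℝ}
    (hD : ∀ e f, D e f = D f e) {σ : U → E → ℝ} (hσ : ∀ u e, ∑ f, D e f * σ u f = 0)
    (hpos : ∀ z : E → ℝ, (∀ u, ∑ f, σ u f * z f = 0) → 0 ≤ ∑ e, (∑ f, D e f * z f) * z e)
    (v : E → ℝ) : 0 ≤ ∑ e, (∑ f, D e f * v f) * v e := by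
  let K : Submodule ℝ (EuclideanSpace ℝ E) := Submodule.span ℝ (Set.range fun u => WithLp.toLp 2 (σ u))
  obtain ⟨y, hy, z, hz, hyz⟩ := K.exists_add_mem_mem_orthogonal (WithLp.toLp 2 v)
  have hv : ∀ e, v e = y e + z e := fun e => by
    have := congrArg (fun q : EuclideanSpace ℝ E => q e) hyz
    simpa using this
  have hDy : ∀ e, ∑ f, D e f * y f = 0 := by
    intro e
    clear hv hyz
    induction hy using Submodule.span_induction with
    | mem x hx => obtain ⟨u, rfl⟩ := hx; exact hσ u e
    | zero => simp
    | add x y _ _ hx hy => simp only [PiLp.add_apply, mul_add, Finset.sum_add_distrib, hx, hy, add_zero]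
    | smul a x _ hx =>
      have : ∀ f, D e f * (a • x) f = a * (D e f * x f) := fun f => by
        simp only [PiLp.smul_apply, smul_eq_mul]; ring
      simp only [this, ← Finset.mul_sum, hx, mul_zero]
  have h1 : ∀ e, ∑ f, D e f * v f = ∑ f, D e f * z f := fun e => by
    simp only [hv, mul_add, Finset.sum_add_distrib, hDy, zero_add]
  have h2 : ∑ e, (∑ f, D e f * z f) * y e = 0 := by
    have : ∀ e, (∑ f, D e f * z f) * y e = ∑ f, D f e * y e * z f := fun e => by
      rw [Finset.sum_mul]
      exact Finset.sum_congr rfl fun f _ => by rw [hD]; ring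
    simp only [this]
    rw [Finset.sum_comm]
    simp only [← Finset.sum_mul, hDy, zero_mul, Finset.sum_const_zero]
  have h3 : ∑ e, (∑ f, D e f * v f) * v e = ∑ e, (∑ f, D e f * z f) * z e := by
    simp only [h1]
    simp only [hv, mul_add (∑ f, _), Finset.sum_add_distrib, h2, zero_add]
  rw [h3]
  apply hpos
  intro u
  have := (Submodule.mem_orthogonal K z).1 hz _ (Submodule.subset_span ⟨u, rfl⟩)
  rw [PiLp.inner_apply] at this
  simpa [mul_comm] using this

/-- The parameters of the second moments satisfy the conditions of `zoneForm_nonneg`. -/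
lemma mom_parameters {N : ℝ} (hN : 9 ≤ N) : 0 ≤ mom₁ N ∧ mom₃ N ≤ mom₁ N ∧ mom₄ N ≤ mom₅ N ∧
    2 * (mom₅ N - mom₄ N) + |mom₅ N - 2 * mom₄ N| ≤ betaW N + mom₅ N ∧
    3 * (|2 * mom₃ N - mom₁ N - mom₅ N| + mom₁ N + 2 * (mom₁ N - mom₃ N) + (mom₅ N - mom₄ N))
      ≤ alphaW N := by
  -- Over the common denominator the claims become polynomial inequalities in `t = N - 6`. The last
  -- one, `3 * t ^ 2 + 12 * t + 18 ≤ (t + 4) * (t + 2) * t`, holds at `t = 3` but fails at `t = 2`;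
  -- this is where `N ≥ 9` matters.
  obtain ⟨t, rfl⟩ : ∃ t, N = t + 6 := ⟨N - 6, by ring⟩
  have ht : 3 ≤ t := by linarith
  set c := 1 / ((t + 6) * (t + 4) * (t + 2) * t) with hc
  have hc0 : 0 ≤ c := by positivity
  have e2 : t + 6 - 2 = t + 4 := by ring
  have e3 : t + 6 - 3 = t + 3 := by ring
  have e4 : t + 6 - 4 = t + 2 := by ring
  have e5 : t + 6 - 5 = t + 1 := by ring
  have e6 : t + 6 - 6 = t := by ring
  have t0 : t ≠ 0 := by linarith
  have t2 : t + 2 ≠ 0 := by linarith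
  have t4 : t + 4 ≠ 0 := by linarith
  have t6 : t + 6 ≠ 0 := by linarith
  have f1 : mom₁ (t + 6) = ((t + 2) * t) * c := by rw [mom₁, e2, hc]; field_simp
  have f3 : mom₃ (t + 6) = ((t + 1) * t) * c := by rw [mom₃, e2, e4, e5, hc]; field_simp
  have f4 : mom₄ (t + 6) = (t ^ 2) * c := by rw [mom₄, e2, e4, e6, hc]; field_simp
  have f5 : mom₅ (t + 6) = (t ^ 2 + 3) * c := by rw [mom₅, e2, e4, e6, hc]; field_simp
  have fa : alphaW (t + 6) = ((t + 4) * (t + 2) * t) * c := by rw [alphaW, hc]; field_simp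
  have fb : betaW (t + 6) = ((t + 3) * (t + 2) * t) * c := by rw [betaW, e2, e3, hc]; field_simp
  have a1 : |(t ^ 2 + 3) * c - 2 * (t ^ 2 * c)| ≤ (t ^ 2 + 3) * c := by
    rw [abs_le]; constructor <;> nlinarith [mul_nonneg (sq_nonneg t) hc0]
  have a2 : |2 * ((t + 1) * t * c) - (t + 2) * t * c - (t ^ 2 + 3) * c| = 3 * c := by
    rw [← abs_neg, abs_of_nonneg] <;> ring_nf
    positivity
  rw [f1, f3, f4, f5, fa, fb, a2]
  refine ⟨by positivity, ?_, ?_, ?_, ?_⟩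
  · exact mul_le_mul_of_nonneg_right (by nlinarith) hc0
  · exact mul_le_mul_of_nonneg_right (by nlinarith) hc0
  · have : 6 * c ≤ ((t + 3) * (t + 2) * t) * c := mul_le_mul_of_nonneg_right (by nlinarith) hc0
    linarith
  · have : (3 * t ^ 2 + 12 * t + 18) * c ≤ ((t + 4) * (t + 2) * t) * c :=
      mul_le_mul_of_nonneg_right (by nlinarith [mul_nonneg (by linarith : 0 ≤ t - 3) (sq_nonneg t)]) hc0
    linarith

namespace Conf

variable {V L : Type*} (π : Conf V L)

/-- The pairs of free ends that carry fractional weight. -/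
def IsFrac (u w : V) : Prop := (∃ z i x, π.IsA z i x u w) ∨ ∃ z, π.IsB z u w

/-- The star of a vertex, restricted to the fractional edges. -/
def starWt (u a b : V) : ℝ := if π.IsFrac a b ∧ (a = u ∨ b = u) then 1 else 0

variable {π}

lemma IsFrac.free {u w : V} (hF : π.IsFrac u w) : π.IsFree u := by
  rcases hF with ⟨z, i, x, hx, ⟨h1, -⟩ | ⟨h1, -⟩⟩ | ⟨z, h1⟩
  · exact Or.inl ⟨z, i, h1⟩
  · exact Or.inr ⟨z, h1 ▸ hx⟩
  · exact Or.inr ⟨z, h1.1⟩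

namespace Good

variable [Fintype V] {s t : V} (h : π.Good s t)
include h

lemma isFrac_symm {u w : V} (hF : π.IsFrac u w) : π.IsFrac w u :=
  hF.imp (fun ⟨z, i, x, hA⟩ => ⟨z, i, x, hA.swap⟩) fun ⟨z, hB⟩ => ⟨z, IsB.symm h hB⟩

lemma isFrac_comm (u w : V) : π.IsFrac u w ↔ π.IsFrac w u := ⟨h.isFrac_symm, h.isFrac_symm⟩

lemma not_isFrac_self (u : V) : ¬ π.IsFrac u u := by
  rintro (⟨z, i, x, hx, ⟨h1, h2⟩ | ⟨h1, h2⟩⟩ | ⟨z, -, -, h1, -⟩)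
  · exact h.sp_ne hx (h2.symm.trans h1)
  · exact h.sp_ne hx (h1.symm.trans h2)
  · exact h1 rfl

lemma not_isFrac_sp_sp (z z' : Bool) (i j : Fin 3) : ¬ π.IsFrac (π.sp z i) (π.sp z' j) := by
  rintro (⟨z, i, x, hx, ⟨h1, h2⟩ | ⟨h1, h2⟩⟩ | ⟨z, h1, -⟩)
  · exact h.sp_ne hx h2.symm
  · exact h.sp_ne hx h1.symm
  · exact h.sp_notMem _ _ _ h1

lemma isFrac_sp_J {z z' : Bool} {i : Fin 3} {x : V} (hx : x ∈ π.J z')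
    (hF : π.IsFrac (π.sp z i) x) : z' = z := by
  rcases hF with ⟨z1, i, x, hx1, ⟨h1, h2⟩ | ⟨h1, h2⟩⟩ | ⟨z, h1, -⟩
  · subst h2
    rw [(h.sp_inj h1).1]
    exact h.J_disj hx hx1
  · exact absurd h2 (h.sp_ne hx)
  · exact absurd h1 (h.sp_notMem _ _ _)

lemma isB_of_isFrac {z z' : Bool} {x y : V} (hx : x ∈ π.J z) (hy : y ∈ π.J z')
    (hF : π.IsFrac x y) : z' = z ∧ π.IsB z x y := by
  rcases hF with ⟨z1, i, w, hw, ⟨h1, -⟩ | ⟨-, h1⟩⟩ | ⟨z1, h1⟩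
  · exact absurd h1 (h.sp_ne hx)
  · exact absurd h1 (h.sp_ne hy)
  · have e1 := h.J_disj h1.1 hx
    subst e1
    exact ⟨h.J_disj hy h1.2.1, h1⟩

lemma sum_star (u : V) (φ : V → V → ℝ) (hφ : ∀ a b, φ a b = φ b a) :
    (1 / 2) * ∑ a, ∑ b, π.starWt u a b * φ a b = ∑ b, if π.IsFrac u b then φ u b else 0 := by
  have key : ∀ a b, π.starWt u a b * φ a b
      = (if a = u then if π.IsFrac u b then φ u b else 0 else 0)
        + (if b = u then if π.IsFrac u a then φ u a else 0 else 0) := by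
    intro a b
    unfold starWt
    by_cases ha : a = u
    · subst ha
      by_cases hb : b = a
      · subst hb; simp [h.not_isFrac_self]
      · simp [hb]
    · by_cases hb : b = u
      · subst hb
        simp [ha, h.isFrac_comm a b, hφ a b]
      · simp [ha, hb]
  simp only [key, Finset.sum_add_distrib, Finset.sum_ite_eq', Finset.mem_univ, if_true]
  rw [Finset.sum_comm]
  simp only [Finset.sum_ite_eq', Finset.mem_univ, if_true]
  ring

lemma star_comm (u a b : V) : π.starWt u a b = π.starWt u b a := by
  unfold starWt
  rw [h.isFrac_comm a b]
  simp only [or_comm]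

lemma sum_edges_star (u : V) (x : (⊤ : SimpleGraph V).edgeSet → ℝ) :
    ∑ e, edgePt (π.starWt u) e * x e = ∑ b, if π.IsFrac u b then pairFn x u b else 0 := by
  rw [sum_edges_mul _ (h.star_comm u), h.sum_star u _ (pairFn_comm x)]

lemma sum_row_sp {ψ : V → V → ℝ} (h0 : ∀ a b, ¬ π.IsFrac a b → ψ a b = 0) (z : Bool)
    (i : Fin 3) : ∑ b, ψ (π.sp z i) b = ∑ x ∈ π.J z, ψ (π.sp z i) x := by
  rw [h.sum_free _ fun b hb => h0 _ _ fun hF => hb (h.isFrac_symm hF).free,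
    Finset.sum_eq_single z]
  · simp [h0 _ _ (h.not_isFrac_sp_sp _ _ _ _)]
  · intro z' _ hz
    rw [Finset.sum_eq_zero, Finset.sum_eq_zero, add_zero]
    · exact fun x hx => h0 _ _ fun hF => hz (h.isFrac_sp_J hx hF)
    · exact fun j _ => h0 _ _ (h.not_isFrac_sp_sp _ _ _ _)
  · simp

lemma sum_row_J {ψ : V → V → ℝ} (hψ : ∀ a b, ψ a b = ψ b a)
    (h0 : ∀ a b, ¬ π.IsFrac a b → ψ a b = 0) {z : Bool} {x : V} (hx : x ∈ π.J z) :
    ∑ b, ψ x b = ∑ i, ψ (π.sp z i) x + ∑ y ∈ π.J z, ψ x y := by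
  rw [h.sum_free _ fun b hb => h0 _ _ fun hF => hb (h.isFrac_symm hF).free,
    Finset.sum_eq_single z]
  · simp only [hψ x (π.sp _ _)]
  · intro z' _ hz
    rw [Finset.sum_eq_zero, Finset.sum_eq_zero, add_zero]
    · exact fun y hy => h0 _ _ fun hF => hz (h.isB_of_isFrac hx hy hF).1
    · exact fun j _ => h0 _ _ fun hF => hz (h.isFrac_sp_J hx (h.isFrac_symm hF)).symm
  · simp

/-- Sums over pairs of a symmetric function supported on the fractional edges, zone by zone. -/
lemma sum_zones {ψ : V → V → ℝ} (hψ : ∀ a b, ψ a b = ψ b a)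
    (h0 : ∀ a b, ¬ π.IsFrac a b → ψ a b = 0) :
    (1 / 2) * ∑ a, ∑ b, ψ a b = ∑ z, (∑ i, ∑ x ∈ π.J z, ψ (π.sp z i) x
      + (1 / 2) * ∑ x ∈ π.J z, ∑ y ∈ π.J z, ψ x y) := by
  rw [h.sum_free (fun a => ∑ b, ψ a b), Finset.mul_sum]
  · refine Finset.sum_congr rfl fun z _ => ?_
    rw [Finset.sum_congr rfl fun i _ => h.sum_row_sp h0 z i,
      Finset.sum_congr rfl fun x hx => h.sum_row_J hψ h0 hx,
      Finset.sum_add_distrib, Finset.sum_comm (s := π.J z)]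
    ring
  · exact fun a ha => Finset.sum_eq_zero fun b _ => h0 _ _ fun hF => ha hF.free

variable (hN : ∀ z, 9 ≤ π.N z)
include hN

/-- This is `zoneForm_nonneg` on the subtype of segment ends, written by rows. The mixed block
occurs twice with factor 1/2, and the block between segments with 1/4, since its pairs are ordered
on both sides. -/
lemma zone_nonneg {g : V → V → ℝ} (hg : ∀ a b, g a b = g b a)
    (hg0 : ∀ a b, ¬ π.IsFrac a b → g a b = 0) (z : Bool)
    (hf : ∀ i, ∑ x ∈ π.J z, g (π.sp z i) x = 0)
    (hG : ∀ x ∈ π.J z, ∑ i, g (π.sp z i) x + ∑ y ∈ π.J z, g x y = 0) :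
    0 ≤ ∑ i, ∑ x ∈ π.J z, (∑ j, ∑ y ∈ π.J z,
          momAA π.τ (alphaW (π.N z)) (mom₁ (π.N z)) i x j y * g (π.sp z j) y
        + (1 / 2) * ∑ w ∈ π.J z, ∑ v ∈ π.J z,
          momAB π.τ (mom₁ (π.N z)) (mom₃ (π.N z)) x w v * g w v) * g (π.sp z i) x
      + (1 / 2) * ∑ w ∈ π.J z, ∑ v ∈ π.J z, (∑ j, ∑ y ∈ π.J z,
          momAB π.τ (mom₁ (π.N z)) (mom₃ (π.N z)) y w v * g (π.sp z j) y
        + (1 / 2) * ∑ w' ∈ π.J z, ∑ v' ∈ π.J z,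
          momBB π.τ (betaW (π.N z)) (mom₄ (π.N z)) (mom₅ (π.N z)) w v w' v' * g w' v') * g w v := by
  obtain ⟨p1, p2, p3, p4, p5⟩ := mom_parameters (hN z)
  have key := zoneForm_nonneg (J := π.J z) (τ := fun x => ⟨π.τ x.1, h.τ_mem x.2⟩)
    (f := fun i x => g (π.sp z i) x) (g := fun x y => g x y)
    (fun u => Subtype.ext (h.τ_τ u.2)) (fun u hu => h.τ_ne u.2 (congrArg Subtype.val hu))
    (fun u w => hg u w) (fun u => hg0 _ _ (h.not_isFrac_self _))
    (fun u => hg0 _ _ fun hF => (h.isB_of_isFrac u.2 (h.τ_mem u.2) hF).2.2.2.2 rfl)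
    (fun i => by rw [Finset.sum_coe_sort (π.J z) fun x => g (π.sp z i) x]; exact hf i)
    (fun u => by
      rw [Finset.sum_coe_sort (π.J z) fun x => g u x]
      linarith [hG u.1 u.2])
    p1 p2 p3 p4 p5
  have cAA : ∀ (α y : ℝ) (i : Fin 3) (u : π.J z) (j : Fin 3) (w : π.J z),
      momAA (fun x : π.J z => (⟨π.τ x.1, h.τ_mem x.2⟩ : π.J z)) α y i u j w
        = momAA π.τ α y i u.1 j w.1 := by
    intros; simp only [momAA, Subtype.ext_iff]
  have cAB : ∀ (y y' : ℝ) (u w v : π.J z),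
      momAB (fun x : π.J z => (⟨π.τ x.1, h.τ_mem x.2⟩ : π.J z)) y y' u w v
        = momAB π.τ y y' u.1 w.1 v.1 := by
    intros; simp only [momAB, Subtype.ext_iff]
  have cBB : ∀ (β y y' : ℝ) (u w a b : π.J z),
      momBB (fun x : π.J z => (⟨π.τ x.1, h.τ_mem x.2⟩ : π.J z)) β y y' u w a b
        = momBB π.τ β y y' u.1 w.1 a.1 b.1 := by
    intros; simp only [momBB, Subtype.ext_iff]
  have cs : ∀ φ : V → ℝ, ∑ x : π.J z, φ x.1 = ∑ x ∈ π.J z, φ x := fun φ =>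
    Finset.sum_coe_sort (π.J z) φ
  simp only [cAA, cAB, cBB] at key
  simp only [← cs]
  set A := ∑ i : Fin 3, ∑ x : π.J z, ∑ j, ∑ y : π.J z, g (π.sp z i) x.1 *
    (g (π.sp z j) y.1 * momAA π.τ (alphaW (π.N z)) (mom₁ (π.N z)) i x.1 j y.1) with hA
  set B := ∑ i : Fin 3, ∑ x : π.J z, ∑ w : π.J z, ∑ v : π.J z, g (π.sp z i) x.1 *
    (g w.1 v.1 * momAB π.τ (mom₁ (π.N z)) (mom₃ (π.N z)) x.1 w.1 v.1) with hB
  set C := ∑ w : π.J z, ∑ v : π.J z, ∑ w' : π.J z, ∑ v' : π.J z, g w.1 v.1 *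
    (g w'.1 v'.1 * momBB π.τ (betaW (π.N z)) (mom₄ (π.N z)) (mom₅ (π.N z)) w.1 v.1 w'.1 v'.1) with hC
  have hB' : B = ∑ w : π.J z, ∑ v : π.J z, (∑ j : Fin 3, ∑ y : π.J z,
      momAB π.τ (mom₁ (π.N z)) (mom₃ (π.N z)) y.1 w.1 v.1 * g (π.sp z j) y.1) * g w.1 v.1 := by
    rw [hB]
    simp only [Finset.sum_mul]
    rw [Finset.sum_congr rfl fun i _ => Finset.sum_comm]
    rw [Finset.sum_comm]
    refine Finset.sum_congr rfl fun w _ => ?_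
    rw [Finset.sum_congr rfl fun i _ => Finset.sum_comm]
    rw [Finset.sum_comm]
    refine Finset.sum_congr rfl fun v _ => Finset.sum_congr rfl fun i _ =>
      Finset.sum_congr rfl fun x _ => by ring
  have hA' : A = ∑ i : Fin 3, ∑ x : π.J z, (∑ j : Fin 3, ∑ y : π.J z,
      momAA π.τ (alphaW (π.N z)) (mom₁ (π.N z)) i x.1 j y.1 * g (π.sp z j) y.1)
        * g (π.sp z i) x.1 := by
    rw [hA]
    refine Finset.sum_congr rfl fun i _ => Finset.sum_congr rfl fun x _ => ?_
    simp only [Finset.sum_mul]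
    exact Finset.sum_congr rfl fun j _ => Finset.sum_congr rfl fun y _ => by ring
  have hB2 : B = ∑ i : Fin 3, ∑ x : π.J z, (∑ w : π.J z, ∑ v : π.J z,
      momAB π.τ (mom₁ (π.N z)) (mom₃ (π.N z)) x.1 w.1 v.1 * g w.1 v.1) * g (π.sp z i) x.1 := by
    rw [hB]
    refine Finset.sum_congr rfl fun i _ => Finset.sum_congr rfl fun x _ => ?_
    simp only [Finset.sum_mul]
    exact Finset.sum_congr rfl fun j _ => Finset.sum_congr rfl fun y _ => by ring
  have hC' : C = ∑ w : π.J z, ∑ v : π.J z, (∑ w' : π.J z, ∑ v' : π.J z,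
      momBB π.τ (betaW (π.N z)) (mom₄ (π.N z)) (mom₅ (π.N z)) w.1 v.1 w'.1 v'.1 * g w'.1 v'.1)
        * g w.1 v.1 := by
    rw [hC]
    refine Finset.sum_congr rfl fun i _ => Finset.sum_congr rfl fun x _ => ?_
    simp only [Finset.sum_mul]
    exact Finset.sum_congr rfl fun j _ => Finset.sum_congr rfl fun y _ => by ring
  simp only [add_mul, Finset.sum_add_distrib, mul_assoc, ← Finset.mul_sum]
  rw [← hA', ← hB2, ← hB', ← hC']
  linarith

end Good

end Conf

end


/-! ### The protection matrix and the induction over the rounds. -/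

noncomputable section

open scoped Classical

namespace Conf

variable {V L : Type*} {π : Conf V L}

variable (π) in
/-- The second moments minus the products of the first moments. -/
def dev (u w a b : V) : ℝ := π.mom u w a b - π.wt u w * π.wt a b

variable (π) in
/-- A row of the protection matrix. -/
def row (u w : V) : Option (⊤ : SimpleGraph V).edgeSet → ℝ
  | none => π.wt u w
  | some f => edgePt (π.mom u w) f

variable (π) in
/-- The protection matrix of a configuration. -/
def protMatrix : Matrix (Option (⊤ : SimpleGraph V).edgeSet) (Option (⊤ : SimpleGraph V).edgeSet) ℝ
  | none, none => 1
  | none, some f => edgePt π.wt f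
  | some e, o => π.row (edgeFst e) (edgeSnd e) o

lemma IsA.isFrac {z : Bool} {i : Fin 3} {x u w : V} (hA : π.IsA z i x u w) : π.IsFrac u w :=
  Or.inl ⟨z, i, x, hA⟩

lemma IsB.isFrac {z : Bool} {u w : V} (hB : π.IsB z u w) : π.IsFrac u w := Or.inr ⟨z, hB⟩

lemma frac_of_not_isFrac {u w : V} (hF : ¬ π.IsFrac u w) : π.frac u w = 0 :=
  frac_eq_zero (fun _ _ _ hA => hF hA.isFrac) fun _ hB => hF hB.isFrac

namespace Good

variable [Fintype V] {s t : V} (h : π.Good s t) (hN : ∀ z, 9 ≤ π.N z)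
include h hN

lemma cond_of_not_isFrac (u w : V) {a b : V} (hF : ¬ π.IsFrac a b) :
    π.cond u w a b = π.wt a b := by
  by_cases ha : π.F.Adj a b
  · rw [h.cond_adj hN _ _ ha, h.wt_of_adj ha]
  · rw [h.cond_zero hN u w ha (fun _ _ _ hA => hF hA.isFrac) fun _ hB => hF hB.isFrac, wt,
      if_neg ha, frac_of_not_isFrac hF, add_zero]

lemma dev_of_not_isFrac (u w : V) {a b : V} (hF : ¬ π.IsFrac a b) : π.dev u w a b = 0 := by
  rw [dev, mom, h.cond_of_not_isFrac hN u w hF, sub_self]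

lemma dev_symm (u w a b : V) : π.dev u w a b = π.dev a b u w := by
  rw [dev, dev, h.mom_symm hN, mul_comm]

lemma dev_comm_right (u w a b : V) : π.dev u w a b = π.dev u w b a := by
  rw [dev, dev, h.mom_comm_right hN, π.wt_comm a b]

lemma dev_comm_left (u w a b : V) : π.dev u w a b = π.dev w u a b := by
  rw [dev, dev, h.mom_comm_left hN, wt_comm]

section Fluctuation

variable {g : V → V → ℝ} (hg : ∀ a b, g a b = g b a)
  (hg0 : ∀ a b, ¬ π.IsFrac a b → g a b = 0) (hrow : ∀ u, ∑ b, g u b = 0)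
include hg hg0 hrow

omit hN hg in
lemma sum_sp_eq_zero (z : Bool) (i : Fin 3) : ∑ x ∈ π.J z, g (π.sp z i) x = 0 := by
  rw [← h.sum_row_sp hg0, hrow]

omit hN in
lemma sum_J_eq_zero {z : Bool} {x : V} (hx : x ∈ π.J z) :
    ∑ i, g (π.sp z i) x + ∑ y ∈ π.J z, g x y = 0 := by
  rw [← h.sum_row_J hg hg0 hx, hrow]

omit hN in
lemma sum_J_J_eq_zero (z : Bool) : ∑ x ∈ π.J z, ∑ y ∈ π.J z, g x y = 0 := by
  have h1 : ∑ x ∈ π.J z, (∑ i, g (π.sp z i) x + ∑ y ∈ π.J z, g x y) = 0 :=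
    Finset.sum_eq_zero fun x hx => h.sum_J_eq_zero hg hg0 hrow hx
  rw [Finset.sum_add_distrib, Finset.sum_comm,
    Finset.sum_eq_zero fun i _ => h.sum_sp_eq_zero hg0 hrow z i, zero_add] at h1
  exact h1

/-- The products of first moments are constant on each type of edge in a zone and are summed against
a fluctuation with vanishing sums, so they drop out. Edges of the other zone are uncorrelated with
this one and have no covariance at all. -/
lemma sum_dev_sp {z : Bool} (i : Fin 3) {x : V} (hx : x ∈ π.J z) :
    (1 / 2) * ∑ a, ∑ b, π.dev (π.sp z i) x a b * g a b
      = ∑ j, ∑ y ∈ π.J z,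
          momAA π.τ (alphaW (π.N z)) (mom₁ (π.N z)) i x j y * g (π.sp z j) y
        + (1 / 2) * ∑ w ∈ π.J z, ∑ v ∈ π.J z,
          momAB π.τ (mom₁ (π.N z)) (mom₃ (π.N z)) x w v * g w v := by
  rw [h.sum_zones (fun a b => by rw [h.dev_comm_right hN, hg])
    fun a b hF => by rw [hg0 a b hF, mul_zero]]
  have e1 : ∀ z', ∀ j, ∀ y ∈ π.J z', π.dev (π.sp z i) x (π.sp z' j) y * g (π.sp z' j) y
      = (if z = z' then momAA π.τ (alphaW (π.N z)) (mom₁ (π.N z)) i x j y * g (π.sp z' j) y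
          - alphaW (π.N z) * alphaW (π.N z) * g (π.sp z' j) y else 0) := by
    intro z' j y hy
    rw [dev, h.mom_AA hN i j hx hy, h.wt_sp_J i hx, h.wt_sp_J j hy]
    split_ifs with hz
    · subst hz; ring
    · ring
  have e2 : ∀ z', ∀ w ∈ π.J z', ∀ v ∈ π.J z', π.dev (π.sp z i) x w v * g w v
      = (if z = z' then momAB π.τ (mom₁ (π.N z)) (mom₃ (π.N z)) x w v * g w v
          - alphaW (π.N z) * betaW (π.N z) * g w v else 0) := by
    intro z' w hw v hv
    by_cases hF : π.IsFrac w v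
    · have hB := (h.isB_of_isFrac hw hv hF).2
      rw [dev, h.mom_AB hN i hx hB, h.wt_sp_J i hx, h.wt_IsB hB]
      split_ifs with hz
      · subst hz; ring
      · ring
    · simp [hg0 _ _ hF]
  rw [Finset.sum_eq_single z]
  · rw [Finset.sum_congr rfl fun j _ => Finset.sum_congr rfl (e1 z j),
      Finset.sum_congr rfl fun w hw => Finset.sum_congr rfl (e2 z w hw)]
    simp only [if_true, Finset.sum_sub_distrib, ← Finset.mul_sum,
      h.sum_sp_eq_zero hg0 hrow, h.sum_J_J_eq_zero hg hg0 hrow]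
    simp
  · intro z' _ hz
    rw [Finset.sum_congr rfl fun j _ => Finset.sum_congr rfl (e1 z' j),
      Finset.sum_congr rfl fun w hw => Finset.sum_congr rfl (e2 z' w hw)]
    simp [Ne.symm hz]
  · simp

lemma sum_dev_J {z : Bool} {u w : V} (hB : π.IsB z u w) :
    (1 / 2) * ∑ a, ∑ b, π.dev u w a b * g a b
      = ∑ j, ∑ y ∈ π.J z,
          momAB π.τ (mom₁ (π.N z)) (mom₃ (π.N z)) y u w * g (π.sp z j) y
        + (1 / 2) * ∑ a ∈ π.J z, ∑ b ∈ π.J z,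
          momBB π.τ (betaW (π.N z)) (mom₄ (π.N z)) (mom₅ (π.N z)) u w a b * g a b := by
  rw [h.sum_zones (fun a b => by rw [h.dev_comm_right hN, hg])
    fun a b hF => by rw [hg0 a b hF, mul_zero]]
  have e1 : ∀ z', ∀ j, ∀ y ∈ π.J z', π.dev u w (π.sp z' j) y * g (π.sp z' j) y
      = (if z = z' then momAB π.τ (mom₁ (π.N z)) (mom₃ (π.N z)) y u w * g (π.sp z' j) y
          - betaW (π.N z) * alphaW (π.N z) * g (π.sp z' j) y else 0) := by
    intro z' j y hy
    rw [dev, h.mom_BA hN j hy hB, h.wt_IsB hB, h.wt_sp_J j hy]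
    split_ifs with hz
    · subst hz; ring
    · ring
  have e2 : ∀ z', ∀ a ∈ π.J z', ∀ b ∈ π.J z', π.dev u w a b * g a b
      = (if z = z' then
          momBB π.τ (betaW (π.N z)) (mom₄ (π.N z)) (mom₅ (π.N z)) u w a b * g a b
          - betaW (π.N z) * betaW (π.N z) * g a b else 0) := by
    intro z' a ha b hb
    by_cases hF : π.IsFrac a b
    · have hB' := (h.isB_of_isFrac ha hb hF).2
      rw [dev, h.mom_BB hN hB hB', h.wt_IsB hB, h.wt_IsB hB']
      split_ifs with hz
      · subst hz; ring
      · ring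
    · simp [hg0 _ _ hF]
  rw [Finset.sum_eq_single z]
  · rw [Finset.sum_congr rfl fun j _ => Finset.sum_congr rfl (e1 z j),
      Finset.sum_congr rfl fun w hw => Finset.sum_congr rfl (e2 z w hw)]
    simp only [if_true, Finset.sum_sub_distrib, ← Finset.mul_sum,
      h.sum_sp_eq_zero hg0 hrow, h.sum_J_J_eq_zero hg hg0 hrow]
    simp
  · intro z' _ hz
    rw [Finset.sum_congr rfl fun j _ => Finset.sum_congr rfl (e1 z' j),
      Finset.sum_congr rfl fun w hw => Finset.sum_congr rfl (e2 z' w hw)]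
    simp [Ne.symm hz]
  · simp

end Fluctuation

/-- The star of a vertex, restricted to fractional edges, lies in the kernel because conditioning
preserves degrees and never alters the other edges. On vectors orthogonal to all stars, the form
splits into the two zone forms. -/
lemma dev_form_nonneg (v : (⊤ : SimpleGraph V).edgeSet → ℝ) :
    0 ≤ ∑ e, (∑ f, edgePt (π.dev (edgeFst e) (edgeSnd e)) f * v f) * v e := by
  refine quadForm_nonneg_of_orthogonal
    (D := fun e f => edgePt (π.dev (edgeFst e) (edgeSnd e)) f) (σ := fun u => edgePt (π.starWt u))
    (fun e f => h.dev_symm hN _ _ _ _) (fun u e => ?_) (fun z hz => ?_) v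
  · have e1 : ∀ f, edgePt (π.dev (edgeFst e) (edgeSnd e)) f * edgePt (π.starWt u) f
        = edgePt (π.starWt u) f * edgePt (π.dev (edgeFst e) (edgeSnd e)) f := fun f => mul_comm _ _
    simp only [e1]
    rw [h.sum_edges_star]
    have e2 : ∀ b, (if π.IsFrac u b then pairFn (edgePt (π.dev (edgeFst e) (edgeSnd e))) u b else 0)
        = π.wt (edgeFst e) (edgeSnd e) * (π.cond (edgeFst e) (edgeSnd e) u b - π.wt u b) := by
      intro b
      split_ifs with hF
      · rw [pairFn_edgePt (h.dev_comm_right hN _ _), dev, mom, mul_sub]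
        rintro rfl
        exact h.not_isFrac_self _ hF
      · rw [h.cond_of_not_isFrac hN _ _ hF, sub_self, mul_zero]
    simp only [e2, ← Finset.mul_sum, Finset.sum_sub_distrib, h.cond_sum hN,
      h.sum_wt fun z => (by linarith [hN z] : 2 < π.N z)]
    ring
  · set g : V → V → ℝ := fun a b => if π.IsFrac a b then pairFn z a b else 0 with hgdef
    have hg : ∀ a b, g a b = g b a := fun a b => by
      simp only [hgdef, h.isFrac_comm a b, pairFn_comm z a b]
    have hg0 : ∀ a b, ¬ π.IsFrac a b → g a b = 0 := fun a b hF => if_neg hF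
    have hrow : ∀ u, ∑ b, g u b = 0 := fun u => by
      rw [← hz u, h.sum_edges_star]
    set I : V → V → ℝ := fun u w => (1 / 2) * ∑ a, ∑ b, π.dev u w a b * g a b with hI
    have hIc : ∀ u w, I u w = I w u := fun u w => by
      simp only [hI, h.dev_comm_left hN u w]
    have hI0 : ∀ u w, ¬ π.IsFrac u w → I u w = 0 := fun u w hF => by
      simp only [hI, h.dev_symm hN u w, h.dev_of_not_isFrac hN _ _ hF]
      simp
    have e1 : ∀ u w a b, π.dev u w a b * pairFn z a b = π.dev u w a b * g a b := by
      intro u w a b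
      by_cases hF : π.IsFrac a b
      · simp only [hgdef, if_pos hF]
      · rw [h.dev_of_not_isFrac hN _ _ hF]; ring
    have e2 : ∀ u w, I u w * pairFn z u w = I u w * g u w := by
      intro u w
      by_cases hF : π.IsFrac u w
      · simp only [hgdef, if_pos hF]
      · rw [hI0 _ _ hF]; ring
    have e3 : ∀ e, ∑ f, edgePt (π.dev (edgeFst e) (edgeSnd e)) f * z f = edgePt I e := by
      intro e
      rw [sum_edges_mul _ (h.dev_comm_right hN _ _)]
      simp only [e1]
      rfl
    simp only [e3]
    rw [sum_edges_mul _ hIc]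
    simp only [e2]
    rw [h.sum_zones (fun a b => by rw [hIc, hg]) fun a b hF => by rw [hg0 a b hF, mul_zero]]
    refine Finset.sum_nonneg fun zn _ => ?_
    have hzn := h.zone_nonneg hN hg hg0 zn (h.sum_sp_eq_zero hg0 hrow zn)
      fun x hx => h.sum_J_eq_zero hg hg0 hrow hx
    refine le_of_le_of_eq hzn (congrArg₂ (· + ·) ?_ ?_)
    · refine Finset.sum_congr rfl fun i _ => Finset.sum_congr rfl fun x hx => ?_
      simp only [hI, h.sum_dev_sp hN hg hg0 hrow i hx]
    · congr 1
      refine Finset.sum_congr rfl fun x hx => Finset.sum_congr rfl fun y hy => ?_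
      by_cases hF : π.IsFrac x y
      · simp only [hI, h.sum_dev_J hN hg hg0 hrow (h.isB_of_isFrac hx hy hF).2]
      · rw [hg0 _ _ hF, mul_zero, mul_zero]

lemma protMatrix_isSymm : π.protMatrix.IsSymm := by
  ext o o'
  rcases o with _ | e <;> rcases o' with _ | f
  · rfl
  · rfl
  · rfl
  · exact h.mom_symm hN _ _ _ _

lemma protMatrix_posSemidef : π.protMatrix.PosSemidef := by
  apply Matrix.PosSemidef.of_dotProduct_mulVec_nonneg
  · rw [Matrix.IsHermitian, Matrix.conjTranspose_eq_transpose_of_trivial]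
    exact h.protMatrix_isSymm hN
  · intro v
    have hd := h.dev_form_nonneg hN fun e => v (some e)
    have e1 : ∀ e f, edgePt (π.dev (edgeFst e) (edgeSnd e)) f
        = π.protMatrix (some e) (some f) - edgePt π.wt e * edgePt π.wt f := fun e f => rfl
    simp only [e1, sub_mul, Finset.sum_sub_distrib] at hd
    set P := ∑ e, edgePt π.wt e * v (some e) with hP
    have e2 : ∀ e, (∑ f, edgePt π.wt e * edgePt π.wt f * v (some f)) * v (some e)
        = edgePt π.wt e * v (some e) * P := fun e => by
      rw [hP, Finset.mul_sum, Finset.sum_mul]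
      exact Finset.sum_congr rfl fun f _ => by ring
    simp only [e2, ← Finset.sum_mul, ← hP] at hd
    set Q := ∑ e, (∑ f, π.protMatrix (some e) (some f) * v (some f)) * v (some e) with hQ
    -- Completing the square in the coordinate `none`: the Schur complement of the corner entry 1 is
    -- the covariance form.
    have e3 : dotProduct (star v) (π.protMatrix.mulVec v) = (v none + P) ^ 2 + (Q - P * P) := by
      simp only [dotProduct, Matrix.mulVec, Fintype.sum_option, star_trivial]
      have m1 : π.protMatrix none none = 1 := rfl
      have m2 : ∀ f, π.protMatrix none (some f) = edgePt π.wt f := fun f => rfl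
      have m3 : ∀ f, π.protMatrix (some f) none = edgePt π.wt f := fun f => rfl
      simp only [m1, m2, m3, ← hP, mul_add, Finset.sum_add_distrib]
      have s1 : ∑ e, v (some e) * (edgePt π.wt e * v none) = P * v none := by
        rw [hP, Finset.sum_mul]
        exact Finset.sum_congr rfl fun f _ => by ring
      have s2 : ∑ e, v (some e) * ∑ f, π.protMatrix (some e) (some f) * v (some f) = Q := by
        rw [hQ]
        exact Finset.sum_congr rfl fun f _ => by ring
      rw [s1, s2]
      ring
    rw [e3]
    have := sq_nonneg (v none + P)
    linarith

section Step

variable {R : Set ((⊤ : SimpleGraph V).edgeSet → ℝ)} (hR : Convex ℝ R)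
  (hcond : ∀ u w, edgePt (π.cond u w) ∈ R)
include hR hcond

omit hR in
lemma row_mem (u w : V) : π.row u w ∈ coneOver R :=
  ⟨π.wt u w, h.wt_nonneg (fun z => by linarith [hN z]) u w, _, hcond u w, rfl, fun _ => rfl⟩

omit hR hcond in
-- At a free end the fractional edges have total weight one, both in the point and in every
-- conditioned point. By symmetry of the moments, the rows of these edges add up to the row of the
-- point.
lemma sum_row {u : V} (hu : π.IsFree u) :
    ∑ b, (if π.F.Adj u b then 0 else π.row u b) = π.protMatrix none := by
  have hs := h.sum_wt (fun z => (by linarith [hN z] : 2 < π.N z)) u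
  have hf := h.sum_frac (fun z => (by linarith [hN z] : 2 < π.N z)) u
  rw [if_pos hu] at hf
  simp only [wt, Finset.sum_add_distrib, hf] at hs
  funext o
  rw [Finset.sum_apply]
  rcases o with _ | f
  · rw [← Finset.sum_congr rfl fun b _ => ?_] at hf
    · exact hf
    · split_ifs with ha
      · have := h.wt_of_adj ha
        rw [wt, if_pos ha] at this
        simp only [Pi.zero_apply]
        linarith
      · simp [row, wt, ha]
  · have e1 : ∀ b, (if π.F.Adj u b then 0 else π.row u b) (some f) = π.wt (edgeFst f) (edgeSnd f)
        * (π.cond (edgeFst f) (edgeSnd f) u b - if π.F.Adj u b then 1 else 0) := by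
      intro b
      split_ifs with ha
      · rw [h.cond_adj hN _ _ ha]; simp
      · simp only [row, edgePt]
        rw [h.mom_symm hN, mom, sub_zero]
    simp only [e1, ← Finset.mul_sum, Finset.sum_sub_distrib, h.cond_sum hN]
    rw [← hs]
    simp [protMatrix, edgePt]

theorem pt_mem_lsPlus : π.pt ∈ lsPlus R := by
  have hN3 : ∀ z, 3 ≤ π.N z := fun z => by linarith [hN z]
  have hne : R.Nonempty := ⟨_, hcond (Classical.choice ⟨π.sp true 0⟩) (π.sp true 0)⟩
  refine ⟨fun e => ⟨h.wt_nonneg hN3 _ _, h.wt_le_one hN3 _ _⟩, π.protMatrix,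
    h.protMatrix_isSymm hN, h.protMatrix_posSemidef hN, rfl, fun _ => rfl, fun e => ?_,
    fun e => h.row_mem hN hcond _ _, fun e => ?_⟩
  · exact h.mom_self hN (edgeFst_ne_edgeSnd e)
  · change π.protMatrix none - π.row (edgeFst e) (edgeSnd e) ∈ coneOver R
    by_cases ha : π.F.Adj (edgeFst e) (edgeSnd e)
    · convert zero_mem_coneOver hne using 1
      rw [sub_eq_zero]
      funext o
      rcases o with _ | f
      · exact (h.wt_of_adj ha).symm
      · simp only [protMatrix, row, edgePt, mom]
        rw [h.wt_of_adj ha, h.cond_of_adj ha, one_mul]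
    by_cases hF : π.IsFrac (edgeFst e) (edgeSnd e)
    · rw [← h.sum_row hN hF.free, ← Finset.add_sum_erase _ _ (Finset.mem_univ (edgeSnd e)),
        if_neg ha, add_sub_cancel_left]
      apply sum_mem_coneOver hR hne
      intro b _
      split_ifs
      · exact zero_mem_coneOver hne
      · exact h.row_mem hN hcond _ _
    · have hw : π.wt (edgeFst e) (edgeSnd e) = 0 := by
        rw [wt, if_neg ha, frac_of_not_isFrac hF, add_zero]
      have hc := hcond (edgeFst e) (edgeSnd e)
      rw [cond_other (fun _ _ _ hA => hF hA.isFrac) fun _ hB => hF hB.isFrac] at hc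
      refine ⟨1, zero_le_one, _, hc, ?_, fun f => ?_⟩
      · simp [protMatrix, row, hw]
      · simp [protMatrix, row, hw, edgePt, mom]

end Step

end Good

/-- The point of a configuration with sufficiently many segments survives many rounds of `N₊`. -/
theorem Good.pt_mem_iterate [Fintype V] {s t : V} (hst : s ≠ t) (r : ℕ) {π : Conf V L}
    (h : π.Good s t) (hN : ∀ z, 4 * (r : ℝ) + 9 ≤ π.N z) :
    π.pt ∈ lsPlus^[r] (symPathPolytope (⊤ : SimpleGraph V) s t) := by
  induction r generalizing π with
  | zero => exact h.pt_mem hst fun z => by simpa using hN z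
  | succ r ih =>
    push_cast at hN
    have hN9 : ∀ z, 9 ≤ π.N z := fun z => by
      have : (0 : ℝ) ≤ r := r.cast_nonneg
      linarith [hN z]
    rw [Function.iterate_succ_apply']
    have hR := convex_lsPlus_iterate (convex_symPathPolytope s t) r
    refine h.pt_mem_lsPlus hN9 hR fun u w => ?_
    -- The costliest case is two merges in the same zone, which remove four segment ends; this
    -- accounts for `4 * r`, and the 9 is what the cut bounds and `mom_parameters` require.
    refine h.cond_mem
      (S := {φ | edgePt φ ∈ lsPlus^[r] (symPathPolytope (⊤ : SimpleGraph V) s t)})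
      (fun φ hφ ψ hψ a b ha hb hab => hR hφ hψ ha hb hab) (six_lt hN9)
      (ih h fun z => by linarith [hN z]) (fun z i x hx => ih (h.mergeA hx) fun z' => ?_)
      (fun z x y hB => ⟨ih (h.mergeB' hB) fun z' => ?_, fun p q hpq =>
        ih ((h.mergeB' hB).mergeB' hpq) fun z' => ?_⟩) u w
    · by_cases hz : z' = z
      · subst hz; rw [h.mergeA_N i hx]; linarith [hN z']
      · rw [h.mergeA_N_other i hx hz]; linarith [hN z']
    · by_cases hz : z' = z
      · subst hz; rw [h.mergeB_N hB]; linarith [hN z']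
      · rw [h.mergeB_N_other hB hz]; linarith [hN z']
    · by_cases hz : z' = z
      · subst hz; rw [(h.mergeB' hB).mergeB_N hpq, h.mergeB_N hB]; linarith [hN z']
      · rw [(h.mergeB' hB).mergeB_N_other hpq hz, h.mergeB_N_other hB hz]; linarith [hN z']

end Conf

end


/-! ### Existence of Hamiltonian paths. -/

noncomputable section

open scoped Classical

lemma sum_fin_adj {n : ℕ} (i : Fin n) :
    ∑ j : Fin n, (if (i : ℕ) + 1 = j ∨ (j : ℕ) + 1 = i then 1 else 0)
      = (if (i : ℕ) + 1 < n then 1 else 0) + (if 0 < (i : ℕ) then 1 else 0) := by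
  have key : ∀ j : Fin n, (if (i : ℕ) + 1 = j ∨ (j : ℕ) + 1 = i then 1 else 0)
      = (if (i : ℕ) + 1 = j then 1 else 0) + (if (j : ℕ) + 1 = i then 1 else 0) := by
    intro j
    split_ifs <;> omega
  simp only [key, Finset.sum_add_distrib]
  congr 1
  · split_ifs with h
    · rw [Finset.sum_eq_single ⟨i + 1, h⟩]
      · simp
      · intro b _ hb
        exact if_neg fun h1 => hb (Fin.ext h1.symm)
      · simp
    · exact Finset.sum_eq_zero fun b _ => if_neg fun h1 => h (by have := b.2; omega)
  · split_ifs with h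
    · rw [Finset.sum_eq_single ⟨i - 1, by omega⟩]
      · exact if_pos (by simp; omega)
      · intro b _ hb
        exact if_neg fun h1 => hb (Fin.ext (by simp; omega))
      · simp
    · exact Finset.sum_eq_zero fun b _ => if_neg fun h1 => h (by omega)

/-- A set of indices that is neither empty nor everything has two neighbouring indices, exactly one
of which belongs to it. -/
lemma exists_adj_crossing {n : ℕ} {S : Set (Fin n)} {i j : Fin n} (hi : i ∈ S) (hj : j ∉ S) :
    ∃ a b : Fin n, a ∈ S ∧ b ∉ S ∧ ((a : ℕ) + 1 = b ∨ (b : ℕ) + 1 = a) := by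
  by_contra hcon
  push Not at hcon
  have step : ∀ k (hk : k + 1 < n), ((⟨k, by omega⟩ : Fin n) ∈ S ↔ (⟨k + 1, hk⟩ : Fin n) ∈ S) := by
    intro k hk
    constructor
    · intro h1
      by_contra h2
      exact (hcon _ _ h1 h2).1 rfl
    · intro h1
      by_contra h2
      exact (hcon _ _ h1 h2).2 rfl
  have all : ∀ k (hk : k < n), ((⟨k, hk⟩ : Fin n) ∈ S ↔ (⟨0, by omega⟩ : Fin n) ∈ S) := by
    intro k
    induction k with
    | zero => intro hk; exact Iff.rfl
    | succ k ih => intro hk; rw [← ih (by omega), step k hk]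
  exact hj ((all j.1 j.2).2 ((all i.1 i.2).1 hi))

section

variable {V : Type*} [Fintype V] {s t : V}

lemma card_inter_pair (hst : s ≠ t) (S : Finset V) :
    (S ∩ {s, t}).card = ∑ a ∈ S, ((if a = s then 1 else 0) + (if a = t then 1 else 0)) := by
  rw [Finset.sum_add_distrib, Finset.sum_ite_eq', Finset.sum_ite_eq']
  by_cases hs : s ∈ S <;> by_cases ht : t ∈ S
  · have : S ∩ {s, t} = {s, t} := by ext v; aesop
    rw [this, Finset.card_pair hst]; simp [hs, ht]
  · have : S ∩ {s, t} = {s} := by ext v; aesop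
    rw [this]; simp [hs, ht]
  · have : S ∩ {s, t} = {t} := by ext v; aesop
    rw [this]; simp [hs, ht]
  · have : S ∩ {s, t} = ∅ := by ext v; aesop
    rw [this]; simp [hs, ht]

lemma cut_add_card_inter_even (hst : s ≠ t) {f : V → V → ℕ} (hf : ∀ u v, f u v = f v u)
    (h0 : ∀ u, f u u = 0)
    (hd : ∀ a, (∑ b, f a b) + ((if a = s then 1 else 0) + (if a = t then 1 else 0)) = 2)
    (S : Finset V) : ((∑ a ∈ S, ∑ b ∈ Sᶜ, f a b) + (S ∩ {s, t}).card) % 2 = 0 := by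
  have h1 := cut_parity f hf h0 S
  have h2 : ∑ a ∈ S, ∑ b, f a b + (S ∩ {s, t}).card = S.card * 2 := by
    rw [card_inter_pair hst, ← Finset.sum_add_distrib, Finset.sum_congr rfl fun a _ => hd a]
    simp
  omega

/-- There is a hamiltonian path between any two distinct vertices. -/
lemma symPathInt_nonempty (hst : s ≠ t) : (symPathInt (⊤ : SimpleGraph V) s t).Nonempty := by
  set n := Fintype.card V with hn
  have hn2 : 2 ≤ n := by
    rw [hn, ← Finset.card_pair hst]
    exact Finset.card_le_univ _
  obtain ⟨σ, hσs, hσt⟩ : ∃ σ : V ≃ Fin n, (σ s : ℕ) = 0 ∧ (σ t : ℕ) + 1 = n := by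
    let σ₀ : V ≃ Fin n := Fintype.equivFin V
    let σ₁ := σ₀.trans (Equiv.swap (σ₀ s) ⟨0, by omega⟩)
    have h1 : σ₁ s = ⟨0, by omega⟩ := by simp [σ₁]
    have h2 : σ₁ t ≠ ⟨0, by omega⟩ := fun h2 => hst (σ₁.injective (h1.trans h2.symm))
    refine ⟨σ₁.trans (Equiv.swap (σ₁ t) ⟨n - 1, by omega⟩), ?_, ?_⟩
    · rw [Equiv.trans_apply, h1, Equiv.swap_apply_of_ne_of_ne h2.symm]
      intro h3
      have := congrArg Fin.val h3
      simp at this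
      omega
    · simp; omega
  set f : V → V → ℕ := fun u v => if (σ u : ℕ) + 1 = σ v ∨ (σ v : ℕ) + 1 = σ u then 1 else 0 with hfd
  have hf : ∀ u v, f u v = f v u := fun u v => by simp only [hfd, or_comm]
  have h0 : ∀ u, f u u = 0 := fun u => by simp [hfd]
  have hs : ∀ v, v = s ↔ (σ v : ℕ) = 0 := fun v =>
    ⟨fun h => by rw [h, hσs], fun h => σ.injective (Fin.ext (by rw [h, hσs]))⟩
  have ht : ∀ v, v = t ↔ (σ v : ℕ) + 1 = n := fun v =>
    ⟨fun h => by rw [h, hσt], fun h => σ.injective (Fin.ext (by omega))⟩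
  have hd : ∀ a, (∑ b, f a b) + ((if a = s then 1 else 0) + (if a = t then 1 else 0)) = 2 := by
    intro a
    have h1 : ∑ b, f a b = ∑ j : Fin n, (if (σ a : ℕ) + 1 = j ∨ (j : ℕ) + 1 = σ a then 1 else 0) :=
      Equiv.sum_comp σ fun j : Fin n => if (σ a : ℕ) + 1 = j ∨ (j : ℕ) + 1 = σ a then 1 else 0
    have h2 := (σ a).2
    simp only [h1, sum_fin_adj, hs, ht]
    split_ifs <;> omega
  set x : (⊤ : SimpleGraph V).edgeSet → ℝ := edgePt fun u v => (f u v : ℝ) with hx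
  have hp : ∀ u v, pairFn x u v = f u v := by
    intro u v
    by_cases huv : u = v
    · subst huv; simp [h0]
    · exact pairFn_edgePt (fun u v => by rw [hf]) huv
  have hcut : ∀ S : Finset V, cutWeight x S = ((∑ a ∈ S, ∑ b ∈ Sᶜ, f a b : ℕ) : ℝ) := by
    intro S
    rw [cutWeight_eq]
    simp only [hp]
    push_cast
    rfl
  have hpos : ∀ S : Finset V, S ≠ ∅ → S ≠ Finset.univ → 1 ≤ ∑ a ∈ S, ∑ b ∈ Sᶜ, f a b := by
    intro S h1 h2
    obtain ⟨u, hu⟩ := Finset.nonempty_iff_ne_empty.2 h1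
    obtain ⟨v, hv⟩ : ∃ v, v ∉ S := by
      by_contra hcon
      push Not at hcon
      exact h2 (Finset.eq_univ_iff_forall.2 hcon)
    obtain ⟨a, b, ha, hb, hab⟩ := exists_adj_crossing (S := {i | σ.symm i ∈ S}) (i := σ u)
      (j := σ v) (by simpa using hu) (by simpa using hv)
    have h3 : f (σ.symm a) (σ.symm b) = 1 := by
      simp only [hfd, Equiv.apply_symm_apply]
      exact if_pos hab
    have h4 : f (σ.symm a) (σ.symm b) ≤ ∑ b ∈ Sᶜ, f (σ.symm a) b :=
      Finset.single_le_sum (f := fun b => f (σ.symm a) b) (fun _ _ => Nat.zero_le _)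
        (by simpa using hb)
    have h5 : ∑ b ∈ Sᶜ, f (σ.symm a) b ≤ ∑ a ∈ S, ∑ b ∈ Sᶜ, f a b :=
      Finset.single_le_sum (f := fun a => ∑ b ∈ Sᶜ, f a b) (fun _ _ => Nat.zero_le _) ha
    omega
  have h01 : ∀ e, x e = 0 ∨ x e = 1 := by
    intro e
    simp only [hx, edgePt, hfd]
    split_ifs <;> simp
  have hdeg : ∀ v, cutWeight x {v} = ((∑ b, f v b : ℕ) : ℝ) := by
    intro v
    rw [cutWeight_singleton]
    simp only [hp]
    push_cast
    rfl
  refine ⟨x, ⟨fun S h1 h2 h3 => ?_, fun S h1 h2 h3 => ?_, fun v h1 h2 => ?_, ?_, ?_, fun e => ?_⟩, h01⟩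
  -- A cut that does not separate `s` from `t` has an even number of edges, and it has at least one.
  · have h4 := cut_add_card_inter_even hst hf h0 hd S
    have h5 := hpos S h1 h2
    have h6 : (S ∩ {s, t}).card ≤ 2 :=
      (Finset.card_le_card Finset.inter_subset_right).trans Finset.card_le_two
    rw [hcut]
    exact_mod_cast (by omega : 2 ≤ ∑ a ∈ S, ∑ b ∈ Sᶜ, f a b)
  · rw [hcut]
    exact_mod_cast hpos S h1 h2
  · have := hd v
    rw [if_neg h1, if_neg h2] at this
    rw [hdeg]
    exact_mod_cast this
  · have := hd s
    rw [if_pos rfl, if_neg hst] at this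
    rw [hdeg]
    exact_mod_cast (by omega : ∑ b, f s b = 1)
  · have := hd t
    rw [if_pos rfl, if_neg hst.symm] at this
    rw [hdeg]
    exact_mod_cast (by omega : ∑ b, f t b = 1)
  · rcases h01 e with h | h <;> rw [h] <;> simp

end

end


/-! ### The lower bound for Hamiltonian paths. -/

noncomputable section

open scoped Classical

/-- The pair `e` has exactly one end in `S`. -/
def Crosses {V : Type*} (S : Finset V) (e : Sym2 V) : Prop := ∃ u ∈ S, ∃ v ∉ S, e = s(u, v)

section Crossing

variable {V : Type*}

lemma crosses_mk {S : Finset V} {u v : V} : Crosses S s(u, v) ↔ ¬ (u ∈ S ↔ v ∈ S) := by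
  constructor
  · rintro ⟨a, ha, b, hb, hab⟩
    rcases Sym2.eq_iff.1 hab with ⟨rfl, rfl⟩ | ⟨rfl, rfl⟩ <;> tauto
  · intro h
    by_cases hu : u ∈ S
    · exact ⟨u, hu, v, by tauto, rfl⟩
    · exact ⟨v, by tauto, u, hu, Sym2.eq_swap⟩

/-- A walk crosses a cut an odd number of times if and only if the cut separates its ends. -/
lemma walk_crossing_parity {G : SimpleGraph V} {u v : V} (w : G.Walk u v) (S : Finset V) :
    w.edges.countP (fun e => decide (Crosses S e)) % 2 = if (u ∈ S ↔ v ∈ S) then 0 else 1 := by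
  induction w with
  | nil => simp
  | cons h p ih =>
    rw [SimpleGraph.Walk.edges_cons, List.countP_cons, Nat.add_mod, ih]
    simp only [decide_eq_true_eq, crosses_mk]
    split_ifs <;> first | rfl | tauto

lemma countP_eq_count_add_count {α : Type*} [DecidableEq α] {p : α → Prop} {a b : α} (hab : a ≠ b) (l : List α)
    (h : ∀ e ∈ l, p e ↔ e = a ∨ e = b) :
    l.countP (fun e => decide (p e)) = l.count a + l.count b := by
  induction l with
  | nil => simp
  | cons e l ih =>
    rw [List.countP_cons, List.count_cons, List.count_cons,
      ih fun e he => h e (List.mem_cons_of_mem _ he)]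
    have h1 := h e List.mem_cons_self
    by_cases ha : e = a
    · subst ha; simp [h1, hab]; omega
    · by_cases hb : e = b
      · subst hb; simp [h1, ha]; omega
      · simp [h1, ha, hb]

lemma sum_count_le_length {α ι : Type*} [DecidableEq α] [Fintype ι] {E : ι → α} (hE : Function.Injective E)
    (l : List α) : ∑ i, l.count (E i) ≤ l.length := by
  induction l with
  | nil => simp
  | cons e l ih =>
    simp only [List.count_cons, Finset.sum_add_distrib, List.length_cons]
    apply Nat.add_le_add ih
    by_cases h : ∃ i, E i = e
    · obtain ⟨i, rfl⟩ := h
      rw [Finset.sum_eq_single i]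
      · simp
      · intro j _ hj
        simp [hE.eq_iff, Ne.symm hj]
      · simp
    · push Not at h
      rw [Finset.sum_eq_zero]
      · omega
      · intro i _
        simp [Ne.symm (h i)]

/-- Odd numbers of which at most one equals one have a sum of at least `3 * n - 2`. -/
lemma sum_odd_ge {n : ℕ} {a : Fin n → ℕ} (hodd : ∀ i, a i % 2 = 1)
    (hone : ∀ i j, i < j → ¬ (a i = 1 ∧ a j = 1)) : 3 * n ≤ ∑ i, a i + 2 := by
  have h1 : ∀ i, 3 ≤ a i + (if a i = 1 then 2 else 0) := by
    intro i
    have := hodd i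
    split_ifs <;> omega
  have h2 : ∑ i, (if a i = 1 then 2 else 0) ≤ 2 := by
    by_cases h : ∃ i, a i = 1
    · obtain ⟨i, hi⟩ := h
      rw [Finset.sum_eq_single i]
      · simp [hi]
      · intro j _ hj
        rw [if_neg]
        intro hj1
        rcases lt_or_gt_of_ne hj with h3 | h3
        · exact hone _ _ h3 ⟨hj1, hi⟩
        · exact hone _ _ h3 ⟨hi, hj1⟩
      · simp
    · push Not at h
      simp [h]
  have h3 : ∑ _i : Fin n, 3 ≤ ∑ i, (a i + (if a i = 1 then 2 else 0)) :=
    Finset.sum_le_sum fun i _ => h1 i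
  rw [Finset.sum_add_distrib] at h3
  simp at h3
  omega

end Crossing

section IntegerBound

variable {V : Type*} [Fintype V]

/-- A graph that consists of two sides joined by two long paths `pv true` and `pv false`: every
hamiltonian path between the sides has length at least `3 * ℓ - 2`. -/
theorem le_cost_of_mem_symPathInt {G : SimpleGraph V} (hG : G.Connected) {s t : V} (hst : s ≠ t)
    {ℓ : ℕ} {len : Bool → ℕ} (hlen : ∀ k, ℓ ≤ len k) {pv : Bool → ℕ → V} {Z : Bool → V → Prop}
    {hgt : V → ℕ} (hs : Z true s) (ht : Z false t)
    (hadj : ∀ u v, G.Adj u v → (∃ z, Z z u ∧ Z z v) ∨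
      ∃ k i, i < len k ∧ s(u, v) = s(pv k i, pv k (i + 1)))
    (hZt : ∀ u, Z true u → hgt u = 0) (hZf : ∀ u, Z false u → ℓ ≤ hgt u)
    (hpv : ∀ k i, i ≤ len k → hgt (pv k i) = i)
    (hZpv : ∀ z k i, i ≤ len k → Z z (pv k i) → i = 0 ∨ i = len k)
    (hinj : ∀ k i k' i', i ≤ len k → i' ≤ len k' → pv k i = pv k' i' → k = k' ∧ i = i')
    {x : (⊤ : SimpleGraph V).edgeSet → ℝ} (hx : x ∈ symPathInt ⊤ s t) :
    (3 * ℓ - 2 : ℝ) ≤ ∑ e, (G.dist (edgeFst e) (edgeSnd e) : ℝ) * x e := by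
  obtain ⟨hxP, h01⟩ := hx
  set xn : (⊤ : SimpleGraph V).edgeSet → ℕ := fun e => if x e = 1 then 1 else 0 with hxn
  have hxe : ∀ e, x e = xn e := by
    intro e
    simp only [hxn]
    rcases h01 e with h | h <;> simp [h]
  set f : V → V → ℕ := fun u v => if pairFn x u v = 1 then 1 else 0 with hfd
  have hfp : ∀ u v, pairFn x u v = f u v := by
    intro u v
    simp only [hfd]
    have : pairFn x u v = 0 ∨ pairFn x u v = 1 := by
      unfold pairFn
      split_ifs
      · exact h01 _
      · exact Or.inl rfl
    rcases this with h | h <;> simp [h]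
  have hf : ∀ u v, f u v = f v u := fun u v => by simp only [hfd, pairFn_comm x u v]
  have h0 : ∀ u, f u u = 0 := fun u => by simp [hfd]
  have hdeg : ∀ v, cutWeight x {v} = ((∑ b, f v b : ℕ) : ℝ) := by
    intro v
    rw [cutWeight_singleton]
    simp only [hfp]
    push_cast
    rfl
  have hd : ∀ a, (∑ b, f a b) + ((if a = s then 1 else 0) + (if a = t then 1 else 0)) = 2 := by
    intro a
    have h1 := hdeg a
    by_cases has : a = s
    · subst has
      rw [hxP.degree_source] at h1
      have : ∑ b, f a b = 1 := by exact_mod_cast h1.symm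
      simp [this, hst]
    · by_cases hat : a = t
      · subst hat
        rw [hxP.degree_target] at h1
        have : ∑ b, f a b = 1 := by exact_mod_cast h1.symm
        simp [this, has]
      · rw [hxP.degree_two a has hat] at h1
        have : ∑ b, f a b = 2 := by exact_mod_cast h1.symm
        simp [this, has, hat]
  set C : Finset V → ℕ := fun S => ∑ e : (⊤ : SimpleGraph V).edgeSet,
    if Crosses S (e : Sym2 V) then xn e else 0 with hC
  have hCw : ∀ S, cutWeight x S = C S := by
    intro S
    simp only [hC, cutWeight]
    push_cast
    refine Finset.sum_congr (Finset.ext fun _ => by simp) fun e _ => ?_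
    rw [hxe]
    exact if_congr Iff.rfl rfl rfl
  have hCeven : ∀ S : Finset V, (C S + (S ∩ {s, t}).card) % 2 = 0 := by
    intro S
    have h1 : C S = ∑ a ∈ S, ∑ b ∈ Sᶜ, f a b := by
      have := (hCw S).symm.trans (cutWeight_eq x S)
      simp only [hfp] at this
      exact_mod_cast this
    rw [h1]
    exact cut_add_card_inter_even hst hf h0 hd S
  choose W hW using fun e : (⊤ : SimpleGraph V).edgeSet =>
    hG.exists_walk_length_eq_dist (edgeFst e) (edgeSnd e)
  -- How often the graph edge `a` is traversed when every edge of the Hamiltonian path is replaced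
  -- by a shortest walk.
  set y : Sym2 V → ℕ := fun a => ∑ e, xn e * (W e).edges.count a with hy
  -- the two graph edges of a cut carry the crossings of the walks
  have hcut : ∀ (S : Finset V) (a b : Sym2 V), a ≠ b →
      (∀ e ∈ G.edgeSet, Crosses S e ↔ e = a ∨ e = b) →
      (y a + y b) % 2 = C S % 2 ∧ C S ≤ y a + y b := by
    intro S a b hab hS
    have key : ∀ e : (⊤ : SimpleGraph V).edgeSet,
        ((W e).edges.count a + (W e).edges.count b) % 2 = if Crosses S (e : Sym2 V) then 1 else 0 := by
      intro e
      rw [← countP_eq_count_add_count hab (W e).edges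
        (fun e' he' => hS e' ((W e).edges_subset_edgeSet he')), walk_crossing_parity,
        ← mk_edgeFst_edgeSnd e, crosses_mk]
      split_ifs <;> rfl
    have hsum : y a + y b = ∑ e, xn e * ((W e).edges.count a + (W e).edges.count b) := by
      simp only [hy, mul_add, Finset.sum_add_distrib]
    rw [hsum]
    constructor
    · rw [Finset.sum_nat_mod]
      conv_rhs => rw [hC, Finset.sum_nat_mod]
      congr 1
      refine Finset.sum_congr rfl fun e _ => ?_
      rw [Nat.mul_mod, key e]
      split_ifs <;> simp
    · refine Finset.sum_le_sum fun e _ => ?_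
      have := key e
      split_ifs with h1
      · rw [if_pos h1] at this
        exact Nat.le_mul_of_pos_right _ (by omega)
      · exact Nat.zero_le _
  set E : Bool → ℕ → Sym2 V := fun k i => s(pv k i, pv k (i + 1)) with hE
  have hEinj : ∀ k i k' i', i < len k → i' < len k' → E k i = E k' i' → k = k' ∧ i = i' := by
    intro k i k' i' hi hi' he
    rcases Sym2.eq_iff.1 he with ⟨h1, -⟩ | ⟨h1, h2⟩
    · exact hinj _ _ _ _ hi.le hi'.le h1
    · have h3 := hinj _ _ _ _ hi.le hi' h1
      have h4 := hinj _ _ _ _ hi hi'.le h2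
      omega
  have mem_hgt : ∀ k i j, i ≤ len k → (pv k i ∈ Finset.univ.filter (fun v => hgt v ≤ j) ↔ i ≤ j) := by
    intro k i j hi
    simp [hpv k i hi]
  -- The vertices of height at most `i` contain `s` but not `t`, and the only graph edges leaving
  -- them are the two path edges at level `i`.
  have hlevel : ∀ i < ℓ, (y (E true i) + y (E false i)) % 2 = 1 := by
    intro i hi
    have hi' : ∀ k, i < len k := fun k => hi.trans_le (hlen k)
    set S := Finset.univ.filter (fun v => hgt v ≤ i) with hS
    have h1 := (hcut S (E true i) (E false i)
      (fun he => by simpa using (hEinj _ _ _ _ (hi' _) (hi' _) he).1) ?_).1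
    · have h2 : (S ∩ {s, t}).card = 1 := by
        have : S ∩ {s, t} = {s} := by
          ext v
          simp only [hS, Finset.mem_inter, Finset.mem_filter, Finset.mem_univ, true_and,
            Finset.mem_insert, Finset.mem_singleton]
          constructor
          · rintro ⟨h1, rfl | rfl⟩
            · rfl
            · have := hZf _ ht; omega
          · rintro rfl
            exact ⟨by rw [hZt _ hs]; omega, Or.inl rfl⟩
        rw [this]; simp
      have h3 := hCeven S
      omega
    · intro e he
      constructor
      · intro hc
        induction e using Sym2.ind with
        | _ u v =>
          rw [crosses_mk] at hc
          simp only [hS, Finset.mem_filter, Finset.mem_univ, true_and] at hc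
          rcases hadj u v he with ⟨z, hu, hv⟩ | ⟨k, j, hj, hjuv⟩
          · exfalso
            apply hc
            cases z
            · have := hZf u hu; have := hZf v hv; omega
            · rw [hZt u hu, hZt v hv]
          · have hc' : Crosses S s(u, v) := by
              rw [crosses_mk]; simpa [hS] using hc
            rw [hjuv, crosses_mk, mem_hgt _ _ _ hj.le, mem_hgt _ _ _ hj] at hc'
            have : j = i := by omega
            subst this
            rw [hjuv]
            cases k
            · exact Or.inr rfl
            · exact Or.inl rfl
      · rintro (rfl | rfl)
        · rw [hE, crosses_mk, mem_hgt _ _ _ (hi' _).le, mem_hgt _ _ _ (hi' _)]; omega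
        · rw [hE, crosses_mk, mem_hgt _ _ _ (hi' _).le, mem_hgt _ _ _ (hi' _)]; omega
  -- The vertices of path `k` between its edges `i` and `j` form a set without `s` and `t` that only
  -- these two edges leave, so the cut constraint forces two traversals.
  have hpair : ∀ k i j, i < j → j < ℓ → 2 ≤ y (E k i) + y (E k j) := by
    intro k i j hij hj
    have hj' : ∀ k, j < len k := fun k => hj.trans_le (hlen k)
    set T := Finset.univ.filter (fun v => ∃ l, i < l ∧ l ≤ j ∧ v = pv k l) with hT
    have mem_T : ∀ k' l, l ≤ len k' → (pv k' l ∈ T ↔ k' = k ∧ i < l ∧ l ≤ j) := by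
      intro k' l hl
      simp only [hT, Finset.mem_filter, Finset.mem_univ, true_and]
      constructor
      · rintro ⟨l', h1, h2, h3⟩
        obtain ⟨h4, h5⟩ := hinj _ _ _ _ hl (h2.trans (hj' k).le) h3
        exact ⟨h4, by omega, by omega⟩
      · rintro ⟨rfl, h1, h2⟩
        exact ⟨l, h1, h2, rfl⟩
    have Z_T : ∀ z v, Z z v → v ∉ T := by
      intro z v hv hvT
      simp only [hT, Finset.mem_filter, Finset.mem_univ, true_and] at hvT
      obtain ⟨l, h1, h2, rfl⟩ := hvT
      have := hj' k
      have := hZpv z k l (by omega) hv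
      omega
    have h1 := (hcut T (E k i) (E k j)
      (fun he => by have := (hEinj _ _ _ _ (hij.trans (hj' _)) (hj' _) he).2; omega) ?_).2
    · have h2 : (T ∩ {s, t}).card = 0 := by
        rw [Finset.card_eq_zero]
        ext v
        simp only [Finset.mem_inter, Finset.mem_insert, Finset.mem_singleton, Finset.notMem_empty,
          iff_false]
        rintro ⟨h1, rfl | rfl⟩
        exacts [Z_T _ _ hs h1, Z_T _ _ ht h1]
      have h3 := hxP.cut_two T ?_ ?_ (by omega)
      · rw [hCw] at h3
        have h4 : 2 ≤ C T := by exact_mod_cast h3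
        omega
      · apply Finset.nonempty_iff_ne_empty.1
        exact ⟨pv k j, (mem_T k j (hj' k).le).2 ⟨rfl, hij, le_rfl⟩⟩
      · intro h4
        exact Z_T _ _ hs (h4 ▸ Finset.mem_univ s)
    · intro e he
      constructor
      · intro hc
        induction e using Sym2.ind with
        | _ u v =>
          rcases hadj u v he with ⟨z, hu, hv⟩ | ⟨k', l, hl, hluv⟩
          · rw [crosses_mk] at hc
            have := Z_T z u hu; have := Z_T z v hv
            tauto
          · rw [hluv, crosses_mk, mem_T _ _ hl.le, mem_T _ _ hl] at hc
            by_cases hk : k' = k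
            · subst hk
              simp only [true_and] at hc
              have : l = i ∨ l = j := by omega
              rcases this with rfl | rfl
              · exact Or.inl hluv
              · exact Or.inr hluv
            · simp [hk] at hc
      · have := hj' k
        rintro (rfl | rfl)
        · rw [hE, crosses_mk, mem_T _ _ (by omega), mem_T _ _ (by omega)]
          simp only [true_and]
          omega
        · rw [hE, crosses_mk, mem_T _ _ (by omega), mem_T _ _ (by omega)]
          simp only [true_and]
          omega
  have htotal : ∑ i : Fin ℓ, (y (E true i) + y (E false i))
      ≤ ∑ e, G.dist (edgeFst e) (edgeSnd e) * xn e := by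
    have h1 : ∑ i : Fin ℓ, (y (E true i) + y (E false i))
        = ∑ e, xn e * ∑ p : Bool × Fin ℓ, (W e).edges.count (E p.1 p.2) := by
      have : ∑ i : Fin ℓ, (y (E true i) + y (E false i)) = ∑ p : Bool × Fin ℓ, y (E p.1 p.2) := by
        rw [Fintype.sum_prod_type]
        simp [Finset.sum_add_distrib]
      rw [this]
      simp only [hy, Finset.mul_sum]
      rw [Finset.sum_comm]
    rw [h1]
    refine Finset.sum_le_sum fun e _ => ?_
    rw [mul_comm, ← hW e, ← SimpleGraph.Walk.length_edges]
    apply Nat.mul_le_mul_right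
    apply sum_count_le_length (E := fun p : Bool × Fin ℓ => E p.1 p.2)
    rintro ⟨k, i⟩ ⟨k', i'⟩ he
    obtain ⟨h1, h2⟩ := hEinj _ _ _ _ (i.2.trans_le (hlen k)) (i'.2.trans_le (hlen k')) he
    exact Prod.ext h1 (Fin.ext h2)
  -- Two levels with a single traversal each would carry two traversals altogether, whereas `hpair`
  -- for both paths demands four.
  have hge := sum_odd_ge (a := fun i : Fin ℓ => y (E true i) + y (E false i))
    (fun i => hlevel i i.2) (fun i j hij h1 => by
      have h2 := hpair true i j hij j.2
      have h3 := hpair false i j hij j.2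
      omega)
  have hfin : 3 * ℓ ≤ ∑ e, G.dist (edgeFst e) (edgeSnd e) * xn e + 2 := by omega
  have hcast : ∑ e, (G.dist (edgeFst e) (edgeSnd e) : ℝ) * x e
      = ((∑ e, G.dist (edgeFst e) (edgeSnd e) * xn e : ℕ) : ℝ) := by
    push_cast
    exact Finset.sum_congr rfl fun e _ => by rw [hxe]
  rw [hcast]
  have : (3 * ℓ : ℝ) ≤ ((∑ e, G.dist (edgeFst e) (edgeSnd e) * xn e : ℕ) : ℝ) + 2 := by
    exact_mod_cast hfin
  linarith

end IntegerBound

end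


/-! ### Two cliques joined by two paths, and their configuration. -/

noncomputable section

open scoped Classical

/-- The roles of the vertices: the two ends `s`, `t`, the ends of `m` segments on either side, and
the vertices of two paths of lengths `len true`, `len false` that join the two sides. -/
abbrev Role (m : ℕ) (len : Bool → ℕ) : Type :=
  Bool ⊕ (Bool × Fin m × Bool) ⊕ (Σ k : Bool, Fin (len k + 1))

namespace Role

variable {m : ℕ} {len : Bool → ℕ}

/-- The vertices of the sides; either side contains the first or the last vertex of each path. -/
def InZone (z : Bool) : Role m len → Prop
  | .inl z' => z' = z
  | .inr (.inl p) => p.1 = z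
  | .inr (.inr p) => (p.2 : ℕ) = if z then 0 else len p.1

/-- The height of a vertex above the first side. -/
def height (ℓ : ℕ) : Role m len → ℕ
  | .inl z => if z then 0 else ℓ
  | .inr (.inl p) => if p.1 then 0 else ℓ
  | .inr (.inr p) => p.2

/-- Adjacency along the segments and the paths. -/
def Linked : Role m len → Role m len → Prop
  | .inr (.inl p), .inr (.inl q) => p.1 = q.1 ∧ p.2.1 = q.2.1 ∧ p.2.2 ≠ q.2.2
  | .inr (.inr p), .inr (.inr q) => p.1 = q.1 ∧ ((p.2 : ℕ) + 1 = q.2 ∨ (q.2 : ℕ) + 1 = p.2)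
  | _, _ => False

/-- The strand of a vertex. -/
def label : Role m len → Bool ⊕ (Bool × Fin m) ⊕ Bool
  | .inl z => .inl z
  | .inr (.inl p) => .inr (.inl (p.1, p.2.1))
  | .inr (.inr p) => .inr (.inr p.1)

/-- The end of a path on a given side. -/
def pathEnd (z k : Bool) : Role m len := .inr (.inr ⟨k, if z then 0 else Fin.last _⟩)

/-- The special free ends of a side. -/
def special (z : Bool) (i : Fin 3) : Role m len :=
  if i = 0 then .inl z else pathEnd z (decide (i = 1))

/-- The other end of a segment. -/
def partner : Role m len → Role m len
  | .inr (.inl p) => .inr (.inl (p.1, p.2.1, !p.2.2))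
  | w => w

@[simp] lemma linked_segment {p q : Bool × Fin m × Bool} :
    Linked (.inr (.inl p) : Role m len) (.inr (.inl q)) ↔
      p.1 = q.1 ∧ p.2.1 = q.2.1 ∧ p.2.2 ≠ q.2.2 := Iff.rfl

@[simp] lemma linked_path {p q : Σ k : Bool, Fin (len k + 1)} :
    Linked (.inr (.inr p) : Role m len) (.inr (.inr q)) ↔
      p.1 = q.1 ∧ ((p.2 : ℕ) + 1 = q.2 ∨ (q.2 : ℕ) + 1 = p.2) := Iff.rfl

@[simp] lemma not_linked_inl {z : Bool} {w : Role m len} : ¬ Linked (.inl z) w := id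

@[simp] lemma not_linked_inl' {z : Bool} {w : Role m len} : ¬ Linked w (.inl z) := by
  rcases w with _ | _ | _ <;> exact id

@[simp] lemma not_linked_segment_path {p : Bool × Fin m × Bool} {q : Σ k : Bool, Fin (len k + 1)} :
    ¬ Linked (.inr (.inl p) : Role m len) (.inr (.inr q)) := id

@[simp] lemma not_linked_path_segment {p : Bool × Fin m × Bool} {q : Σ k : Bool, Fin (len k + 1)} :
    ¬ Linked (.inr (.inr q) : Role m len) (.inr (.inl p)) := id

@[simp] lemma inZone_inl {z z' : Bool} : InZone z (.inl z' : Role m len) ↔ z' = z := Iff.rfl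

@[simp] lemma inZone_segment {z : Bool} {p : Bool × Fin m × Bool} :
    InZone z (.inr (.inl p) : Role m len) ↔ p.1 = z := Iff.rfl

@[simp] lemma inZone_path {z : Bool} {p : Σ k : Bool, Fin (len k + 1)} :
    InZone z (.inr (.inr p) : Role m len) ↔ (p.2 : ℕ) = if z then 0 else len p.1 := Iff.rfl

lemma Linked.symm {w w' : Role m len} (h : Linked w w') : Linked w' w := by
  rcases w with _ | _ | _ <;> rcases w' with _ | _ | _ <;> simp only [linked_segment, linked_path,
    not_linked_inl, not_linked_inl', not_linked_segment_path, not_linked_path_segment] at h ⊢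
  · exact ⟨h.1.symm, h.2.1.symm, h.2.2.symm⟩
  · exact ⟨h.1.symm, h.2.symm⟩

lemma not_linked_self (w : Role m len) : ¬ Linked w w := by
  rcases w with _ | _ | _ <;> simp

lemma inZone_special (z : Bool) (i : Fin 3) : InZone z (special z i : Role m len) := by
  unfold special pathEnd
  split_ifs <;> cases z <;> simp_all [InZone]

lemma special_inj (hlen : ∀ k, 1 ≤ len k) {z z' : Bool} {i j : Fin 3}
    (h : (special z i : Role m len) = special z' j) : z = z' ∧ i = j := by
  have h1 := hlen true
  have h2 := hlen false
  fin_cases i <;> fin_cases j <;> cases z <;> cases z' <;>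
    simp_all [special, pathEnd, Fin.ext_iff]
  all_goals omega

lemma label_special (z : Bool) (i : Fin 3) : label (special z i : Role m len)
    = if i = 0 then .inl z else .inr (.inr (decide (i = 1))) := by
  unfold special pathEnd
  split_ifs <;> rfl

lemma card (m : ℕ) (len : Bool → ℕ) :
    Fintype.card (Role m len) = 4 + 4 * m + len true + len false := by
  simp only [Fintype.card_sum, Fintype.card_prod, Fintype.card_sigma, Fintype.card_bool,
    Fintype.card_fin, Fintype.sum_bool]
  ring

end Role

section Layout

variable {V : Type*} {m : ℕ} {len : Bool → ℕ} (ρ : V ≃ Role m len)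

/-- Two cliques joined by two paths. -/
def layoutGraph : SimpleGraph V where
  Adj u v := u ≠ v ∧ ((∃ z, (ρ u).InZone z ∧ (ρ v).InZone z) ∨ (ρ u).Linked (ρ v))
  symm := ⟨fun _ _ h => ⟨h.1.symm, h.2.imp (fun ⟨z, h1, h2⟩ => ⟨z, h2, h1⟩) Role.Linked.symm⟩⟩
  loopless := ⟨fun _ h => h.1 rfl⟩

/-- The configuration of the segments and the paths. -/
def layoutConf : Conf V (Bool ⊕ (Bool × Fin m) ⊕ Bool) where
  F :=
    { Adj := fun u v => (ρ u).Linked (ρ v)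
      symm := ⟨fun _ _ h => h.symm⟩
      loopless := ⟨fun _ h => Role.not_linked_self _ h⟩ }
  sp z i := ρ.symm (Role.special z i)
  J z := Finset.univ.image fun p : Fin m × Bool => ρ.symm (.inr (.inl (z, p)))
  τ v := ρ.symm (ρ v).partner
  c v := (ρ v).label

variable {ρ}

lemma layoutConf_mem_J {z : Bool} {v : V} :
    v ∈ (layoutConf ρ).J z ↔ ∃ p : Fin m × Bool, ρ v = .inr (.inl (z, p)) := by
  simp only [layoutConf, Finset.mem_image, Finset.mem_univ, true_and]
  constructor
  · rintro ⟨p, rfl⟩; exact ⟨p, by simp⟩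
  · rintro ⟨p, hp⟩; exact ⟨p, by rw [← hp]; simp⟩

lemma layoutConf_N (z : Bool) : (layoutConf ρ).N z = 2 * m := by
  simp only [Conf.N, layoutConf]
  rw [Finset.card_image_of_injective]
  · simp; ring
  · intro p q hpq
    simpa using hpq

lemma layoutConf_isFree {v : V} : (layoutConf ρ).IsFree v ↔ ∃ z, (ρ v).InZone z := by
  obtain ⟨w, rfl⟩ := ρ.symm.surjective v
  simp only [Conf.IsFree, layoutConf_mem_J, Equiv.apply_symm_apply]
  constructor
  · rintro (⟨z, i, h⟩ | ⟨z, p, rfl⟩)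
    · rw [ρ.symm.injective h]
      exact ⟨z, Role.inZone_special z i⟩
    · exact ⟨z, rfl⟩
  · rintro ⟨z, h⟩
    rcases w with z' | ⟨z', p⟩ | ⟨k, i⟩
    · exact Or.inl ⟨z', 0, rfl⟩
    · exact Or.inr ⟨z', p, rfl⟩
    · refine Or.inl ⟨z, if k then 1 else 2, ?_⟩
      simp only [Role.InZone] at h
      simp only [layoutConf, EmbeddingLike.apply_eq_iff_eq]
      have hi : i = if z then 0 else Fin.last _ := Fin.ext (by rw [h]; cases z <;> simp)
      rw [hi]
      cases k
      · rfl
      · rfl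

variable [Fintype V]

/-- The vertices `s` and `t` are isolated and free, segment ends and path ends have one link and are
free, inner path vertices have two links. Paths need an edge, so that their two ends are distinct.
-/
lemma layoutConf_deg (hlen : ∀ k, 1 ≤ len k) (v : V) :
    (∑ b, if (layoutConf ρ).F.Adj v b then 1 else 0) + (if v = ρ.symm (.inl true) then 1 else 0)
      + (if v = ρ.symm (.inl false) then 1 else 0)
      + (if (layoutConf ρ).IsFree v then 1 else 0) = 2 := by
  have h1 : (∑ b, if (layoutConf ρ).F.Adj v b then 1 else 0)
      = ∑ w, if (ρ v).Linked w then 1 else 0 :=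
    Equiv.sum_comp ρ fun w => if (ρ v).Linked w then 1 else 0
  rw [h1, layoutConf_isFree]
  obtain ⟨w, rfl⟩ := ρ.symm.surjective v
  simp only [Equiv.apply_symm_apply, EmbeddingLike.apply_eq_iff_eq, Fintype.sum_sum_type]
  rcases w with z | ⟨z, k, b⟩ | ⟨k, i⟩
  · cases z <;> simp
  · simp only [Role.linked_segment, Role.not_linked_inl', Role.not_linked_segment_path,
      Role.inZone_segment]
    rw [Finset.sum_eq_single (z, k, !b)]
    · simp
    · rintro ⟨z', k', b'⟩ _ hne
      rw [if_neg]
      rintro ⟨rfl, rfl, hb⟩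
      apply hne
      simp only [Prod.mk.injEq, true_and]
      cases b <;> cases b' <;> simp_all
    · simp
  · simp only [Role.linked_path, Role.not_linked_inl', Role.not_linked_path_segment,
      Role.inZone_path, Fintype.sum_sigma, if_false, Finset.sum_const_zero, zero_add]
    rw [Finset.sum_eq_single k]
    · simp only [true_and, sum_fin_adj]
      have := hlen k
      have := i.2
      have e : (∃ z : Bool, (i : ℕ) = if z = true then 0 else len k) ↔ (i : ℕ) = 0 ∨ (i : ℕ) = len k := by
        simp [or_comm]
      simp only [e, if_false, Finset.sum_const_zero, reduceCtorEq]
      split_ifs <;> omega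
    · intro k' _ hk
      exact Finset.sum_eq_zero fun j _ => if_neg fun h => hk h.1.symm
    · simp

lemma layoutConf_good (hlen : ∀ k, 1 ≤ len k) :
    (layoutConf ρ).Good (ρ.symm (.inl true)) (ρ.symm (.inl false)) := by
  have hτ : ∀ {v z} {p : Fin m × Bool}, ρ v = .inr (.inl (z, p)) →
      ρ ((layoutConf ρ).τ v) = .inr (.inl (z, p.1, !p.2)) := by
    intro v z p h
    simp [layoutConf, h, Role.partner]
  have hc : ∀ v, (layoutConf ρ).c v = (ρ v).label := fun v => rfl
  have hsp : ∀ z i, ρ ((layoutConf ρ).sp z i) = Role.special z i := fun z i => by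
    simp [layoutConf]
  have hcsp : ∀ z i, (layoutConf ρ).c ((layoutConf ρ).sp z i)
      = if i = 0 then .inl z else .inr (.inr (decide (i = 1))) := fun z i => by
    rw [hc, hsp, Role.label_special]
  refine
    { sp_inj := ?_, sp_notMem := ?_, J_disj := ?_, τ_mem := ?_, τ_ne := ?_, τ_τ := ?_, c_τ := ?_,
      c_J := ?_, c_sp := ?_, c_one := ?_, c_two := ?_, c_one_two := ?_, c_s := ?_, c_t := ?_,
      adj_c := ?_, conn := ?_, cover := ?_, deg := layoutConf_deg hlen }
  · intro z i z' j h
    exact Role.special_inj hlen (ρ.symm.injective h)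
  · intro z i z' h
    obtain ⟨p, hp⟩ := layoutConf_mem_J.1 h
    rw [hsp] at hp
    have := congrArg Role.label hp
    rw [Role.label_special] at this
    split_ifs at this <;> simp [Role.label] at this
  · intro z z' x h h'
    obtain ⟨p, hp⟩ := layoutConf_mem_J.1 h
    obtain ⟨p', hp'⟩ := layoutConf_mem_J.1 h'
    rw [hp] at hp'
    simp at hp'
    exact hp'.1
  · intro z x h
    obtain ⟨p, hp⟩ := layoutConf_mem_J.1 h
    exact layoutConf_mem_J.2 ⟨_, hτ hp⟩
  · intro z x h h'
    obtain ⟨p, hp⟩ := layoutConf_mem_J.1 h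
    have := hτ hp
    rw [h', hp] at this
    simp [Prod.ext_iff] at this
  · intro z x h
    obtain ⟨p, hp⟩ := layoutConf_mem_J.1 h
    apply ρ.injective
    rw [hτ (hτ hp), hp]
    simp
  · intro z x h
    obtain ⟨p, hp⟩ := layoutConf_mem_J.1 h
    rw [hc, hc, hτ hp, hp]
    rfl
  · intro z z' x y h h' hxy
    obtain ⟨⟨k, b⟩, hp⟩ := layoutConf_mem_J.1 h
    obtain ⟨⟨k', b'⟩, hp'⟩ := layoutConf_mem_J.1 h'
    rw [hc, hc, hp, hp'] at hxy
    simp only [Role.label, Sum.inr.injEq, Sum.inl.injEq, Prod.mk.injEq] at hxy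
    obtain ⟨rfl, rfl⟩ := hxy
    by_cases hb : b' = b
    · left; apply ρ.injective; rw [hp, hp', hb]
    · right; apply ρ.injective; rw [hτ hp, hp']
      have : b' = !b := by cases b <;> cases b' <;> simp_all
      rw [this]
  · intro z x h z' i
    obtain ⟨p, hp⟩ := layoutConf_mem_J.1 h
    rw [hcsp, hc, hp]
    split_ifs <;> simp [Role.label]
  · rw [hcsp, hcsp]; simp
  · rw [hcsp, hcsp]; simp
  · rw [hcsp, hcsp]; simp
  · rw [hcsp, hc]; simp [Role.label]
  · rw [hcsp, hc]; simp [Role.label]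
  · intro u v h
    rw [hc, hc]
    change (ρ u).Linked (ρ v) at h
    generalize ρ u = w at h ⊢
    generalize ρ v = w' at h ⊢
    rcases w with _ | _ | _ <;> rcases w' with _ | _ | _ <;> simp only [Role.linked_segment,
      Role.linked_path, Role.not_linked_inl, Role.not_linked_inl', Role.not_linked_segment_path,
      Role.not_linked_path_segment] at h
    · simp [Role.label, h.1, h.2.1]
    · simp [Role.label, h.1]
  · intro S u v huv hu hv
    obtain ⟨w, rfl⟩ := ρ.symm.surjective u
    obtain ⟨w', rfl⟩ := ρ.symm.surjective v
    have hne : w ≠ w' := by rintro rfl; exact hv hu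
    rw [hc, hc, Equiv.apply_symm_apply, Equiv.apply_symm_apply] at huv
    rcases w with z | ⟨z, k, b⟩ | ⟨k, i⟩ <;> rcases w' with z' | ⟨z', k', b'⟩ | ⟨k', i'⟩ <;>
      simp only [Role.label, reduceCtorEq, Sum.inl.injEq, Sum.inr.injEq, Prod.mk.injEq] at huv
    · exact absurd (by rw [huv]) hne
    · obtain ⟨rfl, rfl⟩ := huv
      refine ⟨_, _, hu, hv, ?_, rfl⟩
      change (ρ _).Linked (ρ _)
      rw [Equiv.apply_symm_apply, Equiv.apply_symm_apply]
      exact ⟨rfl, rfl, fun hb => hne (by simp only at hb; rw [hb])⟩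
    · subst huv
      obtain ⟨a, b, ha, hb, hab⟩ := exists_adj_crossing
        (S := {i : Fin (len k + 1) | ρ.symm (.inr (.inr ⟨k, i⟩)) ∈ S}) (i := i) (j := i') hu hv
      refine ⟨_, _, ha, hb, ?_, ?_⟩
      · change (ρ _).Linked (ρ _)
        rw [Equiv.apply_symm_apply, Equiv.apply_symm_apply]
        exact ⟨rfl, hab⟩
      · rw [hc, hc, Equiv.apply_symm_apply, Equiv.apply_symm_apply]
        rfl
  · intro v
    by_cases hv : (layoutConf ρ).IsFree v
    · exact ⟨v, hv, rfl⟩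
    · rw [layoutConf_isFree] at hv
      push Not at hv
      obtain ⟨w, rfl⟩ := ρ.symm.surjective v
      simp only [Equiv.apply_symm_apply] at hv
      rcases w with z | ⟨z, k, b⟩ | ⟨k, i⟩
      · exact absurd rfl (hv z)
      · exact absurd rfl (hv z)
      · refine ⟨ρ.symm (Role.pathEnd true k), layoutConf_isFree.2 ⟨true, ?_⟩, ?_⟩
        · simp [Role.pathEnd, Role.InZone]
        · rw [hc, hc, Equiv.apply_symm_apply, Equiv.apply_symm_apply]
          rfl

end Layout

end


/-! ### The metric instance and its integrality gap. -/

noncomputable section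

open scoped Classical

section Instance

variable {V : Type*} {m : ℕ} {len : Bool → ℕ} {ρ : V ≃ Role m len}

/-- The vertices of the paths by their height. -/
def pathVertex (ρ : V ≃ Role m len) (k : Bool) (i : ℕ) : V :=
  ρ.symm (.inr (.inr ⟨k, Fin.ofNat (len k + 1) i⟩))

lemma pathVertex_role (k : Bool) {i : ℕ} (hi : i ≤ len k) :
    ρ (pathVertex ρ k i) = .inr (.inr ⟨k, ⟨i, by omega⟩⟩) := by
  rw [pathVertex, Equiv.apply_symm_apply]
  have : Fin.ofNat (len k + 1) i = ⟨i, by omega⟩ :=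
    Fin.ext (Nat.mod_eq_of_lt (by omega : i < len k + 1))
  rw [this]

lemma eq_pathVertex {v : V} {k : Bool} {i : Fin (len k + 1)} (hv : ρ v = .inr (.inr ⟨k, i⟩)) :
    v = pathVertex ρ k i := by
  apply ρ.injective
  rw [hv, pathVertex_role k (by omega)]

lemma layoutGraph_adj_cases (u v : V) (h : (layoutGraph ρ).Adj u v) :
    (∃ z, (ρ u).InZone z ∧ (ρ v).InZone z) ∨
      ∃ k i, i < len k ∧ s(u, v) = s(pathVertex ρ k i, pathVertex ρ k (i + 1)) := by
  obtain ⟨-, h | h⟩ := h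
  · exact Or.inl h
  · rcases hu : ρ u with z | p | ⟨k, i⟩ <;> rcases hv : ρ v with z' | p' | ⟨k', i'⟩ <;>
      rw [hu, hv] at h <;> simp only [Role.linked_segment,
      Role.linked_path, Role.not_linked_inl, Role.not_linked_inl', Role.not_linked_segment_path,
      Role.not_linked_path_segment] at h
    · exact Or.inl ⟨p.1, rfl, h.1.symm⟩
    · obtain ⟨rfl, h⟩ := h
      right
      rw [eq_pathVertex hu, eq_pathVertex hv]
      rcases h with h | h
      · exact ⟨k, i, by omega, by rw [h]⟩
      · exact ⟨k, i', by omega, by rw [h, Sym2.eq_swap]⟩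

lemma layoutGraph_adj_pathVertex (k : Bool) {i : ℕ} (hi : i < len k) :
    (layoutGraph ρ).Adj (pathVertex ρ k i) (pathVertex ρ k (i + 1)) := by
  refine ⟨fun h => ?_, Or.inr ?_⟩
  · have := congrArg ρ h
    rw [pathVertex_role k hi.le, pathVertex_role k hi] at this
    simp at this
  · rw [pathVertex_role k hi.le, pathVertex_role k hi]
    exact ⟨rfl, Or.inl rfl⟩

lemma layoutGraph_connected : (layoutGraph ρ).Connected := by
  have hzone : ∀ {z u v}, (ρ u).InZone z → (ρ v).InZone z → (layoutGraph ρ).Reachable u v := by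
    intro z u v hu hv
    by_cases huv : u = v
    · rw [huv]
    · exact SimpleGraph.Adj.reachable ⟨huv, Or.inl ⟨z, hu, hv⟩⟩
  have hpath : ∀ k i, i ≤ len k →
      (layoutGraph ρ).Reachable (pathVertex ρ k i) (pathVertex ρ k 0) := by
    intro k i
    induction i with
    | zero => intro _; exact SimpleGraph.Reachable.refl _
    | succ i ih =>
      intro hi
      exact (layoutGraph_adj_pathVertex k hi).symm.reachable.trans (ih (by omega))
  have hpt : ∀ k, (ρ (pathVertex ρ k 0)).InZone true := fun k => by
    rw [pathVertex_role k (Nat.zero_le _)]; simp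
  have hpf : ∀ k, (ρ (pathVertex ρ k (len k))).InZone false := fun k => by
    rw [pathVertex_role k le_rfl]; simp
  have hbase : ∀ v, (layoutGraph ρ).Reachable v (pathVertex ρ true 0) := by
    intro v
    have side : ∀ z, (ρ v).InZone z → (layoutGraph ρ).Reachable v (pathVertex ρ true 0) := by
      intro z hz
      cases z
      · exact (hzone hz (hpf true)).trans (hpath true _ le_rfl)
      · exact hzone hz (hpt true)
    rcases hv : ρ v with z | p | ⟨k, i⟩
    · exact side z (by rw [hv]; rfl)
    · exact side p.1 (by rw [hv]; rfl)
    · rw [eq_pathVertex hv]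
      exact (hpath k i (by omega)).trans (hzone (hpt k) (hpt true))
  exact { preconnected := fun u v => (hbase u).trans (hbase v).symm, nonempty := ⟨pathVertex ρ true 0⟩ }

variable [Fintype V]

lemma layoutConf_wt_of_not_adj (hlen : ∀ k, 1 ≤ len k) {u v : V}
    (h : ¬ (layoutGraph ρ).Adj u v) : (layoutConf ρ).wt u v = 0 := by
  have hg := layoutConf_good (ρ := ρ) hlen
  have hF : ¬ (layoutConf ρ).F.Adj u v := fun hF => h ⟨hF.ne, Or.inr hF⟩
  rw [Conf.wt, if_neg hF, zero_add]
  have hsp : ∀ z i, (ρ ((layoutConf ρ).sp z i)).InZone z := fun z i => by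
    simpa [layoutConf] using Role.inZone_special z i
  have hJ : ∀ {z x}, x ∈ (layoutConf ρ).J z → (ρ x).InZone z := by
    intro z x hx
    obtain ⟨p, hp⟩ := layoutConf_mem_J.1 hx
    rw [hp]; rfl
  apply Conf.frac_eq_zero
  · rintro z i x ⟨hx, ⟨rfl, rfl⟩ | ⟨rfl, rfl⟩⟩
    · exact h ⟨(hg.sp_ne hx).symm, Or.inl ⟨z, hsp z i, hJ hx⟩⟩
    · exact h ⟨hg.sp_ne hx, Or.inl ⟨z, hJ hx, hsp z i⟩⟩
  · rintro z ⟨hu, hv, hne, -⟩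
    exact h ⟨hne.symm, Or.inl ⟨z, hJ hu, hJ hv⟩⟩

/-- The shortest-path metric of two cliques joined by two paths. -/
def layoutInstance (ρ : V ≃ Role m len) : SymPathInstance V where
  d := Sym2.lift ⟨fun u v => ((layoutGraph ρ).dist u v : ℝ), fun u v => by
    simp only [SimpleGraph.dist_comm]⟩
  nonneg e := by
    induction e using Sym2.ind with
    | _ u v => exact Nat.cast_nonneg _
  triangle u v w _ _ _ := by
    simp only [Sym2.lift_mk]
    exact_mod_cast layoutGraph_connected.dist_triangle
  s := ρ.symm (.inl true)
  t := ρ.symm (.inl false)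
  s_ne_t := by simp

lemma layoutInstance_isGraphMetric : (layoutInstance ρ).IsGraphMetric :=
  ⟨layoutGraph ρ, layoutGraph_connected, fun _ _ => rfl⟩

lemma layoutInstance_d (e : (⊤ : SimpleGraph V).edgeSet) :
    (layoutInstance ρ).d e = ((layoutGraph ρ).dist (edgeFst e) (edgeSnd e) : ℝ) := by
  rw [← mk_edgeFst_edgeSnd e]
  rfl

lemma one_le_layoutInstance_d (e : (⊤ : SimpleGraph V).edgeSet) :
    1 ≤ (layoutInstance ρ).d e := by
  rw [layoutInstance_d]
  exact_mod_cast layoutGraph_connected.pos_dist_of_ne (edgeFst_ne_edgeSnd e)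

lemma layoutInstance_cost (x : (⊤ : SimpleGraph V).edgeSet → ℝ) :
    (layoutInstance ρ).cost x
      = ∑ e : (⊤ : SimpleGraph V).edgeSet, (layoutInstance ρ).d e * x e :=
  Finset.sum_congr (Finset.ext fun _ => by simp) fun _ _ => rfl

/-- The support consists of graph edges, at distance one, so the cost is half the sum of the
degrees, which are 2 except for the degree 1 of `s` and of `t`. -/
lemma layoutInstance_cost_pt (hlen : ∀ k, 1 ≤ len k) (hm : 2 ≤ m) :
    (layoutInstance ρ).cost (layoutConf ρ).pt = Fintype.card V - 1 := by
  have hg := layoutConf_good (ρ := ρ) hlen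
  have hN : ∀ z, 2 < (layoutConf ρ).N z := fun z => by
    rw [layoutConf_N]
    have : (2 : ℝ) ≤ m := by exact_mod_cast hm
    linarith
  have h1 : ∀ e : (⊤ : SimpleGraph V).edgeSet, (layoutInstance ρ).d e * (layoutConf ρ).pt e
      = edgePt (fun _ _ => 1) e * (layoutConf ρ).pt e := by
    intro e
    rw [layoutInstance_d]
    by_cases h : (layoutGraph ρ).Adj (edgeFst e) (edgeSnd e)
    · rw [SimpleGraph.dist_eq_one_iff_adj.2 h]; simp [edgePt]
    · have : (layoutConf ρ).pt e = 0 := layoutConf_wt_of_not_adj hlen h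
      rw [this]; simp
  rw [layoutInstance_cost, Finset.sum_congr rfl fun e _ => h1 e, sum_edges_mul _ fun _ _ => rfl]
  simp only [one_mul, hg.pairFn_pt, hg.sum_wt hN, Finset.sum_sub_distrib, Finset.sum_ite_eq',
    Finset.mem_univ, if_true, Finset.sum_const, nsmul_eq_mul]
  rw [Finset.card_univ]
  ring

/-- All distances are at least one, so the cost is at least the degree of `s`. The inequality
survives every round; it bounds the values from below and makes the denominator of the gap positive.
-/
lemma layoutInstance_one_le_cost (r : ℕ) : ∀ x ∈ lsPlus^[r] (symPathPolytope
    (⊤ : SimpleGraph V) (layoutInstance ρ).s (layoutInstance ρ).t), 1 ≤ (layoutInstance ρ).cost x := by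
  have hne : Nonempty (⊤ : SimpleGraph V).edgeSet :=
    ⟨⟨s((layoutInstance ρ).s, (layoutInstance ρ).t), by simpa using (layoutInstance ρ).s_ne_t⟩⟩
  intro x hx
  rw [layoutInstance_cost]
  refine le_sum_of_mem_lsPlus_iterate (fun x hx => ?_) r x hx
  have h1 : cutWeight x {(layoutInstance ρ).s} = ∑ e : (⊤ : SimpleGraph V).edgeSet,
      if Crosses {(layoutInstance ρ).s} (e : Sym2 V) then x e else 0 :=
    Finset.sum_congr (Finset.ext fun _ => by simp) fun e _ => if_congr Iff.rfl rfl rfl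
  rw [← hx.degree_source, h1]
  refine Finset.sum_le_sum fun e _ => ?_
  have h2 := one_le_layoutInstance_d (ρ := ρ) e
  have h3 := (hx.mem_Icc e).1
  split_ifs <;> nlinarith

/-- The integrality gap of two cliques joined by two paths. -/
theorem layoutInstance_gap {ℓ r : ℕ} (hℓ : 1 ≤ ℓ) (hlen : ∀ k, ℓ ≤ len k)
    (hr : 4 * r + 9 ≤ 2 * m) :
    (3 * ℓ - 2 : ℝ) / (Fintype.card V - 1) ≤ (layoutInstance ρ).integralityGap r := by
  have hlen1 : ∀ k, 1 ≤ len k := fun k => hℓ.trans (hlen k)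
  have hℓ' : (1 : ℝ) ≤ ℓ := by exact_mod_cast hℓ
  have hst := (layoutInstance ρ).s_ne_t
  have hint : (3 * ℓ - 2 : ℝ) ≤ (layoutInstance ρ).intOpt := by
    apply le_csInf ((symPathInt_nonempty hst).image _)
    rintro _ ⟨x, hx, rfl⟩
    rw [layoutInstance_cost]
    simp only [layoutInstance_d]
    refine le_cost_of_mem_symPathInt layoutGraph_connected hst hlen (pv := pathVertex ρ)
      (Z := fun z v => (ρ v).InZone z) (hgt := fun v => (ρ v).height ℓ) ?_ ?_
      layoutGraph_adj_cases ?_ ?_ ?_ ?_ ?_ hx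
    · simp [layoutInstance]
    · simp [layoutInstance]
    · intro u hu
      rcases h : ρ u with z | p | p <;> rw [h] at hu <;> simp at hu <;> simp [Role.height, hu]
    · intro u hu
      rcases h : ρ u with z | p | p <;> rw [h] at hu <;> simp at hu <;> simp [Role.height, hu, hlen]
    · intro k i hi
      simp only [pathVertex_role k hi]
      rfl
    · intro z k i hi h
      simp only [pathVertex_role k hi, Role.inZone_path] at h
      cases z <;> simp_all
    · intro k i k' i' hi hi' h
      have := congrArg ρ h
      rw [pathVertex_role k hi, pathVertex_role k' hi'] at this
      simp only [Sum.inr.injEq, Sigma.mk.injEq] at this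
      obtain ⟨rfl, h2⟩ := this
      exact ⟨rfl, by simpa using h2⟩
  have hr' : (4 * r + 9 : ℝ) ≤ 2 * m := by exact_mod_cast hr
  have hmem := (layoutConf_good (ρ := ρ) hlen1).pt_mem_iterate hst r fun z => by
    rw [layoutConf_N]; exact hr'
  have hlow := layoutInstance_one_le_cost (ρ := ρ) r
  have hls1 : 1 ≤ (layoutInstance ρ).lsPlusOpt r := by
    apply le_csInf ⟨_, Set.mem_image_of_mem _ hmem⟩
    rintro _ ⟨x, hx, rfl⟩
    exact hlow x hx
  have hls2 : (layoutInstance ρ).lsPlusOpt r ≤ Fintype.card V - 1 := by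
    rw [← layoutInstance_cost_pt (ρ := ρ) hlen1 (by omega)]
    refine csInf_le ⟨1, ?_⟩ (Set.mem_image_of_mem _ hmem)
    rintro _ ⟨x, hx, rfl⟩
    exact hlow x hx
  exact div_le_div₀ (by linarith) hint (by linarith) hls2

end Instance

end


theorem theorem2 :
    ∀ ε : ℝ, 0 < ε → ∃ γ : ℝ, 0 < γ ∧ ∃ N : ℕ, ∀ n : ℕ, N ≤ n → ∀ r : ℕ, (r : ℝ) ≤ γ * n →
      ∃ I : SymPathInstance (Fin n), I.IsGraphMetric ∧ 3 / 2 - ε ≤ I.integralityGap r := by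
  intro ε hε
  -- The `8 * r` vertices spent on segments cost `12 * r` in `3 * ℓ`, and the additive loss is at
  -- most `38 + ε`; either may take half of `ε * n`. The numbers 16 and 52 guarantee `8 * r + 26 ≤
  -- n`.
  refine ⟨min (ε / 24) (1 / 16), by positivity, max 52 ⌈76 / ε + 2⌉₊, fun n hn r hr => ?_⟩
  have hn1 : (52 : ℝ) ≤ n := by exact_mod_cast (le_max_left _ _).trans hn
  have hn2 : 76 / ε + 2 ≤ n := by
    have : ((⌈76 / ε + 2⌉₊ : ℕ) : ℝ) ≤ n := by exact_mod_cast (le_max_right _ _).trans hn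
    exact (Nat.le_ceil _).trans this
  have hn3 : 76 + 2 * ε ≤ ε * n := by
    have := mul_le_mul_of_nonneg_left hn2 hε.le
    rw [mul_add, mul_div_cancel₀ _ hε.ne'] at this
    linarith
  have hr1 : 24 * (r : ℝ) ≤ ε * n := by
    have := hr.trans (mul_le_mul_of_nonneg_right (min_le_left _ _) n.cast_nonneg)
    linarith
  have hr2 : 16 * (r : ℝ) ≤ n := by
    have := hr.trans (mul_le_mul_of_nonneg_right (min_le_right _ _) n.cast_nonneg)
    linarith
  have hrn : 8 * r + 26 ≤ n := by
    have : (8 * r + 26 : ℝ) ≤ n := by linarith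
    exact_mod_cast this
  obtain ⟨k, rfl⟩ := Nat.exists_eq_add_of_le hrn
  -- The two lengths add up to `k + 2` and differ by at most one, to reach either parity of `n`.
  -- With `2 * r + 5` segments per zone the number of vertices is exactly `n`, and each zone has `4
  -- * r + 10` segment ends.
  set len : Bool → ℕ := fun b => if b then (k + 2) / 2 else (k + 3) / 2 with hlen
  have hcard : Fintype.card (Fin (8 * r + 26 + k)) = Fintype.card (Role (2 * r + 5) len) := by
    rw [Role.card, Fintype.card_fin]
    simp only [hlen, if_true, Bool.false_eq_true, if_false]
    omega
  let ρ := Fintype.equivOfCardEq hcard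
  refine ⟨layoutInstance ρ, layoutInstance_isGraphMetric, le_trans ?_
    (layoutInstance_gap (ℓ := (k + 2) / 2) (r := r) (by omega) (fun b => ?_) (by omega))⟩
  · rw [Fintype.card_fin, le_div_iff₀ (by linarith)]
    have h1 : k + 1 ≤ 2 * ((k + 2) / 2) := by omega
    have h2 : (k + 1 : ℝ) ≤ 2 * ((k + 2) / 2 : ℕ) := by exact_mod_cast h1
    push_cast at hn3 hr1 h2 ⊢
    linarith
  · cases b
    · simp only [hlen, Bool.false_eq_true, if_false]
      omega
    · simp [hlen]
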